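/- Let $gl(2)$ be the real Lie algebra with basis $J_3,J_+,J_-,I$ and brackets $[J_3,J_\pm]=\pm2J_\pm$, $[J_+,J_-]=J_3$, $[I,\cdot\,]=0$; write $x\wedge y=x\otimes y-y\otimes x$. Let $a_+\neq0$ and $b_+$ be real numbers. **(1) The Lie bialgebra.** The non-standard cocommutator of family $\mathrm I_+$ with $a=0$, $$\delta(J_3)=a_+J_3\wedge J_++b_+J_+\wedge I,\quad \delta(J_-)=-a_+J_+\wedge J_--\tfrac{b_+}{2}J_3\wedge I,\quad \delta(J_+)=\delta(I)=0,$$ is a Lie bialgebra structure on $gl(2)$; it is the coboundary $\delta(X)=[X\otimes1+1\otimes X,r]$ of $r=\frac12(a_+J_3\wedge J_++b_+J_+\wedge I)$, and $r$ satisfies the classical Yang–Baxter equation. With $J_3'=J_3-\frac{b_+}{a_+}I$ it has the matrix form $$\delta\begin{pmatrix}J_3'\\J_-\end{pmatrix}=N\,\dot\wedge\begin{pmatrix}J_3'\\J_-\end{pmatrix},\qquad N=\begin{pmatrix}-a_+J_+&0\\ \frac{b_+}{2}I&-a_+J_+\end{pmatrix}.$$ **(2) The algebra.** Let $h$ be a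 formal parameter and let $U=U_{a_+,b_+}(gl(2))$ be the $h$-adically complete $\mathbb R[[h]]$-algebra topologically generated by $J_3,J_+,J_-,I$ (the quotient of the $h$-adically complete free algebra by the closed two-sided ideal generated by the relations) with the following relations, in which the deformation parameters are $ha_+$ and $hb_+$: $$[J_3,J_+]=2\,\frac{e^{ha_+J_+}-1}{ha_+},\qquad [J_3,J_-]=-2J_-+\frac{ha_+}{2}\Big(J_3-\frac{b_+}{a_+}I\Big)^2,$$ $$[J_+,J_-]=J_3+hb_+I\,\frac{e^{ha_+J_+}-1}{ha_+},\qquad [I,\cdot\,]=0.$$ The element $$\mathcal C=\Big(J_3-\frac{b_+}{a_+}I\Big)e^{-ha_+J_+}\Big(J_3-\frac{b_+}{a_+}I\Big)+2\frac{b_+}{a_+}J_3I+2\,\frac{1-e^{-ha_+J_+}}{ha_+}J_-+2J_-\frac{1-e^{-ha_+J_+}}{ha_+}+2\big(e^{-ha_+J_+}-1\big)$$ is central in $U$. **(3) The Hopf structure.** There is a topological Hopf algebra structure on $U$ over $\mathbb R[[h]]$ (coproduct with values in the $h$-adically completed tensor product, counit and antipode) such that $J_+$ and $I$ are primitive, the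 counit vanishes on the generators, and the coproduct of $J_3',J_-$ is given by the exponential of the cocommutator matrix: with $(v_1,v_2)=(J_3',J_-)$, $$\Delta(v_i)=1\otimes v_i+\sum_{j}v_j\otimes\big(\exp(-hN)\big)_{ij}.$$ In the original basis, $$\Delta(J_3)=1\otimes J_3+J_3\otimes e^{ha_+J_+}-b_+I\otimes\frac{e^{ha_+J_+}-1}{a_+},$$ $$\Delta(J_-)=1\otimes J_-+J_-\otimes e^{ha_+J_+}-\frac{hb_+}{2}\Big(J_3-\frac{b_+}{a_+}I\Big)\otimes I\,e^{ha_+J_+}.$$ **(4) Quantization.** This Hopf algebra is a quantization of $(gl(2),\delta)$: $U$ is isomorphic to $\mathcal U(gl(2))[[h]]$ as an $\mathbb R[[h]]$-module, where $\mathcal U(gl(2))$ is the universal enveloping algebra; this isomorphism reduces modulo $h$ to an algebra isomorphism $U/hU\cong\mathcal U(gl(2))$ that sends the generators to the generators of the same names and under which $\Delta$, the counit and the antipode become those of $\mathcal U(gl(2))$; and for every $x\in U$ that reduces modulo $h$ to an element $X\in gl(2)$, $\Delta(x)-\sigma\Delta(x)\equiv h\,\delta(X)$ modulo $h^2$, where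 $\sigma$ is the flip. Modulo $h$, $\mathcal C$ becomes $J_3^2+2J_+J_-+2J_-J_++\frac{b_+^2}{a_+^2}I^2$, the Casimir of $gl(2)$ up to a multiple of the central element $I^2$. -/

import Mathlib

open scoped TensorProduct Nat

noncomputable section

/-! ### Topological algebras over `ℝ⟦h⟧` and completed tensor products -/

/-- The ring `ℝ⟦h⟧` of formal power series; the deformation variable `h` is `PowerSeries.X`. -/
abbrev Rh : Type := PowerSeries ℝ

/-- The ideal `hⁿ C` of an `ℝ⟦h⟧`-algebra `C`. -/
abbrev hPow (C : Type) [Ring C] [Algebra Rh C] (n : ℕ) : Ideal C :=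
  Ideal.span {algebraMap Rh C (PowerSeries.X ^ n)}

theorem mem_hPow {C : Type} [Ring C] [Algebra Rh C] {n : ℕ} {x : C} :
    x ∈ hPow C n ↔ ∃ y : C, (PowerSeries.X ^ n : Rh) • y = x := by
  rw [Ideal.mem_span_singleton']
  simp only [Algebra.smul_def, Algebra.commutes]

instance hPow_isTwoSided (C : Type) [Ring C] [Algebra Rh C] (n : ℕ) :
    (hPow C n).IsTwoSided := by
  refine ⟨fun {x} y hx => ?_⟩
  obtain ⟨z, rfl⟩ := mem_hPow.1 hx
  exact mem_hPow.2 ⟨z * y, by rw [smul_mul_assoc]⟩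

/-- The `h`-adic completion `lim C / hⁿ C` of an `ℝ⟦h⟧`-algebra `C`, as the algebra of coherent
sequences in the product of the quotients. -/
def HCompl (C : Type) [Ring C] [Algebra Rh C] : Subalgebra Rh (∀ n : ℕ, C ⧸ hPow C n) where
  carrier := {x | ∀ n, ∃ c : C, ∀ m ≤ n, x m = Ideal.Quotient.mk (hPow C m) c}
  mul_mem' := by
    intro x y hx hy n
    obtain ⟨c, hc⟩ := hx n
    obtain ⟨d, hd⟩ := hy n
    exact ⟨c * d, fun m hm => by simp [hc m hm, hd m hm]⟩
  add_mem' := by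
    intro x y hx hy n
    obtain ⟨c, hc⟩ := hx n
    obtain ⟨d, hd⟩ := hy n
    exact ⟨c + d, fun m hm => by simp [hc m hm, hd m hm]⟩
  algebraMap_mem' := fun r n => ⟨algebraMap Rh C r, fun _ _ => rfl⟩

namespace HCompl

variable {C D : Type} [Ring C] [Algebra Rh C] [Ring D] [Algebra Rh D]

/-- The canonical map of `C` to its completion. -/
def of (C : Type) [Ring C] [Algebra Rh C] : C →ₐ[Rh] HCompl C :=
  (AlgHom.pi fun n => Ideal.Quotient.mkₐ Rh (hPow C n)).codRestrict (HCompl C)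
    fun c _ => ⟨c, fun _ _ => rfl⟩

/-- Two elements of the completion are congruent modulo `hⁿ`. -/
def ModEq (n : ℕ) (x y : HCompl C) : Prop := x.1 n = y.1 n

/-- The map `C / hⁿ C → D / hⁿ D` induced by an `ℝ⟦h⟧`-linear map from `C` to the completion
of `D`. -/
def level (f : C →ₗ[Rh] HCompl D) (n : ℕ) : (C ⧸ hPow C n) →ₗ[Rh] (D ⧸ hPow D n) where
  toFun := QuotientAddGroup.lift (hPow C n).toAddSubgroup
    (((LinearMap.proj n).comp ((HCompl D).val.toLinearMap.comp f)).toAddMonoidHom) (by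
      intro x hx
      obtain ⟨y, rfl⟩ := mem_hPow.1 hx
      obtain ⟨d, hd⟩ := (f y).2 n
      have h1 : ((f ((PowerSeries.X ^ n : Rh) • y)).1 n) =
          Ideal.Quotient.mk (hPow D n) ((PowerSeries.X ^ n : Rh) • d) := by
        rw [map_smul]
        change (PowerSeries.X ^ n : Rh) • ((f y).1 n) = _
        rw [hd n le_rfl]
        rfl
      change (f ((PowerSeries.X ^ n : Rh) • y)).1 n = 0
      rw [h1, Ideal.Quotient.eq_zero_iff_mem]
      exact mem_hPow.2 ⟨d, rfl⟩)
  map_add' := fun x y => map_add _ x y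
  map_smul' := by
    intro r x
    obtain ⟨x, rfl⟩ := Ideal.Quotient.mk_surjective x
    change (f (r • x)).1 n = r • (f x).1 n
    rw [map_smul]
    rfl

theorem level_mk (f : C →ₗ[Rh] HCompl D) (n : ℕ) (c : C) :
    level f n (Ideal.Quotient.mk _ c) = (f c).1 n := rfl

/-- The extension of an `ℝ⟦h⟧`-linear (hence `h`-adically continuous) map from `C` to the
completion of `D` to a map of completions. -/
def extend (f : C →ₗ[Rh] HCompl D) : HCompl C →ₗ[Rh] HCompl D where
  toFun x := ⟨fun n => level f n (x.1 n), by
    intro n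
    obtain ⟨c, hc⟩ := x.2 n
    obtain ⟨d, hd⟩ := (f c).2 n
    exact ⟨d, fun m hm => by rw [← hd m hm, ← level_mk, ← hc m hm]⟩⟩
  map_add' := fun x y => Subtype.ext (funext fun n => map_add (level f n) (x.1 n) (y.1 n))
  map_smul' := fun r x => Subtype.ext (funext fun n => map_smul (level f n) r (x.1 n))

theorem extend_of (f : C →ₗ[Rh] HCompl D) (c : C) : extend f (of C c) = f c := rfl

end HCompl

/-- The completed tensor product `A ⊗̂ B` over `ℝ⟦h⟧`. -/
abbrev CTensor (A B : Type) [Ring A] [Algebra Rh A] [Ring B] [Algebra Rh B] :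
    Subalgebra Rh (∀ n : ℕ, (A ⊗[Rh] B) ⧸ hPow (A ⊗[Rh] B) n) :=
  HCompl (A ⊗[Rh] B)

/-- The element `x ⊗ y` of the completed tensor product. -/
def ctmul {A B : Type} [Ring A] [Algebra Rh A] [Ring B] [Algebra Rh B] (x : A) (y : B) :
    CTensor A B :=
  HCompl.of (A ⊗[Rh] B) (x ⊗ₜ[Rh] y)

/-! ### Topological Hopf algebras -/

section TopHopf

variable {A : Type} [Ring A] [Algebra Rh A]

/-- The map `x ⊗ y ↦ f x * g y`. -/
def mulTensor {B C T : Type} [Ring B] [Algebra Rh B] [Ring C] [Algebra Rh C] [Ring T]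
    [Algebra Rh T] (f : B →ₗ[Rh] T) (g : C →ₗ[Rh] T) : B ⊗[Rh] C →ₗ[Rh] T :=
  TensorProduct.lift ((LinearMap.mul Rh T).compl₁₂ f g)

/-- `Δ ⊗ id`, as a map `A ⊗ A → A ⊗̂ A ⊗̂ A`: `x ⊗ y ↦ (Δ x ⊗ 1) * (1 ⊗ 1 ⊗ y)`. -/
def comulLeft (Δ : A →ₐ[Rh] CTensor A A) : A ⊗[Rh] A →ₗ[Rh] HCompl (A ⊗[Rh] (A ⊗[Rh] A)) :=
  mulTensor
    ((HCompl.extend ((HCompl.of _).comp (Algebra.TensorProduct.map (AlgHom.id Rh A)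
      Algebra.TensorProduct.includeLeft)).toLinearMap).comp Δ.toLinearMap)
    ((HCompl.of _).comp ((Algebra.TensorProduct.includeRight).comp
      Algebra.TensorProduct.includeRight)).toLinearMap

/-- `id ⊗ Δ`, as a map `A ⊗ A → A ⊗̂ A ⊗̂ A`: `x ⊗ y ↦ (x ⊗ 1 ⊗ 1) * (1 ⊗ Δ y)`. -/
def comulRight (Δ : A →ₐ[Rh] CTensor A A) : A ⊗[Rh] A →ₗ[Rh] HCompl (A ⊗[Rh] (A ⊗[Rh] A)) :=
  mulTensor
    ((HCompl.of _).comp Algebra.TensorProduct.includeLeft).toLinearMap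
    ((HCompl.extend ((HCompl.of _).comp
      Algebra.TensorProduct.includeRight).toLinearMap).comp Δ.toLinearMap)

end TopHopf

/-- A topological (`h`-adic) Hopf algebra structure on an `ℝ⟦h⟧`-algebra `A`: a coproduct with
values in the completed tensor product, a counit and an antipode. -/
structure TopHopf (A : Type) [Ring A] [Algebra Rh A] where
  comul : A →ₐ[Rh] CTensor A A
  counit : A →ₐ[Rh] Rh
  antipode : A →ₗ[Rh] A
  coassoc : ∀ x, HCompl.extend (comulLeft comul) (comul x) =
    HCompl.extend (comulRight comul) (comul x)
  counit_comul : ∀ x, HCompl.extend ((HCompl.of A).toLinearMap.comp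
    (mulTensor ((Algebra.ofId Rh A).comp counit).toLinearMap LinearMap.id)) (comul x) =
      HCompl.of A x
  comul_counit : ∀ x, HCompl.extend ((HCompl.of A).toLinearMap.comp
    (mulTensor LinearMap.id ((Algebra.ofId Rh A).comp counit).toLinearMap)) (comul x) =
      HCompl.of A x
  antipode_left : ∀ x, HCompl.extend ((HCompl.of A).toLinearMap.comp
    (mulTensor antipode LinearMap.id)) (comul x) = HCompl.of A (algebraMap Rh A (counit x))
  antipode_right : ∀ x, HCompl.extend ((HCompl.of A).toLinearMap.comp
    (mulTensor LinearMap.id antipode)) (comul x) = HCompl.of A (algebraMap Rh A (counit x))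

/-- The opposite coproduct `σ ∘ Δ`. -/
def TopHopf.comulOp {A : Type} [Ring A] [Algebra Rh A] (T : TopHopf A) (x : A) : CTensor A A :=
  HCompl.extend ((HCompl.of _).toLinearMap.comp (TensorProduct.comm Rh A A).toLinearMap)
    (T.comul x)

/-! ### Power series with coefficients in a real algebra -/

/-- For a real algebra `A`, the algebra `A⟦h⟧` over `ℝ⟦h⟧`. -/
abbrev seriesAlgebra (A : Type) [Ring A] [Algebra ℝ A] : Algebra Rh (PowerSeries A) :=
  (PowerSeries.map (algebraMap ℝ A)).toAlgebra' (by
    intro c x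
    ext n
    simp only [PowerSeries.coeff_mul, PowerSeries.coeff_map]
    rw [← Finset.Nat.sum_antidiagonal_swap]
    exact Finset.sum_congr rfl fun p _ => Algebra.commutes _ _)

/-- `exp(h x)` in `A⟦h⟧`. -/
def hexp {A : Type} [Ring A] [Algebra ℝ A] (x : A) : PowerSeries A :=
  PowerSeries.mk fun n => (n ! : ℝ)⁻¹ • x ^ n

/-- `(exp(h x) - 1) / h` in `A⟦h⟧`. -/
def hexpDiv {A : Type} [Ring A] [Algebra ℝ A] (x : A) : PowerSeries A :=
  PowerSeries.mk fun n => ((n + 1) ! : ℝ)⁻¹ • x ^ (n + 1)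

theorem X_mul_hexpDiv {A : Type} [Ring A] [Algebra ℝ A] (x : A) :
    PowerSeries.X * hexpDiv x = hexp x - 1 := by
  ext n
  cases n with
  | zero => simp [hexp]
  | succ n => simp [hexp, hexpDiv, PowerSeries.coeff_succ_X_mul, PowerSeries.coeff_one]

/-- `exp(h M)` for a square matrix `M` over `A`, as a matrix over `A⟦h⟧`. -/
def hexpMatrix {A : Type} [Ring A] [Algebra ℝ A] (M : Matrix (Fin 2) (Fin 2) A) :
    Matrix (Fin 2) (Fin 2) (PowerSeries A) :=
  fun i j => PowerSeries.mk fun n => (n ! : ℝ)⁻¹ • (M ^ n) i j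

/-! ### Lie bialgebras and their quantizations -/

section LieBialgebra

variable {L : Type} [LieRing L] [LieAlgebra ℝ L]

/-- `x ∧ y = x ⊗ y - y ⊗ x`. -/
def wedge {M : Type} [AddCommGroup M] [Module ℝ M] (x y : M) : M ⊗[ℝ] M :=
  x ⊗ₜ[ℝ] y - y ⊗ₜ[ℝ] x

/-- The operation on the dual space that is dual to `δ`. -/
def dualBracket (δ : L →ₗ[ℝ] L ⊗[ℝ] L) (ξ η : Module.Dual ℝ L) : Module.Dual ℝ L :=
  (TensorProduct.dualDistrib ℝ L L (ξ ⊗ₜ[ℝ] η)).comp δ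

/-- `(L, δ)` is a Lie bialgebra: `δ` is a 1-cocycle and its dual is a Lie bracket. -/
structure IsLieBialgebra (δ : L →ₗ[ℝ] L ⊗[ℝ] L) : Prop where
  cocycle : ∀ x y : L, δ ⁅x, y⁆ = ⁅x, δ y⁆ - ⁅y, δ x⁆
  dual_self : ∀ ξ, dualBracket δ ξ ξ = 0
  dual_jacobi : ∀ ξ η ζ, dualBracket δ ξ (dualBracket δ η ζ) +
    dualBracket δ η (dualBracket δ ζ ξ) + dualBracket δ ζ (dualBracket δ ξ η) = 0

/-- The topological Hopf algebra `(A, T)` over `ℝ⟦h⟧` is a quantization of the Lie bialgebra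
`(L, δ)`, with reduction modulo `h` given by `p : A → U(L)`:
`A` is isomorphic to `U(L)⟦h⟧` as an `ℝ⟦h⟧`-module (hence `h`-adically complete, separated and
torsion-free), compatibly with `p`, so that `p` identifies the algebra `A / h A` with `U(L)`;
modulo `h` the coproduct, the counit and the antipode become those of `U(L)`, for which the
elements of `L` are primitive; and `(Δ x - σ Δ x) / h` reduces to `δ` modulo `h`. -/
structure IsQuantization {A : Type} [Ring A] [Algebra Rh A] (δ : L →ₗ[ℝ] L ⊗[ℝ] L)
    (T : TopHopf A) (p : A →+* UniversalEnvelopingAlgebra ℝ L) : Prop where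
  flat : ∃ Θ : A ≃+ PowerSeries (UniversalEnvelopingAlgebra ℝ L),
    (∀ (s : Rh) (x : A), Θ (s • x) = PowerSeries.map (algebraMap ℝ _) s * Θ x) ∧
    ∀ x, PowerSeries.constantCoeff (Θ x) = p x
  comul_zero : ∀ (X : L) (x : A), p x = UniversalEnvelopingAlgebra.ι ℝ X →
    HCompl.ModEq 1 (T.comul x) (ctmul x 1 + ctmul 1 x)
  counit_zero : ∀ (X : L) (x : A), p x = UniversalEnvelopingAlgebra.ι ℝ X →
    PowerSeries.constantCoeff (T.counit x) = 0
  antipode_zero : ∀ (X : L) (x : A), p x = UniversalEnvelopingAlgebra.ι ℝ X →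
    p (T.antipode x) = -UniversalEnvelopingAlgebra.ι ℝ X
  semiclassical : ∀ (X : L) (x : A), p x = UniversalEnvelopingAlgebra.ι ℝ X →
    ∀ (k : ℕ) (Y Z : Fin k → L) (y z : Fin k → A), δ X = ∑ i, Y i ⊗ₜ[ℝ] Z i →
      (∀ i, p (y i) = UniversalEnvelopingAlgebra.ι ℝ (Y i)) →
      (∀ i, p (z i) = UniversalEnvelopingAlgebra.ι ℝ (Z i)) →
      HCompl.ModEq 2 (T.comul x - T.comulOp x)
        ((PowerSeries.X : Rh) • ∑ i, ctmul (y i) (z i))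

end LieBialgebra

/-! ### The Lie algebra `gl(2)` and its non-standard bialgebra structures -/

/-- `gl(2)` over the real numbers. -/
abbrev GL2 : Type := Matrix (Fin 2) (Fin 2) ℝ

/-- The Lie bracket of `gl(2)` is the commutator of matrices. -/
instance : LieRing GL2 := LieRing.ofAssociativeRing

namespace GL2

def J3 : GL2 := !![1, 0; 0, -1]
def Jp : GL2 := !![0, 1; 0, 0]
def Jm : GL2 := !![0, 0; 1, 0]
def I : GL2 := !![1, 0; 0, 1]

/-- The linear map on `gl(2)` with prescribed values on the basis `J₃, J₊, J₋, I`. -/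
def lin {M : Type} [AddCommGroup M] [Module ℝ M] (m3 mp mm mi : M) : GL2 →ₗ[ℝ] M where
  toFun X := ((X 0 0 - X 1 1) / 2) • m3 + X 0 1 • mp + X 1 0 • mm + ((X 0 0 + X 1 1) / 2) • mi
  map_add' := by
    intro X Y
    simp only [Matrix.add_apply]
    module
  map_smul' := by
    intro r X
    simp only [Matrix.smul_apply, smul_eq_mul, RingHom.id_apply]
    module

theorem lin_basis {M : Type} [AddCommGroup M] [Module ℝ M] (m3 mp mm mi : M) :
    lin m3 mp mm mi J3 = m3 ∧ lin m3 mp mm mi Jp = mp ∧ lin m3 mp mm mi Jm = mm ∧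
      lin m3 mp mm mi I = mi := by
  refine ⟨?_, ?_, ?_, ?_⟩ <;> simp [lin, J3, Jp, Jm, I]

/-- The six-parameter linear map `δ : gl(2) → gl(2) ⊗ gl(2)` in the parameters
`a₊, a₋, b₊, b₋, a, b`. -/
def cocommutator (ap am bp bm a b : ℝ) : GL2 →ₗ[ℝ] GL2 ⊗[ℝ] GL2 :=
  lin
    (ap • wedge J3 Jp + am • wedge J3 Jm + bp • wedge Jp I + bm • wedge Jm I)
    (a • wedge J3 Jp - (bm / 2) • wedge J3 I + am • wedge Jp Jm + b • wedge Jp I)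
    (a • wedge J3 Jm - (bp / 2) • wedge J3 I - ap • wedge Jp Jm - b • wedge Jm I)
    0

/-- The cocommutator of the non-standard family I₊ with parameters `a₊ ≠ 0, b₊, a`. -/
def cocommutatorIplus (ap bp a : ℝ) : GL2 →ₗ[ℝ] GL2 ⊗[ℝ] GL2 :=
  cocommutator ap (-a ^ 2 / ap) bp (bp * a ^ 2 / ap ^ 2) a (bp * a / ap)

/-- The classical `r`-matrix `½ (a₊ J₃ ∧ J₊ + b₊ J₊ ∧ I)`. -/
def rMatrix (ap bp : ℝ) : GL2 ⊗[ℝ] GL2 :=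
  (1 / 2 : ℝ) • (ap • wedge J3 Jp + bp • wedge Jp I)

/-- The classical Yang–Baxter equation `[r₁₂, r₁₃] + [r₁₂, r₂₃] + [r₁₃, r₂₃] = 0`, computed with
the commutators of `gl(2)` as matrices. -/
def CYBE (r : GL2 ⊗[ℝ] GL2) : Prop :=
  let i12 : GL2 ⊗[ℝ] GL2 →ₐ[ℝ] GL2 ⊗[ℝ] (GL2 ⊗[ℝ] GL2) :=
    Algebra.TensorProduct.map (AlgHom.id ℝ GL2) Algebra.TensorProduct.includeLeft
  let i13 : GL2 ⊗[ℝ] GL2 →ₐ[ℝ] GL2 ⊗[ℝ] (GL2 ⊗[ℝ] GL2) :=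
    Algebra.TensorProduct.map (AlgHom.id ℝ GL2) Algebra.TensorProduct.includeRight
  let i23 : GL2 ⊗[ℝ] GL2 →ₐ[ℝ] GL2 ⊗[ℝ] (GL2 ⊗[ℝ] GL2) :=
    Algebra.TensorProduct.includeRight
  ⁅i12 r, i13 r⁆ + ⁅i12 r, i23 r⁆ + ⁅i13 r, i23 r⁆ = 0

/-- The pair of non-primitive generators `J₃' = J₃ - (b₊/a₊) I` and `J₋`. -/
def pair (ap bp : ℝ) : Fin 2 → GL2 := ![J3 - (bp / ap) • I, Jm]

/-- The cocommutator matrix of this pair. -/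
def cocommMatrix (ap bp : ℝ) : Matrix (Fin 2) (Fin 2) GL2 :=
  !![-(ap • Jp), 0; (bp / 2) • I, -(ap • Jp)]

end GL2

/-! ### The quantum algebra `U_{a₊,b₊}(gl(2))` -/

/-- Names for the generators `J₃, J₊, J₋, I`. -/
inductive Gen : Type
  | j3 | jp | jm | i

namespace QGL2

/-- The free real algebra on the four generators. -/
abbrev Free : Type := FreeAlgebra ℝ Gen

/-- `Free⟦h⟧` is the `h`-adically complete free `ℝ⟦h⟧`-algebra on the four generators. -/
instance : Algebra Rh (PowerSeries Free) := seriesAlgebra Free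

/-- The inclusion of `gl(2)`, as the span of the generators, in the free algebra. -/
def freeLin : GL2 →ₗ[ℝ] Free :=
  GL2.lin (FreeAlgebra.ι ℝ Gen.j3) (FreeAlgebra.ι ℝ Gen.jp) (FreeAlgebra.ι ℝ Gen.jm)
    (FreeAlgebra.ι ℝ Gen.i)

/-- A generator, as an element of `Free⟦h⟧`. -/
def fgen (g : Gen) : PowerSeries Free := PowerSeries.C (FreeAlgebra.ι ℝ g)

/-- The deformed commutation rules, written as `left side - right side`, with `a₊`, `b₊`
replaced by `h a₊`, `h b₊`:
`[J₃, J₊] = 2 (e^{h a₊ J₊} - 1) / (h a₊)`,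
`[J₃, J₋] = -2 J₋ + (h a₊ / 2) (J₃ - (b₊/a₊) I)²`,
`[J₊, J₋] = J₃ + h b₊ I (e^{h a₊ J₊} - 1) / (h a₊)`, and `I` commutes with the generators. -/
inductive Rel (ap bp : ℝ) : PowerSeries Free → Prop
  | j3_jp : Rel ap bp (⁅fgen .j3, fgen .jp⁆ -
      (2 : ℝ) • ap⁻¹ • hexpDiv (ap • FreeAlgebra.ι ℝ Gen.jp))
  | j3_jm : Rel ap bp (⁅fgen .j3, fgen .jm⁆ - (-(2 : ℝ) • fgen .jm +
      (ap / 2) • (PowerSeries.X * (fgen .j3 - (bp / ap) • fgen .i) ^ 2)))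
  | jp_jm : Rel ap bp (⁅fgen .jp, fgen .jm⁆ - (fgen .j3 +
      (bp / ap) • (fgen .i * (hexp (ap • FreeAlgebra.ι ℝ Gen.jp) - 1))))
  | i_central (g : Gen) : Rel ap bp ⁅fgen .i, fgen g⁆

/-- The `h`-adic closure of the two-sided ideal generated by the commutation rules, that is, the
intersection over all `n` of the ideals generated by the rules and `hⁿ`. -/
def relIdeal (ap bp : ℝ) : TwoSidedIdeal (PowerSeries Free) :=
  ⨅ n : ℕ, TwoSidedIdeal.span ({x | Rel ap bp x} ∪ {PowerSeries.X ^ n})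

end QGL2

/-- The quantum algebra `U_{a₊,b₊}(gl(2))`: the complete `ℝ⟦h⟧`-algebra topologically generated
by `J₃, J₊, J₋, I` with the deformed commutation rules. -/
def QGL2 (ap bp : ℝ) : Type := (QGL2.relIdeal ap bp).ringCon.Quotient

namespace QGL2

variable (ap bp : ℝ)

instance : Ring (QGL2 ap bp) := inferInstanceAs (Ring (relIdeal ap bp).ringCon.Quotient)

instance : Algebra Rh (QGL2 ap bp) :=
  inferInstanceAs (Algebra Rh (relIdeal ap bp).ringCon.Quotient)

instance : Algebra ℝ (QGL2 ap bp) :=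
  inferInstanceAs (Algebra ℝ (relIdeal ap bp).ringCon.Quotient)

/-- The quotient map. -/
def mk : PowerSeries Free →+* QGL2 ap bp := (relIdeal ap bp).ringCon.mk'

def J3 : QGL2 ap bp := mk ap bp (fgen .j3)
def Jp : QGL2 ap bp := mk ap bp (fgen .jp)
def Jm : QGL2 ap bp := mk ap bp (fgen .jm)
def I : QGL2 ap bp := mk ap bp (fgen .i)

/-- The element of the quantum algebra that an element of `gl(2)` names, as a linear combination
of the generators. -/
def gen (x : GL2) : QGL2 ap bp := mk ap bp (PowerSeries.C (freeLin x))

/-- `e^{c h J₊}`. -/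
def expJp (c : ℝ) : QGL2 ap bp := mk ap bp (hexp (c • FreeAlgebra.ι ℝ Gen.jp))

/-- `(e^{c h J₊} - 1) / h`. -/
def expJpDiv (c : ℝ) : QGL2 ap bp := mk ap bp (hexpDiv (c • FreeAlgebra.ι ℝ Gen.jp))

/-- `exp(h M)` for a matrix `M` with entries in `gl(2)`, over the quantum algebra. -/
def expMatrix (M : Matrix (Fin 2) (Fin 2) GL2) : Matrix (Fin 2) (Fin 2) (QGL2 ap bp) :=
  (hexpMatrix (M.map freeLin)).map (mk ap bp)

/-- The deformed Casimir, with `a₊`, `b₊` replaced by `h a₊`, `h b₊`; here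
`(1 - e^{-h a₊ J₊}) / (h a₊)` is `-a₊⁻¹ • expJpDiv (-a₊)`. -/
def casimir : QGL2 ap bp :=
  (J3 ap bp - (bp / ap) • I ap bp) * expJp ap bp (-ap) * (J3 ap bp - (bp / ap) • I ap bp)
    + (2 * (bp / ap)) • (J3 ap bp * I ap bp)
    + (2 : ℝ) • ((-ap⁻¹ • expJpDiv ap bp (-ap)) * Jm ap bp)
    + (2 : ℝ) • (Jm ap bp * (-ap⁻¹ • expJpDiv ap bp (-ap)))
    + (2 : ℝ) • (expJp ap bp (-ap) - 1)

end QGL2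

end

/-! The quantum algebra is, as an algebra, the undeformed `UGL2` with power series coefficients. Put
q = h a₊/4, β = b₊/a₊, K = J₃ - β I, and write h, e, f, i for the generators of U(gl(2)). The
assignment J₃ ↦ h, I ↦ i, J₊ ↦ -log(1 - h a₊ e)/(h a₊), J₋ ↦ f + q K² respects the deformed rules
(`toSeries_rel`). Modulo h these rules are those of gl(2), so an element of the kernel can be
corrected by relations one power of h at a time, and the kernel is exactly the closed ideal of
relations (`mem_relIdeal_iff`). Surjectivity modulo h and completeness give surjectivity, hence the
isomorphism `equivSeries`. It yields flatness, the reduction modulo h, and a universal property.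

In the variables K, e = (1 - e^{-h a₊ J₊})/(h a₊), M = J₋ and I the rules become polynomial
(`QRel`), and they are equivalent to the rules of gl(2) for (K + β I, e, M - q K², I). A
homomorphism out of the quantum algebra is therefore four elements of a complete algebra satisfying
`QRel`. The coproduct, the counit and the antipode (into the opposite algebra) arise in this way
from `QRel.tensor`, from zero and from `QRel.antipode`; the Hopf axioms are checked on K, e, M, I.
The antipode axiom, whose two sides are not a priori multiplicative, is passed to products by
`extend_antipode_left_mul` and its mirror image.

The coproduct of e makes u = 1 - 4q e group-like, hence also E = e^{h a₊ J₊}. The exponential is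
injective on a complete torsion-free algebra, so J₊ is primitive (`comul_Jp`). Torsion-freeness of
the completed tensor square comes from flatness over the discrete valuation ring ℝ⟦h⟧.

The deformed Casimir equals the undeformed Casimir of (h, e, f, i) plus β² i² (`QRel.casimir_eq`),
which gives both its centrality and its reduction. For the semiclassical limit, E is expanded to
second order; Δ is cocommutative modulo h, so changing a lift by a multiple of h does not affect Δ -
σΔ modulo h². The classical statements are a finite computation on the basis, the cocycle identity
being the Jacobi identity for a coboundary. -/

noncomputable section

/-! ### `h`-adically complete modules -/

/-- An `ℝ⟦h⟧`-module is `h`-adically complete and separated. -/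
class IsHComplete (T : Type) [AddCommGroup T] [Module Rh T] : Prop where
  separated : ∀ x : T, (∀ n : ℕ, ∃ y : T, x = (PowerSeries.X ^ n : Rh) • y) → x = 0
  exists_sum : ∀ f : ℕ → T, ∃ L : T, ∀ n : ℕ, ∃ y : T,
    L = ∑ k ∈ Finset.range n, (PowerSeries.X ^ k : Rh) • f k + (PowerSeries.X ^ n : Rh) • y

section HSum

variable {T T' : Type} [AddCommGroup T] [Module Rh T] [AddCommGroup T'] [Module Rh T']

/-- The sum of the series `∑ hᵏ fₖ`. -/
def hsum [IsHComplete T] (f : ℕ → T) : T := (IsHComplete.exists_sum f).choose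

theorem hsum_spec [IsHComplete T] (f : ℕ → T) (n : ℕ) : ∃ y : T,
    hsum f = ∑ k ∈ Finset.range n, (PowerSeries.X ^ k : Rh) • f k + (PowerSeries.X ^ n : Rh) • y :=
  (IsHComplete.exists_sum f).choose_spec n

theorem eq_hsum [IsHComplete T] {f : ℕ → T} {L : T} (h : ∀ n : ℕ, ∃ y : T,
    L = ∑ k ∈ Finset.range n, (PowerSeries.X ^ k : Rh) • f k + (PowerSeries.X ^ n : Rh) • y) :
    L = hsum f := by
  rw [← sub_eq_zero]
  refine IsHComplete.separated _ fun n => ?_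
  obtain ⟨y, hy⟩ := h n
  obtain ⟨z, hz⟩ := hsum_spec f n
  exact ⟨y - z, by rw [hz]; nth_rewrite 1 [hy]; rw [smul_sub]; abel⟩

/-- Continuity is automatic: an ℝ⟦h⟧-linear map sends a remainder hⁿ y to hⁿ θ(y). -/
theorem map_hsum [IsHComplete T] [IsHComplete T'] (θ : T →ₗ[Rh] T') (f : ℕ → T) :
    θ (hsum f) = hsum fun k => θ (f k) := by
  refine eq_hsum fun n => ?_
  obtain ⟨y, hy⟩ := hsum_spec f n
  exact ⟨θ y, by rw [hy]; simp⟩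

theorem hsum_add [IsHComplete T] (f g : ℕ → T) :
    hsum (fun k => f k + g k) = hsum f + hsum g := by
  refine (eq_hsum fun n => ?_).symm
  obtain ⟨y, hy⟩ := hsum_spec f n
  obtain ⟨z, hz⟩ := hsum_spec g n
  exact ⟨y + z, by rw [hy, hz]; simp only [smul_add, Finset.sum_add_distrib]; abel⟩

/-- A recursion that determines the sum of a series. -/
theorem eq_hsum_of_rec [IsHComplete T] {f L : ℕ → T}
    (h : ∀ m, L m = f m + (PowerSeries.X : Rh) • L (m + 1)) : L 0 = hsum f := by
  refine eq_hsum fun n => ⟨L n, ?_⟩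
  induction n with
  | zero => simp
  | succ n ih =>
    rw [ih, Finset.sum_range_succ, h n, smul_add, ← mul_smul, ← pow_succ]
    abel

theorem hsum_rec [IsHComplete T] (f : ℕ → T) :
    hsum f = f 0 + (PowerSeries.X : Rh) • hsum fun k => f (k + 1) := by
  refine (eq_hsum fun n => ?_).symm
  cases n with
  | zero => exact ⟨f 0 + (PowerSeries.X : Rh) • hsum fun k => f (k + 1), by simp⟩
  | succ n =>
    obtain ⟨y, hy⟩ := hsum_spec (fun k => f (k + 1)) n
    refine ⟨y, ?_⟩
    rw [hy, Finset.sum_range_succ', smul_add, Finset.smul_sum]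
    simp only [← mul_smul, ← pow_succ', pow_zero, one_smul]
    abel

theorem linearMap_hsum_eq_zero [IsHComplete T] [IsHComplete T'] (θ : T →ₗ[Rh] T') (f : ℕ → T)
    (h : ∀ k, θ (f k) = 0) : θ (hsum f) = 0 := by
  refine IsHComplete.separated _ fun n => ?_
  obtain ⟨y, hy⟩ := hsum_spec f n
  exact ⟨θ y, by rw [hy]; simp [h]⟩

/-- Series are finite sums here. This makes each C / hⁿ C an admissible target, so that the
extension principles also apply to reductions modulo hⁿ. -/
theorem isHComplete_of_smul_eq_zero (N : ℕ) (h : ∀ x : T, (PowerSeries.X ^ N : Rh) • x = 0) :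
    IsHComplete T := by
  have h' : ∀ (n : ℕ) (x : T), N ≤ n → (PowerSeries.X ^ n : Rh) • x = 0 := by
    intro n x hn
    obtain ⟨k, rfl⟩ := Nat.exists_eq_add_of_le' hn
    rw [pow_add, mul_smul, h, smul_zero]
  refine ⟨fun x hx => ?_, fun f => ⟨∑ k ∈ Finset.range N, (PowerSeries.X ^ k : Rh) • f k, ?_⟩⟩
  · obtain ⟨y, rfl⟩ := hx N
    exact h y
  · intro n
    rcases le_total n N with hn | hn
    · refine ⟨∑ k ∈ Finset.range (N - n), (PowerSeries.X ^ k : Rh) • f (n + k), ?_⟩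
      obtain ⟨k, rfl⟩ := Nat.exists_eq_add_of_le hn
      rw [Finset.sum_range_add, Finset.smul_sum, Nat.add_sub_cancel_left]
      simp only [← mul_smul, ← pow_add]
    · refine ⟨0, ?_⟩
      obtain ⟨k, rfl⟩ := Nat.exists_eq_add_of_le hn
      rw [Finset.sum_range_add, smul_zero, add_zero, left_eq_add]
      exact Finset.sum_eq_zero fun i _ => h' _ _ (Nat.le_add_right _ _)

theorem IsHComplete.of_linearEquiv [IsHComplete T] (e : T ≃ₗ[Rh] T') : IsHComplete T' := by
  refine ⟨fun x hx => ?_, fun f => ⟨e (hsum fun k => e.symm (f k)), fun n => ?_⟩⟩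
  · rw [← e.symm.map_eq_zero_iff]
    refine IsHComplete.separated _ fun n => ?_
    obtain ⟨y, hy⟩ := hx n
    exact ⟨e.symm y, by rw [hy, map_smul]⟩
  · obtain ⟨y, hy⟩ := hsum_spec (fun k => e.symm (f k)) n
    exact ⟨e y, by rw [hy]; simp⟩

/-- A linear map out of a complete module that is surjective modulo `h` is surjective. -/
theorem surjective_of_surjective_mod_h [IsHComplete T] [IsHComplete T'] (θ : T →ₗ[Rh] T')
    (h : ∀ y, ∃ x y', y = θ x + (PowerSeries.X : Rh) • y') : Function.Surjective θ := by
  choose u v huv using h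
  intro y
  -- Successive approximation: `u` solves the equation modulo h and `v` is the remaining error
  -- divided by h, so the k-th correction is `u` of the k-th iterated error.
  refine ⟨hsum fun k => u (v^[k] y), ?_⟩
  rw [map_hsum]
  refine (eq_hsum_of_rec (L := fun k => v^[k] y) fun m => ?_).symm
  rw [Function.iterate_succ_apply']
  exact huv _

end HSum

section HSumAlgebra

variable {T T' : Type} [Ring T] [Algebra Rh T] [Ring T'] [Algebra Rh T']

theorem mul_hsum [IsHComplete T] (x : T) (f : ℕ → T) : x * hsum f = hsum fun k => x * f k :=
  map_hsum (LinearMap.mulLeft Rh x) f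

theorem hsum_mul [IsHComplete T] (x : T) (f : ℕ → T) : hsum f * x = hsum fun k => f k * x :=
  map_hsum (LinearMap.mulRight Rh x) f

/-- The Cauchy product. The auxiliary `L m` is the part of the product of total degree at least m,
divided by hᵐ: terms with i < m meet a tail of `g`, and the tail of `f` meets all of `g`. -/
theorem hsum_mul_hsum [IsHComplete T] (f g : ℕ → T) :
    hsum f * hsum g = hsum fun n => ∑ p ∈ Finset.HasAntidiagonal.antidiagonal n, f p.1 * g p.2 := by
  have h := eq_hsum_of_rec (f := fun n => ∑ p ∈ Finset.HasAntidiagonal.antidiagonal n, f p.1 * g p.2)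
    (L := fun m => ∑ i ∈ Finset.range m, f i * hsum (fun k => g (k + (m - i))) +
      hsum (fun k => f (k + m)) * hsum g) (fun m => by
      rw [Finset.sum_range_succ, hsum_rec (fun k => f (k + m)), add_mul, zero_add, hsum_rec g,
        Finset.Nat.sum_antidiagonal_eq_sum_range_succ (fun i j => f i * g j),
        Finset.sum_range_succ, Nat.sub_self, Nat.add_sub_cancel_left]
      have h1 : ∀ i ∈ Finset.range m, f i * hsum (fun k => g (k + (m - i))) =
          f i * g (m - i) + (PowerSeries.X : Rh) • (f i * hsum fun k => g (k + (m + 1 - i))) := by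
        intro i hi
        rw [hsum_rec (fun k => g (k + (m - i))), mul_add, mul_smul_comm, zero_add]
        have h2 : ∀ k, k + 1 + (m - i) = k + (m + 1 - i) := by
          have := Finset.mem_range.1 hi
          omega
        simp only [h2]
      rw [Finset.sum_congr rfl h1, Finset.sum_add_distrib]
      simp only [smul_add, mul_add, mul_smul_comm, smul_mul_assoc, Finset.smul_sum,
        add_assoc, add_comm 1 m]
      abel)
  simpa using h

instance [IsHComplete T] : IsHComplete Tᵐᵒᵖ :=
  .of_linearEquiv (MulOpposite.opLinearEquiv Rh : T ≃ₗ[Rh] Tᵐᵒᵖ)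

end HSumAlgebra

/-! ### Completions -/

namespace HCompl

variable {C D : Type} [Ring C] [Algebra Rh C] [Ring D] [Algebra Rh D]

theorem X_pow_smul_mem_hPow (n : ℕ) (x : C) : (PowerSeries.X ^ n : Rh) • x ∈ hPow C n :=
  mem_hPow.2 ⟨x, rfl⟩

theorem X_pow_smul_quotient {m n : ℕ} (h : m ≤ n) (x : C ⧸ hPow C m) :
    (PowerSeries.X ^ n : Rh) • x = 0 := by
  obtain ⟨x, rfl⟩ := Ideal.Quotient.mk_surjective x
  obtain ⟨k, rfl⟩ := Nat.exists_eq_add_of_le h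
  rw [pow_add, mul_smul]
  exact Ideal.Quotient.eq_zero_iff_mem.2 (X_pow_smul_mem_hPow m ((PowerSeries.X ^ k : Rh) • x))

instance (n : ℕ) : IsHComplete (C ⧸ hPow C n) :=
  isHComplete_of_smul_eq_zero n (X_pow_smul_quotient le_rfl)

theorem of_apply (c : C) (n : ℕ) : (of C c).1 n = Ideal.Quotient.mk (hPow C n) c := rfl

/-- The projection to `C / hⁿ C`. -/
def proj (C : Type) [Ring C] [Algebra Rh C] (n : ℕ) : HCompl C →ₐ[Rh] C ⧸ hPow C n :=
  (Pi.evalAlgHom Rh _ n).comp (HCompl C).val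

theorem proj_apply (x : HCompl C) (n : ℕ) : proj C n x = x.1 n := rfl

theorem exists_rep (x : HCompl C) (n : ℕ) :
    ∃ c : C, ∀ m ≤ n, x.1 m = Ideal.Quotient.mk (hPow C m) c := x.2 n

theorem ext_level {x y : HCompl C} (h : ∀ n, x.1 n = y.1 n) : x = y := Subtype.ext (funext h)

instance : IsHComplete (HCompl C) := by
  -- At level m the terms with k ≥ m are killed by hᵏ, so a sum of m terms represents the whole
  -- series there.
  have coh : ∀ f : ℕ → HCompl C, (fun m => ∑ k ∈ Finset.range m,
      (PowerSeries.X ^ k : Rh) • (f k).1 m) ∈ HCompl C := by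
    intro f n
    choose c hc using fun k => exists_rep (f k) n
    refine ⟨∑ k ∈ Finset.range n, (PowerSeries.X ^ k : Rh) • c k, fun m hm => ?_⟩
    obtain ⟨k, rfl⟩ := Nat.exists_eq_add_of_le hm
    rw [Finset.sum_range_add, map_add, map_sum, map_sum,
      Finset.sum_eq_zero (s := Finset.range k), add_zero]
    · exact Finset.sum_congr rfl fun k _ => by rw [hc k m hm]; rfl
    · exact fun i _ => X_pow_smul_quotient (Nat.le_add_right m i) (Ideal.Quotient.mk (hPow C m) _)
  refine ⟨fun x hx => ext_level fun n => ?_, fun f => ⟨⟨_, coh f⟩, fun n => ?_⟩⟩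
  · obtain ⟨y, rfl⟩ := hx n
    exact X_pow_smul_quotient le_rfl (y.1 n)
  · refine ⟨⟨_, coh fun k => f (n + k)⟩, ext_level fun m => ?_⟩
    change _ = proj C m (_ + _)
    rw [map_add, map_sum, map_smul]
    simp only [map_smul, proj_apply]
    rw [Finset.smul_sum]
    simp only [← mul_smul, ← pow_add]
    rw [← Finset.sum_range_add (fun k => (PowerSeries.X ^ k : Rh) • (f k).1 m), add_comm n m,
      Finset.sum_range_add, left_eq_add]
    exact Finset.sum_eq_zero fun i _ => X_pow_smul_quotient (Nat.le_add_right m i) _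

theorem extend_apply (f : C →ₗ[Rh] HCompl D) {x : HCompl C} {n : ℕ} {c : C}
    (h : x.1 n = Ideal.Quotient.mk (hPow C n) c) : (extend f x).1 n = (f c).1 n := by
  change level f n (x.1 n) = _
  rw [h, level_mk]

theorem extend_mul (f : C →ₗ[Rh] HCompl D) (hf : ∀ x y, f (x * y) = f x * f y)
    (x y : HCompl C) : extend f (x * y) = extend f x * extend f y := by
  refine ext_level fun n => ?_
  obtain ⟨c, hc⟩ := exists_rep x n
  obtain ⟨d, hd⟩ := exists_rep y n
  have h : (x * y).1 n = Ideal.Quotient.mk (hPow C n) (c * d) := by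
    rw [map_mul, ← hc n le_rfl, ← hd n le_rfl]; rfl
  rw [extend_apply f h, hf]
  change (f c).1 n * (f d).1 n = (extend f x).1 n * (extend f y).1 n
  rw [extend_apply f (hc n le_rfl), extend_apply f (hd n le_rfl)]

/-- The extension of an algebra homomorphism to the completion. -/
def extendAlgHom (f : C →ₗ[Rh] HCompl D) (h1 : f 1 = 1) (hf : ∀ x y, f (x * y) = f x * f y) :
    HCompl C →ₐ[Rh] HCompl D :=
  AlgHom.ofLinearMap (extend f) (by rw [← map_one (of C), extend_of, h1]) (extend_mul f hf)

/-- The completion of an `h`-torsion free algebra is `h`-torsion free. -/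
theorem X_smul_injective (hC : ∀ x : C, (PowerSeries.X : Rh) • x = 0 → x = 0) (x : HCompl C)
    (hx : (PowerSeries.X : Rh) • x = 0) : x = 0 := by
  refine ext_level fun n => ?_
  -- One extra level is needed: h c ∈ hⁿ⁺¹ C yields only c ∈ hⁿ C.
  obtain ⟨c, hc⟩ := exists_rep x (n + 1)
  have h1 : Ideal.Quotient.mk (hPow C (n + 1)) ((PowerSeries.X : Rh) • c) = 0 := by
    change (PowerSeries.X : Rh) • Ideal.Quotient.mk (hPow C (n + 1)) c = 0
    rw [← hc _ le_rfl]
    exact congrFun (congrArg Subtype.val hx) (n + 1)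
  obtain ⟨d, hd⟩ := mem_hPow.1 (Ideal.Quotient.eq_zero_iff_mem.1 h1)
  rw [hc n (Nat.le_succ n)]
  refine Ideal.Quotient.eq_zero_iff_mem.2 (mem_hPow.2 ⟨d, ?_⟩)
  rw [← sub_eq_zero]
  refine hC _ ?_
  rw [smul_sub, ← mul_smul, ← pow_succ', hd, sub_self]

end HCompl

/-! ### Power series with coefficients in a real algebra -/

section Series

attribute [local instance] seriesAlgebra

variable {S : Type} [Ring S] [Algebra ℝ S]

theorem PowerSeries.series_smul_def (s : Rh) (x : PowerSeries S) :
    s • x = PowerSeries.map (algebraMap ℝ S) s * x := rfl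

theorem PowerSeries.X_pow_smul_series (n : ℕ) (x : PowerSeries S) :
    (PowerSeries.X ^ n : Rh) • x = PowerSeries.X ^ n * x := by
  rw [PowerSeries.series_smul_def, map_pow, PowerSeries.map_X]

theorem PowerSeries.X_smul_series (x : PowerSeries S) :
    (PowerSeries.X : Rh) • x = PowerSeries.X * x := by
  rw [PowerSeries.series_smul_def, PowerSeries.map_X]

theorem PowerSeries.C_smul_series (r : ℝ) (x : PowerSeries S) :
    (PowerSeries.C r : Rh) • x = r • x := by
  ext n
  rw [PowerSeries.series_smul_def, PowerSeries.map_C, PowerSeries.coeff_C_mul,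
    PowerSeries.coeff_smul, Algebra.smul_def]

theorem PowerSeries.coeff_X_pow_smul_series (n m : ℕ) (x : PowerSeries S) :
    PowerSeries.coeff m ((PowerSeries.X ^ n : Rh) • x) =
      if n ≤ m then PowerSeries.coeff (m - n) x else 0 := by
  rw [PowerSeries.X_pow_smul_series, PowerSeries.coeff_X_pow_mul']

theorem PowerSeries.X_smul_series_injective (x : PowerSeries S)
    (h : (PowerSeries.X : Rh) • x = 0) : x = 0 := by
  ext n
  have := congrArg (PowerSeries.coeff (n + 1)) h
  simpa [PowerSeries.X_smul_series, PowerSeries.coeff_succ_X_mul] using this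

/-- The limit is written by coefficients: degree m of ∑ hᵏ fₖ receives the coefficient of degree m -
k of fₖ for each k ≤ m. -/
instance : IsHComplete (PowerSeries S) := by
  refine ⟨fun x hx => ?_, fun f => ⟨PowerSeries.mk fun m => ∑ k ∈ Finset.range (m + 1),
    PowerSeries.coeff (m - k) (f k), fun n => ⟨PowerSeries.mk fun m => ∑ k ∈ Finset.range (m + 1),
    PowerSeries.coeff (m - k) (f (n + k)), ?_⟩⟩⟩
  · ext n
    obtain ⟨y, rfl⟩ := hx (n + 1)
    rw [PowerSeries.coeff_X_pow_smul_series]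
    simp
  · ext m
    simp only [map_add, map_sum, PowerSeries.coeff_X_pow_smul_series, PowerSeries.coeff_mk]
    rcases le_or_gt n m with h | h
    · obtain ⟨k, rfl⟩ := Nat.exists_eq_add_of_le h
      rw [if_pos h, Nat.add_sub_cancel_left, add_assoc, Finset.sum_range_add]
      congr 1
      · refine Finset.sum_congr rfl fun i hi => ?_
        have := Finset.mem_range.1 hi
        rw [if_pos (by omega)]
      · exact Finset.sum_congr rfl fun i hi => by rw [Nat.add_sub_add_left]
    · rw [if_neg (by omega), add_zero]
      obtain ⟨k, rfl⟩ := Nat.exists_eq_add_of_le (Nat.succ_le_of_lt h)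
      rw [Nat.succ_eq_add_one, Finset.sum_range_add _ (m + 1) k, Finset.sum_eq_zero (s := Finset.range k),
        add_zero]
      · refine Finset.sum_congr rfl fun i hi => ?_
        have := Finset.mem_range.1 hi
        rw [if_pos (by omega)]
      · exact fun i _ => if_neg (by omega)

theorem PowerSeries.eq_hsum_coeff (x : PowerSeries S) :
    x = hsum fun k => PowerSeries.C (PowerSeries.coeff k x) := by
  refine Eq.trans (by ext; simp) (eq_hsum_of_rec
    (L := fun m => PowerSeries.mk fun k => PowerSeries.coeff (k + m) x) fun m => ?_)
  ext n
  cases n with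
  | zero => simp [PowerSeries.X_smul_series]
  | succ n =>
    simp [PowerSeries.X_smul_series, PowerSeries.coeff_succ_X_mul,
      Nat.add_assoc, Nat.add_comm 1 m]

theorem algebraMap_eq_hsum {T : Type} [Ring T] [Algebra Rh T] [IsHComplete T] (s : Rh) :
    algebraMap Rh T s = hsum fun k => algebraMap Rh T (PowerSeries.C (PowerSeries.coeff k s)) := by
  refine Eq.trans (by congr 1; ext; simp) (eq_hsum_of_rec
    (L := fun m => algebraMap Rh T (PowerSeries.mk fun k => PowerSeries.coeff (k + m) s))
    fun m => ?_)
  rw [Algebra.smul_def, ← map_mul, ← map_add]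
  congr 1
  ext n
  cases n with
  | zero => simp
  | succ n =>
    simp [PowerSeries.coeff_succ_X_mul, Nat.add_assoc, Nat.add_comm 1 m]

/-- The extension of a ring homomorphism `f : S → T` to an `ℝ⟦h⟧`-algebra homomorphism
`S⟦h⟧ → T`. -/
def PowerSeries.extendScalars {T : Type} [Ring T] [Algebra Rh T] [IsHComplete T] (f : S →+* T)
    (hf : ∀ r : ℝ, f (algebraMap ℝ S r) = algebraMap Rh T (PowerSeries.C r)) :
    PowerSeries S →ₐ[Rh] T where
  toFun x := hsum fun k => f (PowerSeries.coeff k x)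
  map_zero' := (eq_hsum fun n => ⟨0, by simp⟩).symm
  map_one' := by
    rw [← map_one (algebraMap Rh T), algebraMap_eq_hsum]
    congr 1
    ext k
    rw [PowerSeries.coeff_one, PowerSeries.coeff_one, ← hf]
    split_ifs <;> simp
  map_add' := fun x y => by simp only [map_add]; exact hsum_add _ _
  map_mul' := fun x y => by
    rw [hsum_mul_hsum]
    simp only [PowerSeries.coeff_mul, map_sum, map_mul]
  commutes' := fun s => by
    rw [algebraMap_eq_hsum (T := T) s]
    simp only [← hf]
    congr 1

theorem PowerSeries.extendScalars_C {T : Type} [Ring T] [Algebra Rh T] [IsHComplete T]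
    (f : S →+* T) (hf : ∀ r : ℝ, f (algebraMap ℝ S r) = algebraMap Rh T (PowerSeries.C r))
    (s : S) : PowerSeries.extendScalars f hf (PowerSeries.C s) = f s := by
  change hsum _ = _
  rw [hsum_rec]
  simp only [PowerSeries.coeff_C, Nat.succ_ne_zero, if_true, if_false, map_zero]
  have : hsum (fun _ : ℕ => (0 : T)) = 0 := (eq_hsum fun n => ⟨0, by simp⟩).symm
  rw [this, smul_zero, add_zero]

end Series

/-! ### Exponentials in complete algebras -/

section Texp

variable {T T' : Type} [Ring T] [Algebra Rh T] [IsHComplete T] [Ring T'] [Algebra Rh T']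
  [IsHComplete T']

/-- `exp(h x)` in a complete algebra. -/
def texp (x : T) : T := hsum fun n => (PowerSeries.C (n ! : ℝ)⁻¹ : Rh) • x ^ n

/-- `(exp(h x) - 1) / h` in a complete algebra. -/
def texpDiv (x : T) : T := hsum fun n => (PowerSeries.C ((n + 1) ! : ℝ)⁻¹ : Rh) • x ^ (n + 1)

theorem map_texp (θ : T →ₐ[Rh] T') (x : T) : θ (texp x) = texp (θ x) := by
  refine (map_hsum θ.toLinearMap _).trans ?_
  simp [texp]

theorem X_smul_texpDiv (x : T) : (PowerSeries.X : Rh) • texpDiv x = texp x - 1 := by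
  rw [texp, hsum_rec]
  simp [texpDiv]

theorem texp_zero : texp (0 : T) = 1 := by
  refine (eq_hsum fun n => ?_).symm
  cases n with
  | zero => exact ⟨1, by simp⟩
  | succ n => exact ⟨0, by simp [Finset.sum_range_succ']⟩

/-- Compare the binomial theorem with the Cauchy product: a binomial coefficient divided by n! is
1/(i! j!). -/
theorem texp_add {x y : T} (h : Commute x y) : texp (x + y) = texp x * texp y := by
  rw [texp, texp, texp, hsum_mul_hsum]
  congr 1
  ext n
  rw [h.add_pow', Finset.smul_sum]
  refine Finset.sum_congr rfl fun p hp => ?_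
  rw [smul_mul_smul_comm, ← map_mul, ← Nat.cast_smul_eq_nsmul Rh, ← mul_smul]
  congr 1
  rw [← map_natCast PowerSeries.C, ← map_mul]
  congr 1
  rw [← Finset.HasAntidiagonal.mem_antidiagonal.1 hp, Nat.cast_add_choose]
  field_simp

theorem texp_neg_mul_texp (x : T) : texp (-x) * texp x = 1 := by
  rw [← texp_add (Commute.neg_left (Commute.refl x)), neg_add_cancel, texp_zero]

theorem texp_mul_texp_neg (x : T) : texp x * texp (-x) = 1 := by
  rw [← texp_add (Commute.neg_right (Commute.refl x)), add_neg_cancel, texp_zero]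

/-- In a torsion-free complete algebra the exponential is injective. -/
theorem texp_injective (hT : ∀ x : T, (PowerSeries.X : Rh) • x = 0 → x = 0) {x y : T}
    (h : texp x = texp y) : x = y := by
  rw [← sub_eq_zero]
  refine IsHComplete.separated _ fun n => ?_
  -- After cancelling h, equality of exponentials reads x - y = -h (φ(x) - φ(y)) for a power series
  -- φ. If x ≡ y modulo hⁿ, then all powers, and so φ(x) and φ(y), agree modulo hⁿ; the congruence
  -- improves to hⁿ⁺¹.
  have key : ∀ z : T, texp z = 1 + (PowerSeries.X : Rh) • (z + (PowerSeries.X : Rh) •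
      hsum fun n => (PowerSeries.C ((n + 2) ! : ℝ)⁻¹ : Rh) • z ^ (n + 2)) := by
    intro z
    rw [texp, hsum_rec, hsum_rec]
    simp
  rw [key x, key y, add_right_inj, ← sub_eq_zero, ← smul_sub] at h
  replace h := hT _ h
  induction n with
  | zero => exact ⟨x - y, by simp⟩
  | succ n ih =>
    obtain ⟨d, hd⟩ := ih
    have hpow : ∀ k : ℕ, ∃ w : T, x ^ k - y ^ k = (PowerSeries.X ^ n : Rh) • w := by
      intro k
      induction k with
      | zero => exact ⟨0, by simp⟩
      | succ k ih =>
        obtain ⟨w, hw⟩ := ih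
        refine ⟨x ^ k * d + w * y, ?_⟩
        rw [smul_add, ← mul_smul_comm, ← smul_mul_assoc, ← hd, ← hw, pow_succ, pow_succ]
        noncomm_ring
    choose w hw using hpow
    refine ⟨-hsum fun k => (PowerSeries.C ((k + 2) ! : ℝ)⁻¹ : Rh) • w (k + 2), ?_⟩
    have h2 : (hsum fun k => (PowerSeries.C ((k + 2) ! : ℝ)⁻¹ : Rh) • x ^ (k + 2)) -
        (hsum fun k => (PowerSeries.C ((k + 2) ! : ℝ)⁻¹ : Rh) • y ^ (k + 2)) =
        (PowerSeries.X ^ n : Rh) •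
          hsum fun k => (PowerSeries.C ((k + 2) ! : ℝ)⁻¹ : Rh) • w (k + 2) := by
      rw [sub_eq_iff_eq_add]
      refine Eq.trans ?_ (congrArg (· + _)
        (map_hsum (LinearMap.lsmul Rh T (PowerSeries.X ^ n)) _).symm)
      rw [← hsum_add]
      congr 1
      ext k
      rw [LinearMap.lsmul_apply, smul_comm, ← smul_add, ← hw, sub_add_cancel]
    rw [pow_succ', mul_smul, smul_neg, ← h2, ← sub_eq_zero, ← h]
    rw [smul_neg, smul_sub]
    abel

end Texp

section SeriesExp

attribute [local instance] seriesAlgebra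

theorem PowerSeries.extendScalars_hexp {S T : Type} [Ring S] [Algebra ℝ S] [Ring T] [Algebra Rh T]
    [IsHComplete T] (f : S →+* T)
    (hf : ∀ r : ℝ, f (algebraMap ℝ S r) = algebraMap Rh T (PowerSeries.C r)) (x : S) :
    PowerSeries.extendScalars f hf (hexp x) = texp (f x) := by
  change hsum _ = hsum _
  congr 1
  ext n
  rw [hexp, PowerSeries.coeff_mk, Algebra.smul_def, map_mul, hf, map_pow, Algebra.smul_def]

theorem PowerSeries.extendScalars_hexpDiv {S T : Type} [Ring S] [Algebra ℝ S] [Ring T]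
    [Algebra Rh T] [IsHComplete T] (f : S →+* T)
    (hf : ∀ r : ℝ, f (algebraMap ℝ S r) = algebraMap Rh T (PowerSeries.C r)) (x : S) :
    PowerSeries.extendScalars f hf (hexpDiv x) = texpDiv (f x) := by
  change hsum _ = hsum _
  congr 1
  ext n
  rw [hexpDiv, PowerSeries.coeff_mk, Algebra.smul_def, map_mul, hf, map_pow, Algebra.smul_def]

/-- The series `-log(1 - h a x) / (h a)`. -/
def logSeries {S : Type} [Ring S] [Algebra ℝ S] (a : ℝ) (x : S) : PowerSeries S :=
  PowerSeries.mk fun n => (a ^ n / (n + 1)) • x ^ (n + 1)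

/-- The chain rule for d/dh of exp(hQ). Differentiation is not ℝ⟦h⟧-linear, so it is applied to
truncations rather than through `map_hsum`. -/
theorem PowerSeries.derivative_texp {S : Type} [CommRing S] [Algebra ℝ S] (Q : PowerSeries S) :
    PowerSeries.derivative S (texp Q) =
      texp Q * PowerSeries.derivative S (PowerSeries.X * Q) := by
  have hterm : ∀ k : ℕ, (PowerSeries.X ^ k : Rh) • (PowerSeries.C (k ! : ℝ)⁻¹ : Rh) • Q ^ k =
      PowerSeries.C (algebraMap ℝ S (k ! : ℝ)⁻¹) * (PowerSeries.X * Q) ^ k := by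
    intro k
    rw [PowerSeries.X_pow_smul_series, PowerSeries.series_smul_def, PowerSeries.map_C, mul_pow]
    ring
  rw [texp, hsum_mul]
  refine eq_hsum fun n => ?_
  -- Differentiation lowers the order of the remainder by one, so truncating at n + 1 gives a
  -- remainder of order n.
  obtain ⟨y, hy⟩ := hsum_spec (fun n => (PowerSeries.C (n ! : ℝ)⁻¹ : Rh) • Q ^ n) (n + 1)
  refine ⟨((n + 1 : ℕ) : PowerSeries S) * y + PowerSeries.X * PowerSeries.derivative S y, ?_⟩
  rw [hy]
  simp only [← smul_mul_assoc]
  simp only [hterm, PowerSeries.X_pow_smul_series, map_add, map_sum, Derivation.leibniz]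
  rw [Finset.sum_range_succ']
  congr 1
  · have h0 : ∀ r : ℝ, PowerSeries.derivative S (PowerSeries.C (algebraMap ℝ S r)) = 0 :=
      fun r => PowerSeries.derivative_C
    simp only [h0, smul_zero, add_zero, pow_zero, Derivation.map_one_eq_zero]
    refine Finset.sum_congr rfl fun k _ => ?_
    rw [Derivation.leibniz_pow, Derivation.leibniz, nsmul_eq_mul, Nat.add_sub_cancel, smul_eq_mul,
      smul_eq_mul, ← mul_assoc, ← mul_assoc]
    congr 2
    rw [← map_natCast (PowerSeries.C : S →+* PowerSeries S), ← map_mul,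
      ← map_natCast (algebraMap ℝ S), ← map_mul, Nat.factorial_succ]
    congr 2
    push_cast
    field_simp
  · simp only [Derivation.leibniz_pow, PowerSeries.derivative_X, Nat.add_sub_cancel, nsmul_eq_mul,
      smul_eq_mul]
    ring

/-- Both sides solve (1 - h a x) W' = -a x W with constant coefficient 1, and such a solution is
unique. -/
theorem texp_logSeries_comm {S : Type} [CommRing S] [Algebra ℝ S] (a : ℝ) (x : S) :
    texp (-((PowerSeries.C a : Rh) • logSeries a x)) =
      1 - (PowerSeries.X : Rh) • (PowerSeries.C a : Rh) • PowerSeries.C x := by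
  set W := texp (-((PowerSeries.C a : Rh) • logSeries a x)) with hW
  have hlog : PowerSeries.derivative S
      (PowerSeries.X * -((PowerSeries.C a : Rh) • logSeries a x)) =
      -PowerSeries.mk fun n => a ^ (n + 1) • x ^ (n + 1) := by
    ext n
    rw [PowerSeries.coeff_derivative, PowerSeries.coeff_succ_X_mul, PowerSeries.C_smul_series]
    simp only [map_neg, PowerSeries.coeff_smul, logSeries, PowerSeries.coeff_mk]
    rw [← mul_smul, neg_mul, neg_inj, smul_mul_assoc, mul_comm (x ^ _), ← Nat.cast_succ,
      ← Nat.cast_succ, ← nsmul_eq_mul, ← Nat.cast_smul_eq_nsmul ℝ, ← mul_smul]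
    congr 1
    push_cast
    field_simp
    ring
  have hmul : (1 - PowerSeries.X * PowerSeries.C (a • x)) *
      (-PowerSeries.mk fun n => a ^ (n + 1) • x ^ (n + 1)) = -PowerSeries.C (a • x) := by
    ext n
    cases n with
    | zero => simp
    | succ n =>
      simp [sub_mul, mul_assoc, PowerSeries.coeff_succ_X_mul, PowerSeries.coeff_C_mul,
        smul_smul, pow_succ, mul_comm]
  have hD : (1 - PowerSeries.X * PowerSeries.C (a • x)) * PowerSeries.derivative S W =
      -PowerSeries.C (a • x) * W := by
    rw [hW, PowerSeries.derivative_texp, hlog, mul_left_comm, hmul, mul_comm]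
  have hZ : (1 - (PowerSeries.X : Rh) • (PowerSeries.C a : Rh) • PowerSeries.C x) =
      1 - PowerSeries.X * PowerSeries.C (a • x) := by
    rw [PowerSeries.X_smul_series, PowerSeries.C_smul_series]
    congr 2
    ext n
    simp [PowerSeries.coeff_C]
  have hW0 : PowerSeries.coeff 0 W = 1 := by
    rw [hW, texp, hsum_rec, PowerSeries.X_smul_series]
    simp
  -- The difference D solves the same linear equation with D(0) = 0. Its coefficient of degree n +
  -- 1, multiplied by the unit n + 1, is determined by coefficients of degree at most n.
  set D := W - (1 - PowerSeries.X * PowerSeries.C (a • x)) with hDdef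
  have hDZ : PowerSeries.derivative S D =
      PowerSeries.X * (PowerSeries.C (a • x) * PowerSeries.derivative S D) -
        PowerSeries.C (a • x) * D := by
    have h1 : PowerSeries.derivative S (1 - PowerSeries.X * PowerSeries.C (a • x)) =
        -PowerSeries.C (a • x) := by
      simp [Derivation.leibniz, PowerSeries.derivative_C, PowerSeries.derivative_X]
    rw [hDdef, map_sub, h1]
    linear_combination hD
  suffices hD0 : D = 0 by rw [hZ]; exact sub_eq_zero.1 hD0
  have hcoeff : PowerSeries.coeff 0 D = 0 := by
    rw [hDdef, map_sub, hW0]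
    simp
  clear_value D
  ext n
  induction n with
  | zero => exact hcoeff
  | succ n ih =>
    have h := congrArg (PowerSeries.coeff n) hDZ
    rw [map_sub, PowerSeries.coeff_C_mul, ih, PowerSeries.coeff_derivative] at h
    have h2 : PowerSeries.coeff n
        (PowerSeries.X * (PowerSeries.C (a • x) * PowerSeries.derivative S D)) = 0 := by
      cases n with
      | zero => simp
      | succ n =>
        rw [PowerSeries.coeff_succ_X_mul, PowerSeries.coeff_C_mul, PowerSeries.coeff_derivative,
          ih]
        simp
    have hu : IsUnit ((n : S) + 1) := by
      have := (IsUnit.mk0 ((n : ℝ) + 1) (by positivity)).map (algebraMap ℝ S)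
      simpa using this
    rw [h2, map_zero, mul_zero, sub_zero] at h
    exact hu.mul_left_eq_zero.1 h

/-- Only powers of one element occur, so the identity is transported from the commutative ring ℝ[X]
along evaluation at x. -/
theorem texp_logSeries {S : Type} [Ring S] [Algebra ℝ S] (a : ℝ) (x : S) :
    texp (-((PowerSeries.C a : Rh) • logSeries a x)) =
      1 - (PowerSeries.X : Rh) • (PowerSeries.C a : Rh) • PowerSeries.C x := by
  let θ : PowerSeries (Polynomial ℝ) →ₐ[Rh] PowerSeries S :=
    { PowerSeries.map (Polynomial.aeval x : Polynomial ℝ →ₐ[ℝ] S).toRingHom with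
      commutes' := fun s => by
        ext n
        change PowerSeries.coeff n (PowerSeries.map _ (PowerSeries.map _ s)) =
          PowerSeries.coeff n (PowerSeries.map _ s)
        simp }
  have h := congrArg θ (texp_logSeries_comm a Polynomial.X)
  have hlog : θ (logSeries a Polynomial.X) = logSeries a x := by
    ext n
    change PowerSeries.coeff n (PowerSeries.map _ _) = _
    simp [logSeries]
  have hx : θ (PowerSeries.C Polynomial.X) = PowerSeries.C x := by
    change PowerSeries.map _ _ = _
    simp
  rwa [map_texp, map_neg, map_smul, hlog, map_sub, map_one, map_smul, map_smul, hx] at h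

end SeriesExp

/-! ### The universal enveloping algebra of `gl(2)` -/

namespace GL2

/-- Four elements of a ring that satisfy the commutation rules of `J₃, J₊, J₋, I` in `gl(2)`. -/
structure IsRep {T : Type} [Ring T] (h e f i : T) : Prop where
  he : h * e = e * h + 2 * e
  hf : h * f = f * h - 2 * f
  ef : e * f = f * e + h
  ih : i * h = h * i
  ie : i * e = e * i
  fi : f * i = i * f

theorem IsRep.map {T T' : Type} [Ring T] [Ring T'] {h e f i : T} (H : IsRep h e f i)
    (θ : T →+* T') : IsRep (θ h) (θ e) (θ f) (θ i) := by
  constructor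
  · simpa [map_ofNat θ 2] using congrArg θ H.he
  · simpa [map_ofNat θ 2] using congrArg θ H.hf
  · simpa using congrArg θ H.ef
  · simpa using congrArg θ H.ih
  · simpa using congrArg θ H.ie
  · simpa using congrArg θ H.fi

theorem eq_sum (X : GL2) : X = ((X 0 0 - X 1 1) / 2) • J3 + X 0 1 • Jp + X 1 0 • Jm +
    ((X 0 0 + X 1 1) / 2) • I := by
  ext i j
  fin_cases i <;> fin_cases j <;> simp [J3, Jp, Jm, I] <;> ring

theorem linearMap_ext {M : Type} [AddCommGroup M] [Module ℝ M] {u v : GL2 →ₗ[ℝ] M}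
    (h3 : u J3 = v J3) (hp : u Jp = v Jp) (hm : u Jm = v Jm) (hi : u I = v I) : u = v := by
  ext X : 1
  rw [eq_sum X]
  simp only [map_add, map_smul, h3, hp, hm, hi]

attribute [local instance 100] LieRing.ofAssociativeRing

/-- The Lie algebra homomorphism defined by four elements of an associative algebra. -/
def IsRep.lieHom {T : Type} [Ring T] [Algebra ℝ T] {h e f i : T} (H : IsRep h e f i) :
    GL2 →ₗ⁅ℝ⁆ T :=
  { lin h e f i with
    map_lie' := fun {X Y} => by
      change lin h e f i ⁅X, Y⁆ = ⁅lin h e f i X, lin h e f i Y⁆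
      rw [LieRing.of_associative_ring_bracket, LieRing.of_associative_ring_bracket]
      simp only [lin, LinearMap.coe_mk, AddHom.coe_mk, Matrix.sub_apply, Matrix.mul_apply,
        Fin.sum_univ_two, mul_add, add_mul, smul_mul_smul_comm, H.he, H.hf, H.ef, H.ih, H.ie,
        H.fi, two_mul]
      module }

/-- The homomorphism of the enveloping algebra defined by four elements of an algebra. -/
def IsRep.lift {T : Type} [Ring T] [Algebra ℝ T] {h e f i : T} (H : IsRep h e f i) :
    UniversalEnvelopingAlgebra ℝ GL2 →ₐ[ℝ] T :=
  UniversalEnvelopingAlgebra.lift ℝ H.lieHom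

theorem IsRep.lift_ι {T : Type} [Ring T] [Algebra ℝ T] {h e f i : T} (H : IsRep h e f i)
    (X : GL2) : H.lift (UniversalEnvelopingAlgebra.ι ℝ X) = lin h e f i X :=
  UniversalEnvelopingAlgebra.lift_ι_apply ℝ _ X

end GL2

/-- The universal enveloping algebra of `gl(2)`. -/
abbrev UGL2 : Type := UniversalEnvelopingAlgebra ℝ GL2

namespace UGL2

attribute [local instance 100] LieRing.ofAssociativeRing

def h : UGL2 := UniversalEnvelopingAlgebra.ι ℝ GL2.J3
def e : UGL2 := UniversalEnvelopingAlgebra.ι ℝ GL2.Jp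
def f : UGL2 := UniversalEnvelopingAlgebra.ι ℝ GL2.Jm
def i : UGL2 := UniversalEnvelopingAlgebra.ι ℝ GL2.I

theorem isRep : GL2.IsRep h e f i := by
  have key : ∀ X Y : GL2, UniversalEnvelopingAlgebra.ι ℝ X * UniversalEnvelopingAlgebra.ι ℝ Y =
      UniversalEnvelopingAlgebra.ι ℝ Y * UniversalEnvelopingAlgebra.ι ℝ X +
      UniversalEnvelopingAlgebra.ι ℝ (X * Y - Y * X) := by
    intro X Y
    rw [← LieRing.of_associative_ring_bracket, LieHom.map_lie,
      LieRing.of_associative_ring_bracket]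
    abel
  refine ⟨?_, ?_, ?_, ?_, ?_, ?_⟩
  · rw [h, e, key, two_mul, ← map_add]
    congr 2
    ext a b
    fin_cases a <;> fin_cases b <;> norm_num [GL2.J3, GL2.Jp]
  · rw [h, f, key, two_mul, eq_sub_iff_add_eq, add_assoc, ← map_add, ← map_add, add_eq_left,
      ← map_zero (UniversalEnvelopingAlgebra.ι ℝ)]
    congr 1
    ext a b
    fin_cases a <;> fin_cases b <;> norm_num [GL2.J3, GL2.Jm]
  · rw [h, e, f, key]
    congr 2
    ext a b
    fin_cases a <;> fin_cases b <;> norm_num [GL2.J3, GL2.Jm, GL2.Jp]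
  all_goals
    rw [i]
    first | rw [h] | rw [e] | rw [f]
    rw [key, add_eq_left, ← map_zero (UniversalEnvelopingAlgebra.ι ℝ)]
    congr 1
    ext a b
    fin_cases a <;> fin_cases b <;> norm_num [GL2.J3, GL2.Jm, GL2.Jp, GL2.I]

theorem lin_eq_ι (X : GL2) : GL2.lin h e f i X = UniversalEnvelopingAlgebra.ι ℝ X := by
  conv_rhs => rw [GL2.eq_sum X]
  simp only [map_add, map_smul]
  rfl

/-- A property that holds for the generators and is stable under the operations of the algebra
holds for all elements. -/
theorem induction {p : UGL2 → Prop} (hι : ∀ X : GL2, p (UniversalEnvelopingAlgebra.ι ℝ X))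
    (hr : ∀ r : ℝ, p (algebraMap ℝ UGL2 r)) (hadd : ∀ x y, p x → p y → p (x + y))
    (hmul : ∀ x y, p x → p y → p (x * y)) (x : UGL2) : p x := by
  let S : Subalgebra ℝ UGL2 :=
    { carrier := {x | p x}
      mul_mem' := fun {x y} hx hy => hmul x y hx hy
      add_mem' := fun {x y} hx hy => hadd x y hx hy
      algebraMap_mem' := hr }
  -- The generators lie in the subalgebra S, so the universal property gives a map into S; followed
  -- by the inclusion it fixes the generators, hence is the identity, and S is everything.
  have H : GL2.IsRep (⟨h, hι _⟩ : S) ⟨e, hι _⟩ ⟨f, hι _⟩ ⟨i, hι _⟩ := by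
    constructor <;> apply Subtype.ext
    · exact isRep.he
    · exact isRep.hf
    · exact isRep.ef
    · exact isRep.ih
    · exact isRep.ie
    · exact isRep.fi
  have hid : S.val.comp H.lift = AlgHom.id ℝ UGL2 := by
    refine UniversalEnvelopingAlgebra.hom_ext ℝ ?_
    ext X
    refine Eq.trans ?_ (lin_eq_ι X)
    exact congrArg S.val (H.lift_ι X)
  have hx : S.val (H.lift x) = x := DFunLike.congr_fun hid x
  rw [← hx]
  exact (H.lift x).2

end UGL2

theorem GL2.IsRep.h_mul_e_pow {T : Type} [Ring T] {h e f i : T} (H : GL2.IsRep h e f i) (n : ℕ) :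
    h * e ^ n = e ^ n * h + (2 * n : ℕ) • e ^ n := by
  induction n with
  | zero => simp
  | succ n ih =>
    rw [pow_succ, ← mul_assoc, ih, add_mul, mul_assoc, H.he, smul_mul_assoc, mul_add, two_mul,
      mul_add, mul_assoc]
    module

/-- The sl(2) rule that allows the commutator of f with a series in e to be computed
coefficientwise. -/
theorem GL2.IsRep.e_pow_mul_f {T : Type} [Ring T] {h e f i : T} (H : GL2.IsRep h e f i) (n : ℕ) :
    e ^ (n + 1) * f = f * e ^ (n + 1) + (n + 1) • (e ^ n * h) + ((n + 1) * n) • e ^ n := by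
  induction n with
  | zero => simp [H.ef]
  | succ n ih =>
    have h1 : e * f = f * e + h := H.ef
    rw [pow_succ' e (n + 1), mul_assoc, ih, mul_add, mul_add, ← mul_assoc, h1, add_mul,
      H.h_mul_e_pow, mul_smul_comm, mul_smul_comm, ← mul_assoc, ← pow_succ', mul_assoc f e,
      ← pow_succ']
    module

/-! ### The deformed rules for J₋ = f + q K² as consequences of the undeformed ones. -/

section DeformedRelations

variable {k T : Type} [CommRing k] [Ring T] [Algebra k T]

/-- K² commutes with h, so the bracket is still -2f; rewriting f as M - qK² produces the quadratic
term. -/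
theorem lie_j3_jm {h f i : T} (hf : h * f = f * h - 2 * f) (hi : i * h = h * i) (q β : k) :
    h * (f + q • (h - β • i) ^ 2) - (f + q • (h - β • i) ^ 2) * h =
      -(2 : k) • (f + q • (h - β • i) ^ 2) + (2 * q) • (h - β • i) ^ 2 := by
  have hK : Commute h (h - β • i) :=
    (Commute.refl h).sub_right ((show Commute h i from hi.symm).smul_right β)
  rw [mul_add, add_mul, mul_smul_comm, smul_mul_assoc, (hK.pow_right 2).eq, hf, two_mul]
  module

/-- Here P is the image of J₊, E its exponential and G = (E - 1)/(4q). The bracket with qK²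
contributes -4q GK - 2q G'. The last term cancels N, and 4q GK = (E - 1)(h - βi) turns E h into h +
β(E - 1)i. -/
theorem lie_jp_jm {h f i P E N G G' : T} (q β : k) (hPf : P * f - f * P = E * h + N)
    (hP : h * P - P * h = (2 : k) • G) (hG : h * G - G * h = G') (hE : (4 * q) • G = E - 1)
    (hN : (2 * q) • G' = N) (hiP : i * P = P * i) (hiG : i * G = G * i) (hiE : i * E = E * i) :
    P * (f + q • (h - β • i) ^ 2) - (f + q • (h - β • i) ^ 2) * P = h + β • (i * (E - 1)) := by
  obtain ⟨K, hK⟩ : ∃ K, K = h - β • i := ⟨_, rfl⟩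
  have h1 : K * P = P * K + (2 : k) • G := by
    rw [hK, ← hP]
    simp only [sub_mul, mul_sub, smul_mul_assoc, mul_smul_comm, hiP]
    abel
  have h2 : K * G = G * K + G' := by
    rw [hK, ← hG]
    simp only [sub_mul, mul_sub, smul_mul_assoc, mul_smul_comm, hiG]
    abel
  have h3 : K ^ 2 * P = P * K ^ 2 + (4 : k) • (G * K) + (2 : k) • G' := by
    rw [pow_two, mul_assoc, h1, mul_add, ← mul_assoc, h1, mul_smul_comm, h2]
    simp only [add_mul, smul_mul_assoc, mul_assoc]
    module
  have h4 : P * f = f * P + E * h + N := by rw [add_assoc, ← hPf]; abel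
  have h5 : (4 * q) • (G * K) = E * h - β • (E * i) - h + β • i := by
    rw [← smul_mul_assoc, hE, hK, sub_mul, mul_sub, one_mul, mul_smul_comm]
    abel
  have h6 : (P * (f + q • K ^ 2) - (f + q • K ^ 2) * P) =
      E * h + N - (4 * q) • (G * K) - (2 * q) • G' := by
    rw [mul_add, add_mul, h4, mul_smul_comm, smul_mul_assoc, h3]
    module
  rw [← hK, h6, h5, hN, mul_sub, mul_one, hiE]
  module

end DeformedRelations

/-! ### Commutators of power series in e over U(gl(2)). -/

namespace UGL2

instance : Algebra Rh (PowerSeries UGL2) := seriesAlgebra UGL2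

/-- The series `∑ cₙ hⁿ eⁿ⁺¹`. -/
def eSeries (c : ℕ → ℝ) : PowerSeries UGL2 := PowerSeries.mk fun n => c n • e ^ (n + 1)

theorem logSeries_eq (a : ℝ) : logSeries a e = eSeries fun n => a ^ n / (n + 1) := rfl

theorem h_mul_eSeries (c : ℕ → ℝ) : PowerSeries.C h * eSeries c - eSeries c * PowerSeries.C h =
    eSeries fun n => 2 * (n + 1) * c n := by
  ext n
  simp only [eSeries, map_sub, PowerSeries.coeff_C_mul, PowerSeries.coeff_mul_C,
    PowerSeries.coeff_mk, mul_smul_comm, smul_mul_assoc]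
  rw [isRep.h_mul_e_pow]
  module

theorem eSeries_mul_f (c : ℕ → ℝ) : eSeries c * PowerSeries.C f - PowerSeries.C f * eSeries c =
    (PowerSeries.mk fun n => ((n + 1) * c n) • e ^ n) * PowerSeries.C h +
      PowerSeries.mk fun n => ((n + 1) * n * c n) • e ^ n := by
  ext n
  simp only [eSeries, map_sub, map_add, PowerSeries.coeff_C_mul, PowerSeries.coeff_mul_C,
    PowerSeries.coeff_mk, mul_smul_comm, smul_mul_assoc]
  rw [isRep.e_pow_mul_f]
  module

theorem i_mul_eSeries (c : ℕ → ℝ) : PowerSeries.C i * eSeries c = eSeries c * PowerSeries.C i := by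
  ext n
  simp only [eSeries, PowerSeries.coeff_C_mul, PowerSeries.coeff_mul_C,
    PowerSeries.coeff_mk, mul_smul_comm, smul_mul_assoc]
  rw [((show Commute i e from isRep.ie).pow_right _).eq]

end UGL2

/-! ### The homomorphism to U(gl(2))⟦h⟧ and the deformed rules. -/

namespace QGL2

variable (ap bp : ℝ)

/-- `J₃ - (b₊/a₊) I` in `U(gl(2))⟦h⟧`. -/
def K₀ : PowerSeries UGL2 := PowerSeries.C UGL2.h - (bp / ap) • PowerSeries.C UGL2.i

/-- The images of the generators in `U(gl(2))⟦h⟧`. -/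
def genImage : Gen → PowerSeries UGL2
  | .j3 => PowerSeries.C UGL2.h
  | .jp => logSeries ap UGL2.e
  | .jm => PowerSeries.C UGL2.f + (ap / 4) • (PowerSeries.X * K₀ ap bp ^ 2)
  | .i => PowerSeries.C UGL2.i

/-- The homomorphism `Free⟦h⟧ → U(gl(2))⟦h⟧`. -/
def toSeries : PowerSeries Free →ₐ[Rh] PowerSeries UGL2 :=
  PowerSeries.extendScalars (FreeAlgebra.lift ℝ (genImage ap bp) : Free →ₐ[ℝ] PowerSeries UGL2)
    (fun r => (AlgHom.commutes (FreeAlgebra.lift ℝ (genImage ap bp)) r).trans (by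
      rw [Algebra.algebraMap_eq_smul_one, Algebra.algebraMap_eq_smul_one,
        PowerSeries.C_smul_series]))

theorem toSeries_C (x : Free) :
    toSeries ap bp (PowerSeries.C x) = FreeAlgebra.lift ℝ (genImage ap bp) x :=
  PowerSeries.extendScalars_C _ _ x

theorem toSeries_fgen (g : Gen) : toSeries ap bp (fgen g) = genImage ap bp g := by
  rw [fgen, toSeries_C, FreeAlgebra.lift_ι_apply]

theorem toSeries_smul (r : ℝ) (x : PowerSeries Free) :
    toSeries ap bp (r • x) = r • toSeries ap bp x := by
  rw [← PowerSeries.C_smul_series r (toSeries ap bp x)]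
  exact (congrArg _ (PowerSeries.C_smul_series r x).symm).trans (map_smul (toSeries ap bp) _ _)

theorem toSeries_X : toSeries ap bp PowerSeries.X = PowerSeries.X := by
  have h := (toSeries ap bp).commutes PowerSeries.X
  have h1 : algebraMap Rh (PowerSeries Free) PowerSeries.X = PowerSeries.X := PowerSeries.map_X _
  have h2 : algebraMap Rh (PowerSeries UGL2) PowerSeries.X = PowerSeries.X := PowerSeries.map_X _
  rwa [h1, h2] at h

theorem toSeries_hexp (c : ℝ) : toSeries ap bp (hexp (c • FreeAlgebra.ι ℝ Gen.jp)) =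
    texp (c • logSeries ap UGL2.e) := by
  refine (PowerSeries.extendScalars_hexp _ _ _).trans ?_
  congr 1
  change FreeAlgebra.lift ℝ (genImage ap bp) _ = _
  rw [map_smul, FreeAlgebra.lift_ι_apply, genImage]

theorem toSeries_hexpDiv (c : ℝ) : toSeries ap bp (hexpDiv (c • FreeAlgebra.ι ℝ Gen.jp)) =
    texpDiv (c • logSeries ap UGL2.e) := by
  refine (PowerSeries.extendScalars_hexpDiv _ _ _).trans ?_
  congr 1
  change FreeAlgebra.lift ℝ (genImage ap bp) _ = _
  rw [map_smul, FreeAlgebra.lift_ι_apply, genImage]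

/-- The reason for the logarithm: the exponential of -h a₊ J₊ becomes linear in e, and its inverse a
geometric series. -/
theorem texp_neg_logSeries : texp ((-ap) • logSeries ap UGL2.e) =
    1 - PowerSeries.X * (ap • PowerSeries.C UGL2.e) := by
  have h := texp_logSeries ap UGL2.e
  rw [PowerSeries.C_smul_series, ← neg_smul] at h
  refine h.trans ?_
  rw [PowerSeries.X_smul_series, PowerSeries.C_smul_series]

theorem texp_logSeries_eq_mk : texp (ap • logSeries ap UGL2.e) =
    PowerSeries.mk fun n => ap ^ n • UGL2.e ^ n := by
  have h1 := texp_mul_texp_neg (ap • logSeries ap UGL2.e)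
  rw [← neg_smul, texp_neg_logSeries] at h1
  have h2 : (1 - PowerSeries.X * (ap • PowerSeries.C UGL2.e)) *
      (PowerSeries.mk fun n => ap ^ n • UGL2.e ^ n) = 1 := by
    ext n
    cases n with
    | zero => simp
    | succ n =>
      simp [sub_mul, mul_assoc, PowerSeries.coeff_succ_X_mul, PowerSeries.coeff_one,
        PowerSeries.coeff_C_mul, smul_smul, pow_succ']
  exact left_inv_eq_right_inv h1 h2

/-- Division by h is avoided: both sides are compared after multiplication by h, which is injective
on power series. -/
theorem texpDiv_logSeries : texpDiv (ap • logSeries ap UGL2.e) =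
    ap • UGL2.eSeries fun n => ap ^ n := by
  rw [← sub_eq_zero]
  refine PowerSeries.X_smul_series_injective _ ?_
  have h := X_smul_texpDiv (ap • logSeries ap UGL2.e)
  rw [smul_sub, sub_eq_zero]
  refine h.trans ?_
  rw [PowerSeries.X_smul_series, mul_smul_comm, texp_logSeries_eq_mk]
  ext n
  cases n with
  | zero => simp
  | succ n => simp [UGL2.eSeries, PowerSeries.coeff_succ_X_mul, PowerSeries.coeff_one, smul_smul,
      pow_succ']

theorem X_mul_smul_eq (r : ℝ) (x : PowerSeries UGL2) :
    r • (PowerSeries.X * x) = (PowerSeries.X * PowerSeries.C r : Rh) • x := by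
  rw [mul_smul, PowerSeries.C_smul_series, PowerSeries.X_smul_series, mul_smul_comm]

theorem genImage_jm : genImage ap bp .jm = PowerSeries.C UGL2.f +
    (PowerSeries.X * PowerSeries.C (ap / 4) : Rh) • (PowerSeries.C UGL2.h -
      (PowerSeries.C (bp / ap) : Rh) • PowerSeries.C UGL2.i) ^ 2 := by
  rw [genImage, X_mul_smul_eq, K₀, PowerSeries.C_smul_series]

/-- All deformed rules already hold for suitable elements of U(gl(2))⟦h⟧, so the deformation is
trivial as an algebra. -/
theorem toSeries_rel {x : PowerSeries Free} (hap : ap ≠ 0) (hx : Rel ap bp x) :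
    toSeries ap bp x = 0 := by
  have hrep := UGL2.isRep.map (PowerSeries.C (R := UGL2))
  cases hx with
  | j3_jp =>
    rw [Ring.lie_def, map_sub, map_sub, map_mul, map_mul, toSeries_smul, toSeries_smul,
      toSeries_hexpDiv, texpDiv_logSeries, toSeries_fgen, toSeries_fgen, genImage, genImage,
      UGL2.logSeries_eq, UGL2.h_mul_eSeries, inv_smul_smul₀ hap, sub_eq_zero]
    ext n
    simp only [UGL2.eSeries, PowerSeries.coeff_smul, PowerSeries.coeff_mk, smul_smul]
    congr 1
    field_simp
  | j3_jm =>
    rw [Ring.lie_def, map_sub, map_sub, map_mul, map_mul, map_add, toSeries_smul, toSeries_smul,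
      map_mul, map_pow, map_sub, toSeries_smul, toSeries_X, toSeries_fgen, toSeries_fgen,
      toSeries_fgen, genImage_jm, genImage, genImage, sub_eq_zero, lie_j3_jm hrep.hf hrep.ih,
      X_mul_smul_eq, ← PowerSeries.C_smul_series (bp / ap), ← PowerSeries.C_smul_series (-2)]
    congr 2
    · rw [map_neg, map_ofNat]
    · rw [mul_left_comm, ← map_ofNat PowerSeries.C 2, ← map_mul]
      congr 2
      ring
  | jp_jm =>
    rw [Ring.lie_def, map_sub, map_sub, map_mul, map_mul, map_add, toSeries_smul, map_mul, map_sub,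
      map_one, toSeries_hexp, toSeries_fgen, toSeries_fgen, toSeries_fgen, toSeries_fgen,
      genImage_jm, genImage, genImage, genImage, sub_eq_zero, texp_logSeries_eq_mk,
      ← PowerSeries.C_smul_series (bp / ap), UGL2.logSeries_eq]
    -- The commutators with e^{n+1} produce the factor n + 1 that cancels the denominator of the
    -- logarithm; this leaves E h + N with E the geometric series and N = ∑ n a₊ⁿ hⁿ eⁿ.
    have h1 : ∀ n : ℕ, ((n : ℝ) + 1) * (ap ^ n / (n + 1)) = ap ^ n := fun n => by field_simp
    have hPf := UGL2.eSeries_mul_f fun n => ap ^ n / (n + 1)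
    have hP := UGL2.h_mul_eSeries fun n => ap ^ n / (n + 1)
    simp only [mul_assoc, mul_left_comm ((_ : ℝ) + 1), h1] at hPf hP
    refine lie_jp_jm _ _ hPf (G := UGL2.eSeries fun n => ap ^ n) ?_
      (UGL2.h_mul_eSeries _) ?_ ?_ (UGL2.i_mul_eSeries _) (UGL2.i_mul_eSeries _) ?_
    · rw [hP, ← map_ofNat PowerSeries.C 2, PowerSeries.C_smul_series]
      ext n
      simp only [UGL2.eSeries, PowerSeries.coeff_smul, PowerSeries.coeff_mk, smul_smul]
    · have h4 : (4 * (PowerSeries.X * PowerSeries.C (ap / 4)) : Rh) =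
          PowerSeries.X * PowerSeries.C ap := by
        rw [mul_left_comm, ← map_ofNat PowerSeries.C 4, ← map_mul]
        congr 2
        ring
      rw [h4, ← X_mul_smul_eq]
      ext n
      cases n with
      | zero => simp
      | succ n => simp [UGL2.eSeries, PowerSeries.coeff_succ_X_mul, PowerSeries.coeff_one,
          smul_smul, pow_succ']
    · have h4 : (2 * (PowerSeries.X * PowerSeries.C (ap / 4)) : Rh) =
          PowerSeries.X * PowerSeries.C (ap / 2) := by
        rw [mul_left_comm, ← map_ofNat PowerSeries.C 2, ← map_mul]
        congr 2
        ring
      rw [h4, ← X_mul_smul_eq]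
      ext n
      cases n with
      | zero => simp
      | succ n =>
        simp only [UGL2.eSeries, PowerSeries.coeff_succ_X_mul, PowerSeries.coeff_smul,
          PowerSeries.coeff_mk, smul_smul]
        congr 1
        push_cast
        ring
    · ext n
      simp only [PowerSeries.coeff_C_mul, PowerSeries.coeff_mul_C, PowerSeries.coeff_mk,
        mul_smul_comm, smul_mul_assoc]
      rw [((show Commute UGL2.i UGL2.e from UGL2.isRep.ie).pow_right _).eq]
  | i_central g =>
    rw [Ring.lie_def, map_sub, map_mul, map_mul, toSeries_fgen, toSeries_fgen, sub_eq_zero]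
    cases g with
    | j3 => exact hrep.ih
    | jp => exact UGL2.i_mul_eSeries _
    | jm =>
      rw [genImage_jm, genImage]
      refine Commute.add_right hrep.fi.symm (Commute.smul_right (Commute.pow_right
        (Commute.sub_right hrep.ih (Commute.smul_right (Commute.refl _) _)) _) _)
    | i => rfl

end QGL2

/-! ### The kernel is the closed ideal of relations; the isomorphism with U(gl(2))⟦h⟧. -/

namespace QGL2

variable (ap bp : ℝ)

/-- The homomorphism from the free algebra to the enveloping algebra. -/
def freeToU : Free →ₐ[ℝ] UGL2 :=
  FreeAlgebra.lift ℝ (fun | .j3 => UGL2.h | .jp => UGL2.e | .jm => UGL2.f | .i => UGL2.i)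

theorem constantCoeff_toSeries (x : PowerSeries Free) :
    PowerSeries.constantCoeff (toSeries ap bp x) = freeToU (PowerSeries.constantCoeff x) := by
  let ε : PowerSeries UGL2 →ₐ[ℝ] UGL2 :=
    { PowerSeries.constantCoeff (R := UGL2) with
      commutes' := fun r => by
        rw [Algebra.algebraMap_eq_smul_one, Algebra.algebraMap_eq_smul_one]
        change PowerSeries.constantCoeff _ = _
        rw [PowerSeries.constantCoeff_smul, map_one] }
  have hε : ε.comp (FreeAlgebra.lift ℝ (genImage ap bp)) = freeToU := by
    refine FreeAlgebra.hom_ext ?_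
    ext g
    simp only [Function.comp_apply, AlgHom.comp_apply, FreeAlgebra.lift_ι_apply, freeToU]
    change PowerSeries.constantCoeff _ = _
    cases g <;> simp [genImage, logSeries]
  rw [← DFunLike.congr_fun hε]
  nth_rewrite 1 [PowerSeries.eq_X_mul_shift_add_const x]
  rw [map_add, map_mul, toSeries_X, toSeries_C, map_add, map_mul]
  simp
  rfl

theorem toSeries_eq_zero_of_mem_span (hap : ap ≠ 0) {x : PowerSeries Free}
    (hx : x ∈ TwoSidedIdeal.span {x | Rel ap bp x}) : toSeries ap bp x = 0 := by
  rw [← TwoSidedIdeal.mem_ker]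
  exact TwoSidedIdeal.span_le.2
    (fun y hy => (TwoSidedIdeal.mem_ker _).2 (toSeries_rel ap bp hap hy)) hx

/-- The closure adds hⁿ to the generators of the ideal, so vanishing is proved modulo each hⁿ and
separatedness concludes. -/
theorem toSeries_eq_zero_of_mem (hap : ap ≠ 0) {x : PowerSeries Free}
    (hx : x ∈ relIdeal ap bp) : toSeries ap bp x = 0 := by
  refine IsHComplete.separated _ fun n => ?_
  let θ := (Ideal.Quotient.mkₐ Rh (hPow (PowerSeries UGL2) n)).comp (toSeries ap bp)
  have h1 : x ∈ TwoSidedIdeal.ker θ := by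
    refine TwoSidedIdeal.span_le.2 ?_ ((TwoSidedIdeal.mem_iInf _).1 hx n)
    rintro y (hy | rfl)
    · refine (TwoSidedIdeal.mem_ker _).2 ?_
      change Ideal.Quotient.mk _ (toSeries ap bp y) = 0
      rw [toSeries_rel ap bp hap hy, map_zero]
    · refine (TwoSidedIdeal.mem_ker _).2 (Ideal.Quotient.eq_zero_iff_mem.2 (mem_hPow.2 ⟨1, ?_⟩))
      change _ = toSeries ap bp (PowerSeries.X ^ n)
      rw [map_pow, toSeries_X, PowerSeries.X_pow_smul_series, mul_one]
  obtain ⟨y, hy⟩ := mem_hPow.1 (Ideal.Quotient.eq_zero_iff_mem.1 ((TwoSidedIdeal.mem_ker _).1 h1))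
  exact ⟨y, hy.symm⟩

/-- The two-sided ideal of the reductions modulo `h` of the relations. -/
def relIdeal₀ : TwoSidedIdeal Free :=
  .mk' {x | ∃ r ∈ TwoSidedIdeal.span {x | Rel ap bp x}, PowerSeries.constantCoeff r = x}
    ⟨0, TwoSidedIdeal.zero_mem _, map_zero _⟩
    (by
      rintro _ _ ⟨r, hr, rfl⟩ ⟨s, hs, rfl⟩
      exact ⟨r + s, TwoSidedIdeal.add_mem _ hr hs, map_add _ _ _⟩)
    (by
      rintro _ ⟨r, hr, rfl⟩
      exact ⟨-r, TwoSidedIdeal.neg_mem _ hr, map_neg _ _⟩)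
    (by
      rintro x _ ⟨r, hr, rfl⟩
      exact ⟨PowerSeries.C x * r, TwoSidedIdeal.mul_mem_left _ _ _ hr, by simp⟩)
    (by
      rintro _ y ⟨r, hr, rfl⟩
      exact ⟨r * PowerSeries.C y, TwoSidedIdeal.mul_mem_right _ _ _ hr, by simp⟩)

theorem mem_relIdeal₀ {x : Free} : x ∈ relIdeal₀ ap bp ↔
    ∃ r ∈ TwoSidedIdeal.span {x | Rel ap bp x}, PowerSeries.constantCoeff r = x :=
  TwoSidedIdeal.mem_mk' _ _ _ _ _ _ _

/-- In the quotient by the reduced relations the generators satisfy the rules of gl(2). The quotient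
map therefore factors through U(gl(2)), and its kernel contains that of `freeToU`. -/
theorem mem_relIdeal₀_of_freeToU (hap : ap ≠ 0) {x : Free} (hx : freeToU x = 0) :
    x ∈ relIdeal₀ ap bp := by
  let π : Free →ₐ[ℝ] (relIdeal₀ ap bp).ringCon.Quotient := (relIdeal₀ ap bp).ringCon.mkₐ ℝ
  have hπ : ∀ y, π y = 0 ↔ y ∈ relIdeal₀ ap bp := by
    intro y
    rw [← TwoSidedIdeal.mem_ker (f := π)]
    have h := TwoSidedIdeal.ker_ringCon_mk' (relIdeal₀ ap bp)
    exact ⟨fun hy => h ▸ hy, fun hy => h.symm ▸ hy⟩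
  have hrel : ∀ r, Rel ap bp r → π (PowerSeries.constantCoeff r) = 0 := fun r hr =>
    (hπ _).2 ((mem_relIdeal₀ ap bp).2 ⟨r, TwoSidedIdeal.subset_span hr, rfl⟩)
  let t : Gen → (relIdeal₀ ap bp).ringCon.Quotient := fun g => π (FreeAlgebra.ι ℝ g)
  have hcomm : ∀ g, t .i * t g = t g * t .i := by
    intro g
    have h := hrel _ (Rel.i_central g)
    simpa [Ring.lie_def, fgen, sub_eq_zero] using h
  have H : GL2.IsRep (t .j3) (t .jp) (t .jm) (t .i) := by
    refine ⟨?_, ?_, ?_, hcomm _, hcomm _, (hcomm _).symm⟩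
    · have h := hrel _ Rel.j3_jp
      simp [Ring.lie_def, fgen, hexpDiv, smul_smul, hap] at h
      rw [ofNat_smul_eq_nsmul, two_nsmul] at h
      rw [two_mul, ← sub_eq_zero, ← h]
      abel
    · have h := hrel _ Rel.j3_jm
      simp [Ring.lie_def, fgen] at h
      rw [ofNat_smul_eq_nsmul, two_nsmul] at h
      rw [two_mul, ← sub_eq_zero, ← h]
      abel
    · have h := hrel _ Rel.jp_jm
      simp [Ring.lie_def, fgen, hexp] at h
      rw [← sub_eq_zero, ← h]
      abel
  have hcomp : H.lift.comp freeToU = π := by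
    refine FreeAlgebra.hom_ext ?_
    ext g
    simp only [Function.comp_apply, AlgHom.comp_apply, FreeAlgebra.lift_ι_apply, freeToU]
    obtain ⟨h1, h2, h3, h4⟩ := GL2.lin_basis (t .j3) (t .jp) (t .jm) (t .i)
    cases g
    · exact (H.lift_ι _).trans h1
    · exact (H.lift_ι _).trans h2
    · exact (H.lift_ι _).trans h3
    · exact (H.lift_ι _).trans h4
  rw [← hπ, ← hcomp, AlgHom.comp_apply, hx, map_zero]

/-- The constant coefficient of a kernel element y is that of some s in the ideal. Then y - s = h z,
and z is again in the kernel because U(gl(2))⟦h⟧ has no h-torsion; so the process repeats. -/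
theorem exists_span_of_toSeries_eq_zero (hap : ap ≠ 0) {x : PowerSeries Free}
    (hx : toSeries ap bp x = 0) (n : ℕ) : ∃ r ∈ TwoSidedIdeal.span {x | Rel ap bp x},
      ∃ y, x = r + PowerSeries.X ^ n * y ∧ toSeries ap bp y = 0 := by
  induction n with
  | zero => exact ⟨0, TwoSidedIdeal.zero_mem _, x, by simp, hx⟩
  | succ n ih =>
    obtain ⟨r, hr, y, rfl, hy⟩ := ih
    have h0 : freeToU (PowerSeries.constantCoeff y) = 0 := by
      rw [← constantCoeff_toSeries ap bp, hy, map_zero]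
    obtain ⟨s, hs, hsy⟩ := (mem_relIdeal₀ ap bp).1 (mem_relIdeal₀_of_freeToU ap bp hap h0)
    obtain ⟨z, hz⟩ := PowerSeries.X_dvd_iff.2
      (show PowerSeries.constantCoeff (y - s) = 0 by rw [map_sub, hsy, sub_self])
    refine ⟨r + PowerSeries.X ^ n * s,
      TwoSidedIdeal.add_mem _ hr (TwoSidedIdeal.mul_mem_left _ _ _ hs), z, ?_, ?_⟩
    · rw [pow_succ, mul_assoc, ← hz, mul_sub]
      abel
    · refine PowerSeries.X_smul_series_injective _ ?_
      rw [PowerSeries.X_smul_series, ← toSeries_X ap bp, ← map_mul, ← hz, map_sub, hy,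
        toSeries_eq_zero_of_mem_span ap bp hap hs, sub_zero]

/-- This is the flatness of the deformation: no relations arise beyond those forced by completion.
-/
theorem mem_relIdeal_iff (hap : ap ≠ 0) {x : PowerSeries Free} :
    x ∈ relIdeal ap bp ↔ toSeries ap bp x = 0 := by
  refine ⟨toSeries_eq_zero_of_mem ap bp hap, fun hx => (TwoSidedIdeal.mem_iInf _).2 fun n => ?_⟩
  obtain ⟨r, hr, y, rfl, -⟩ := exists_span_of_toSeries_eq_zero ap bp hap hx n
  exact TwoSidedIdeal.add_mem _ (TwoSidedIdeal.span_mono Set.subset_union_left hr)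
    (TwoSidedIdeal.mul_mem_right _ _ _ (TwoSidedIdeal.subset_span (Or.inr rfl)))

theorem freeToU_surjective : Function.Surjective freeToU := by
  intro u
  induction u using UGL2.induction with
  | hι X =>
    refine ⟨freeLin X, ?_⟩
    rw [← UGL2.lin_eq_ι]
    simp [freeLin, GL2.lin, freeToU]
  | hr r => exact ⟨algebraMap ℝ _ r, AlgHom.commutes _ _⟩
  | hadd x y hx hy =>
    obtain ⟨a, rfl⟩ := hx
    obtain ⟨b, rfl⟩ := hy
    exact ⟨a + b, map_add _ _ _⟩
  | hmul x y hx hy =>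
    obtain ⟨a, rfl⟩ := hx
    obtain ⟨b, rfl⟩ := hy
    exact ⟨a * b, map_mul _ _ _⟩

instance : IsHComplete (PowerSeries Free) := inferInstance

theorem toSeries_surjective : Function.Surjective (toSeries ap bp) := by
  refine surjective_of_surjective_mod_h (toSeries ap bp).toLinearMap fun y => ?_
  obtain ⟨u, hu⟩ := freeToU_surjective (PowerSeries.constantCoeff y)
  obtain ⟨z, hz⟩ := PowerSeries.X_dvd_iff.2
    (show PowerSeries.constantCoeff (y - toSeries ap bp (PowerSeries.C u)) = 0 by
      rw [map_sub, constantCoeff_toSeries, PowerSeries.constantCoeff_C, hu, sub_self])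
  exact ⟨PowerSeries.C u, z, by rw [PowerSeries.X_smul_series, ← hz]; simp⟩

/-- The homomorphism from the quantum algebra to `U(gl(2))⟦h⟧`. -/
def toSeriesQuot (hap : ap ≠ 0) : QGL2 ap bp →ₐ[Rh] PowerSeries UGL2 :=
  (relIdeal ap bp).ringCon.liftₐ (toSeries ap bp) (by
    intro x y hxy
    change toSeries ap bp x = toSeries ap bp y
    rw [← sub_eq_zero, ← map_sub]
    exact toSeries_eq_zero_of_mem ap bp hap (((relIdeal ap bp).rel_iff x y).1 hxy))

theorem mk_surjective : Function.Surjective (mk ap bp) := RingCon.mk'_surjective _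

theorem mk_eq_zero {x : PowerSeries Free} (hx : x ∈ relIdeal ap bp) : mk ap bp x = 0 := by
  rw [← TwoSidedIdeal.ker_ringCon_mk' (relIdeal ap bp)] at hx
  exact (TwoSidedIdeal.mem_ker _).1 hx

/-- The quantum algebra is isomorphic to `U(gl(2))⟦h⟧`. -/
def equivSeries (hap : ap ≠ 0) : QGL2 ap bp ≃ₐ[Rh] PowerSeries UGL2 :=
  AlgEquiv.ofBijective (toSeriesQuot ap bp hap) (by
    constructor
    · rw [injective_iff_map_eq_zero]
      intro x hx
      obtain ⟨x, rfl⟩ := mk_surjective ap bp x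
      exact mk_eq_zero ap bp ((mem_relIdeal_iff ap bp hap).2 hx)
    · intro y
      obtain ⟨x, rfl⟩ := toSeries_surjective ap bp y
      exact ⟨mk ap bp x, rfl⟩)

theorem equivSeries_mk (hap : ap ≠ 0) (x : PowerSeries Free) :
    equivSeries ap bp hap (mk ap bp x) = toSeries ap bp x := rfl

end QGL2

/-! ### The commutation rules in rational form -/

section QRel

set_option linter.unusedSimpArgs false

variable {k A : Type} [CommRing k] [Ring A] [Algebra k A]

/-- The rules satisfied by `K = J₃ - β I`, `e = (1 - e^{-4 q J₊}) / 4 q`, `M = J₋` and `I` in the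
quantum algebra, where `q = h a₊ / 4` and `β = b₊ / a₊`. -/
structure QRel (q β : k) (K e M i : A) : Prop where
  Ke : K * e = e * K + (2 : k) • e
  KM : K * M = M * K - (2 : k) • M + (2 * q) • (K * K)
  eM : e * M = M * e + K + β • i - (4 * q) • (e * K) - (4 * q) • e
  iK : i * K = K * i
  ie : i * e = e * i
  iM : i * M = M * i

/-- Extends a rewriting rule for x y to right-associated words, so that `simp` can put every
monomial into normal order; `module` then compares coefficients. -/
theorem mul_mul_eq_of_mul_eq {A : Type} [Ring A] {x y r : A} (h : x * y = r) (z : A) :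
    x * (y * z) = r * z := by
  rw [← mul_assoc, h]

theorem GL2.IsRep.qRel {h e f i : A} (H : GL2.IsRep h e f i) (q β : k) :
    QRel q β (h - β • i) e (f + q • (h - β • i) ^ 2) i := by
  have h2 : ∀ x : A, 2 * x = (2 : k) • x := fun x => by rw [two_mul, two_smul]
  have he := H.he
  have hf := H.hf
  have ef := H.ef
  have ih := H.ih
  have ie := H.ie
  have fi := H.fi
  rw [h2] at he hf
  constructor <;>
  · simp only [pow_two, mul_add, add_mul, mul_sub, sub_mul, smul_mul_assoc, mul_smul_comm,
      mul_assoc, smul_add, smul_sub, he, hf, ef, ih, ie, fi, mul_mul_eq_of_mul_eq he,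
      mul_mul_eq_of_mul_eq hf, mul_mul_eq_of_mul_eq ef, mul_mul_eq_of_mul_eq ih,
      mul_mul_eq_of_mul_eq ie, mul_mul_eq_of_mul_eq fi]
    try module

/-- The converse of `GL2.IsRep.qRel`: the change of generators is invertible, so the universal
property of U(gl(2)) becomes one for `QRel`. -/
theorem QRel.isRep {q β : k} {K e M i : A} (H : QRel q β K e M i) :
    GL2.IsRep (K + β • i) e (M - q • K ^ 2) i := by
  have h2 : ∀ x : A, 2 * x = (2 : k) • x := fun x => by rw [two_mul, two_smul]
  have Ke := H.Ke
  have KM := H.KM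
  have eM := H.eM
  have iK := H.iK
  have ie := H.ie
  have iM := H.iM
  constructor <;> try rw [h2]
  all_goals
    simp only [pow_two, mul_add, add_mul, mul_sub, sub_mul, smul_mul_assoc, mul_smul_comm,
      mul_assoc, smul_add, smul_sub, Ke, KM, eM, iK, ie, iM, mul_mul_eq_of_mul_eq Ke,
      mul_mul_eq_of_mul_eq KM, mul_mul_eq_of_mul_eq eM, mul_mul_eq_of_mul_eq iK,
      mul_mul_eq_of_mul_eq ie, mul_mul_eq_of_mul_eq iM]
    try module

/-- The rules for `u = e^{-4 q J₊}` and `E = e^{4 q J₊}`. -/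
structure QExp (q : k) (e u E : A) : Prop where
  u_eq : u = 1 - (4 * q) • e
  uE : u * E = 1
  Eu : E * u = 1

namespace QExp

variable {q β : k} {K e M i u E : A}

/-- A substitute for eE = (E - 1)/(4q) that never divides by q. -/
theorem qeE (X : QExp q e u E) : (4 * q) • (e * E) = E - 1 := by
  have h := X.uE
  rw [X.u_eq, sub_mul, one_mul, smul_mul_assoc] at h
  rw [← h]
  abel

theorem eE (X : QExp q e u E) : e * E = E * e := by
  have h : e * u = u * e := by
    rw [X.u_eq]
    simp only [mul_sub, sub_mul, mul_one, one_mul, mul_smul_comm, smul_mul_assoc]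
  calc e * E = E * u * (e * E) := by rw [X.Eu, one_mul]
    _ = E * (u * e) * E := by simp only [mul_assoc]
    _ = E * e * (u * E) := by rw [← h]; simp only [mul_assoc]
    _ = E * e := by rw [X.uE, mul_one]

theorem Ku (X : QExp q e u E) (H : QRel q β K e M i) : K * u = u * K - (8 * q) • e := by
  rw [X.u_eq]
  simp only [mul_sub, sub_mul, mul_one, one_mul, mul_smul_comm, smul_mul_assoc, H.Ke]
  module

theorem uM (X : QExp q e u E) (H : QRel q β K e M i) :
    u * M = M * u - (4 * q) • (u * K + β • i - (4 * q) • e) := by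
  rw [X.u_eq]
  simp only [mul_sub, sub_mul, mul_one, one_mul, mul_smul_comm, smul_mul_assoc, H.eM]
  module

theorem iu (X : QExp q e u E) (H : QRel q β K e M i) : i * u = u * i := by
  rw [X.u_eq]
  simp only [mul_sub, sub_mul, mul_one, one_mul, mul_smul_comm, smul_mul_assoc, H.ie]

/-- E is known only as the inverse of u, so its commutation rules are obtained by inserting E u = 1
and moving u, which is polynomial in e. -/
theorem KE (X : QExp q e u E) (H : QRel q β K e M i) : K * E = E * K + (2 : k) • (E * E) - (2 : k) • E := by
  have h := X.Ku H
  calc K * E = E * u * (K * E) := by rw [X.Eu, one_mul]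
    _ = E * (u * K) * E := by simp only [mul_assoc]
    _ = E * (K * u + (8 * q) • e) * E := by rw [h]; abel_nf
    _ = E * K * (u * E) + (2 : k) • (E * ((4 * q) • (e * E))) := by
      simp only [mul_add, add_mul, mul_smul_comm, smul_mul_assoc, mul_assoc]
      module
    _ = E * K + (2 : k) • (E * E) - (2 : k) • E := by
      rw [X.uE, X.qeE, mul_sub, mul_one, mul_one]
      module

theorem iE (X : QExp q e u E) (H : QRel q β K e M i) : i * E = E * i := by
  have h := X.iu H
  calc i * E = E * u * (i * E) := by rw [X.Eu, one_mul]
    _ = E * (u * i) * E := by simp only [mul_assoc]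
    _ = E * i * (u * E) := by rw [← h]; simp only [mul_assoc]
    _ = E * i := by rw [X.uE, mul_one]

theorem EM (X : QExp q e u E) (H : QRel q β K e M i) : E * M = M * E + (4 * q) • (E * K + β • (E * E * i) + E * E - E) := by
  have h : M * u = u * M + (4 * q) • (u * K + β • i - (4 * q) • e) := by
    rw [X.uM H, sub_add_cancel]
  have hKE := X.KE H
  calc E * M = E * (M * u) * E := by rw [mul_assoc, mul_assoc, X.uE, mul_one]
    _ = E * u * M * E + (4 * q) • (E * u * (K * E) + β • (E * (i * E)) -
        E * ((4 * q) • (e * E))) := by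
      rw [h]
      simp only [mul_add, mul_sub, add_mul, sub_mul, mul_smul_comm, smul_mul_assoc, mul_assoc]
    _ = _ := by
      rw [X.Eu, X.qeE, X.iE H, hKE, one_mul, one_mul, mul_sub, mul_one, mul_assoc]
      module

end QExp

open TensorProduct in
/-- The coproduct respects the rules. -/
theorem QRel.tensor {q β : k} {K e M i u E : A} (H : QRel q β K e M i) (X : QExp q e u E) :
    QRel q β (1 ⊗ₜ[k] K + K ⊗ₜ[k] E) (1 ⊗ₜ[k] e + e ⊗ₜ[k] u)
      (1 ⊗ₜ[k] M + M ⊗ₜ[k] E - (2 * q * β) • K ⊗ₜ[k] (i * E))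
      (1 ⊗ₜ[k] i + i ⊗ₜ[k] 1 : A ⊗[k] A) := by
  have Ke := H.Ke
  have KM := H.KM
  have eM := H.eM
  have Ki := H.iK.symm
  have ei := H.ie.symm
  have Mi := H.iM.symm
  have KE := X.KE H
  have Ei := (X.iE H).symm
  have EM := X.EM H
  have Ee := X.eE.symm
  have uE := X.uE
  have Eu := X.Eu
  have Ku := X.Ku H
  have uM := X.uM H
  have ui := (X.iu H).symm
  -- Normal ordering in the second factor leaves products eE with coefficient 4q, which have to be
  -- collapsed there.
  have qeE : ∀ y : A, (4 * q) • (y ⊗ₜ[k] (e * E)) = y ⊗ₜ[k] E - y ⊗ₜ[k] 1 := fun y => by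
    rw [← tmul_smul, X.qeE, tmul_sub]
  constructor
  all_goals
    simp only [mul_add, add_mul, mul_sub, sub_mul, smul_mul_assoc, mul_smul_comm,
      mul_assoc, smul_add, smul_sub, Algebra.TensorProduct.tmul_mul_tmul, one_mul, mul_one,
      add_tmul, tmul_add, sub_tmul, tmul_sub, ← smul_tmul', tmul_smul,
      Ke, KM, eM, Ki, ei, Mi, KE, Ei, EM, Ee, uE, Eu, Ku, uM, ui, qeE,
      mul_mul_eq_of_mul_eq Ke, mul_mul_eq_of_mul_eq KM, mul_mul_eq_of_mul_eq eM,
      mul_mul_eq_of_mul_eq Ki, mul_mul_eq_of_mul_eq ei, mul_mul_eq_of_mul_eq Mi,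
      mul_mul_eq_of_mul_eq KE, mul_mul_eq_of_mul_eq Ei, mul_mul_eq_of_mul_eq EM,
      mul_mul_eq_of_mul_eq Ee, mul_mul_eq_of_mul_eq uE, mul_mul_eq_of_mul_eq Eu,
      mul_mul_eq_of_mul_eq Ku, mul_mul_eq_of_mul_eq uM, mul_mul_eq_of_mul_eq ui]
    -- Only now is u expanded: an earlier expansion would hide the cancellations uE = Eu = 1.
    try simp only [X.u_eq, mul_sub, sub_mul, tmul_sub, one_mul, mul_one, tmul_smul,
      smul_mul_assoc, mul_smul_comm]
    try module

end QRel

/-! ### The antipode and the Casimir element in rational form. -/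

section
set_option linter.unusedSimpArgs false

variable {k A : Type} [CommRing k] [Ring A] [Algebra k A]

open MulOpposite in
/-- The antipode respects the rules. -/
theorem QRel.antipode {q β : k} {K e M i u E : A} (H : QRel q β K e M i) (X : QExp q e u E) :
    QRel q β (op (-(K * u))) (op (-(e * E))) (op (-(M * u) - (2 * q * β) • (i * (K * u))))
      (op (-i)) := by
  have Ke := H.Ke
  have KM := H.KM
  have eM := H.eM
  have Ki := H.iK.symm
  have ei := H.ie.symm
  have Mi := H.iM.symm
  have KE := X.KE H
  have Ei := (X.iE H).symm
  have EM := X.EM H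
  have Ee := X.eE.symm
  have uE := X.uE
  have Eu := X.Eu
  have Ku := X.Ku H
  have uM := X.uM H
  have ui := (X.iu H).symm
  have ue : u * e = e * u := by
    rw [X.u_eq]
    simp only [mul_sub, sub_mul, mul_one, one_mul, mul_smul_comm, smul_mul_assoc]
  have qeE := X.qeE
  constructor
  all_goals
    apply unop_injective
    simp only [unop_mul, unop_add, unop_sub, unop_smul, unop_op, neg_mul, mul_neg, smul_neg,
      mul_add, add_mul, mul_sub, sub_mul, smul_mul_assoc, mul_smul_comm,
      mul_assoc, smul_add, smul_sub, one_mul, mul_one,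
      Ke, KM, eM, Ki, ei, Mi, KE, Ei, EM, Ee, uE, Eu, Ku, uM, ui, ue,
      mul_mul_eq_of_mul_eq Ke, mul_mul_eq_of_mul_eq KM, mul_mul_eq_of_mul_eq eM,
      mul_mul_eq_of_mul_eq Ki, mul_mul_eq_of_mul_eq ei, mul_mul_eq_of_mul_eq Mi,
      mul_mul_eq_of_mul_eq KE, mul_mul_eq_of_mul_eq Ei, mul_mul_eq_of_mul_eq EM,
      mul_mul_eq_of_mul_eq Ee, mul_mul_eq_of_mul_eq uE, mul_mul_eq_of_mul_eq Eu,
      mul_mul_eq_of_mul_eq Ku, mul_mul_eq_of_mul_eq uM, mul_mul_eq_of_mul_eq ui,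
      mul_mul_eq_of_mul_eq ue]
    try simp only [X.u_eq, mul_sub, sub_mul, one_mul, mul_one,
      smul_mul_assoc, mul_smul_comm]
    try module

/-- The deformed Casimir element reduces to a combination that commutes with the generators. -/
theorem QRel.casimir_eq {q β : k} {h e f i u E : A} (H : GL2.IsRep h e f i) (X : QExp q e u E) :
    (h - β • i) * u * (h - β • i) + (2 * β) • (h * i) +
      (2 : k) • (e * (f + q • (h - β • i) ^ 2)) + (2 : k) • ((f + q • (h - β • i) ^ 2) * e) +
      (2 : k) • (u - 1) =
    h ^ 2 + (2 : k) • (e * f) + (2 : k) • (f * e) + β ^ 2 • i ^ 2 := by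
  have h2 : ∀ x : A, 2 * x = (2 : k) • x := fun x => by rw [two_mul, two_smul]
  have he := H.he
  have hf := H.hf
  have ef := H.ef
  have ih := H.ih
  have ie := H.ie
  have fi := H.fi.symm
  rw [h2] at he hf
  rw [X.u_eq]
  -- With K = h - βi, the terms of first order in q are 2q(eK² + K²e - 2KeK) - 8q e = 2q[K,[K,e]] -
  -- 8q e = 0, while K² + 2βhi = h² + β²i².
  simp only [pow_two, mul_add, add_mul, mul_sub, sub_mul, smul_mul_assoc, mul_smul_comm,
      mul_assoc, smul_add, smul_sub, mul_one, he, hf, ef, ih, ie, fi, mul_mul_eq_of_mul_eq he,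
      mul_mul_eq_of_mul_eq hf, mul_mul_eq_of_mul_eq ef, mul_mul_eq_of_mul_eq ih,
      mul_mul_eq_of_mul_eq ie, mul_mul_eq_of_mul_eq fi]
  module

theorem GL2.IsRep.casimir_comm {h e f i : A} (H : GL2.IsRep h e f i) (γ : k) :
    let c := h ^ 2 + (2 : k) • (e * f) + (2 : k) • (f * e) + γ • i ^ 2
    Commute c h ∧ Commute c e ∧ Commute c f ∧ Commute c i := by
  have h2 : ∀ x : A, 2 * x = (2 : k) • x := fun x => by rw [two_mul, two_smul]
  have he := H.he
  have hf := H.hf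
  have ef := H.ef
  have ih := H.ih
  have ie := H.ie
  have fi := H.fi.symm
  rw [h2] at he hf
  intro c
  refine ⟨?_, ?_, ?_, ?_⟩
  all_goals
    change _ * _ = _ * _
    simp only [c, pow_two, mul_add, add_mul, mul_sub, sub_mul, smul_mul_assoc, mul_smul_comm,
      mul_assoc, smul_add, smul_sub, mul_one, he, hf, ef, ih, ie, fi, mul_mul_eq_of_mul_eq he,
      mul_mul_eq_of_mul_eq hf, mul_mul_eq_of_mul_eq ef, mul_mul_eq_of_mul_eq ih,
      mul_mul_eq_of_mul_eq ie, mul_mul_eq_of_mul_eq fi]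
    try module

end

/-! ### The structure of the quantum algebra -/

namespace QGL2

variable (ap bp : ℝ)

theorem smul_eq (r : ℝ) (x : QGL2 ap bp) : r • x = (PowerSeries.C r : Rh) • x := by
  obtain ⟨x, rfl⟩ := mk_surjective ap bp x
  exact congrArg (mk ap bp) (PowerSeries.C_smul_series r x).symm

/-- `J₃ - (b₊/a₊) I`. -/
def K : QGL2 ap bp := J3 ap bp - (PowerSeries.C (bp / ap) : Rh) • I ap bp

/-- `h a₊ / 4`. -/
def q : Rh := PowerSeries.X * PowerSeries.C (ap / 4)

/-- `b₊ / a₊`. -/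
def β : Rh := PowerSeries.C (bp / ap)

theorem four_mul_q : 4 * q ap = PowerSeries.X * PowerSeries.C ap := by
  rw [q, mul_left_comm, ← map_ofNat PowerSeries.C 4, ← map_mul]
  congr 2
  ring

theorem two_mul_q_mul_β (hap : ap ≠ 0) :
    2 * q ap * β ap bp = PowerSeries.X * PowerSeries.C (bp / 2) := by
  rw [q, β, mul_left_comm, mul_assoc, ← map_ofNat PowerSeries.C 2, ← map_mul, ← map_mul]
  congr 2
  field_simp
  norm_num

variable [hap : Fact (ap ≠ 0)]

instance : IsHComplete (QGL2 ap bp) :=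
  .of_linearEquiv (equivSeries ap bp hap.out).symm.toLinearEquiv

/-- The inclusion of the enveloping algebra in the quantum algebra. -/
def ofU (u : UGL2) : QGL2 ap bp := (equivSeries ap bp hap.out).symm (PowerSeries.C u)

theorem equivSeries_ofU (u : UGL2) :
    equivSeries ap bp hap.out (ofU ap bp u) = PowerSeries.C u := AlgEquiv.apply_symm_apply _ _

/-- The element `(1 - e^{-h a₊ J₊}) / (h a₊)`. -/
def e : QGL2 ap bp := ofU ap bp UGL2.e

theorem ofU_h : ofU ap bp UGL2.h = J3 ap bp := by
  rw [ofU, AlgEquiv.symm_apply_eq, J3, equivSeries_mk, toSeries_fgen, genImage]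

theorem ofU_i : ofU ap bp UGL2.i = I ap bp := by
  rw [ofU, AlgEquiv.symm_apply_eq, I, equivSeries_mk, toSeries_fgen, genImage]

theorem Jm_eq : Jm ap bp = ofU ap bp UGL2.f + q ap • K ap bp ^ 2 := by
  apply (equivSeries ap bp hap.out).injective
  rw [map_add, map_smul, map_pow, K, map_sub, map_smul, ← ofU_h, ← ofU_i, equivSeries_ofU,
    equivSeries_ofU, equivSeries_ofU, Jm, equivSeries_mk, toSeries_fgen, genImage_jm, q]

theorem isRep : GL2.IsRep (J3 ap bp) (e ap bp) (ofU ap bp UGL2.f) (I ap bp) := by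
  rw [← ofU_h, ← ofU_i]
  exact (UGL2.isRep.map PowerSeries.C).map (equivSeries ap bp hap.out).symm.toRingEquiv.toRingHom

theorem qRel : QRel (q ap) (β ap bp) (K ap bp) (e ap bp) (Jm ap bp) (I ap bp) := by
  rw [Jm_eq]
  exact (isRep ap bp).qRel (q ap) (β ap bp)

theorem expJp_eq (c : ℝ) : expJp ap bp c = texp ((PowerSeries.C c : Rh) • Jp ap bp) := by
  apply (equivSeries ap bp hap.out).injective
  refine (toSeries_hexp ap bp c).trans ?_
  refine Eq.trans ?_ (map_texp (equivSeries ap bp hap.out).toAlgHom _).symm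
  congr 1
  change _ = equivSeries ap bp hap.out _
  rw [map_smul, PowerSeries.C_smul_series, Jp, equivSeries_mk, toSeries_fgen, genImage]

theorem qExp : QExp (q ap) (e ap bp) (expJp ap bp (-ap)) (expJp ap bp ap) := by
  refine ⟨?_, ?_, ?_⟩
  · apply (equivSeries ap bp hap.out).injective
    rw [map_sub, map_one, map_smul, e, equivSeries_ofU, four_mul_q, ← X_mul_smul_eq,
      ← mul_smul_comm, ← texp_neg_logSeries, expJp, equivSeries_mk, toSeries_hexp]
  · rw [expJp_eq, expJp_eq, map_neg, neg_smul, texp_neg_mul_texp]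
  · rw [expJp_eq, expJp_eq, map_neg, neg_smul, texp_mul_texp_neg]

/-- Identifies the quotient occurring in the deformed Casimir with the generator e, again after
multiplication by h. -/
theorem expJpDiv_neg : -ap⁻¹ • expJpDiv ap bp (-ap) = e ap bp := by
  apply (equivSeries ap bp hap.out).injective
  rw [← sub_eq_zero]
  refine PowerSeries.X_smul_series_injective _ ?_
  have h1 : equivSeries ap bp hap.out (-ap⁻¹ • expJpDiv ap bp (-ap)) =
      -ap⁻¹ • texpDiv ((-ap) • logSeries ap UGL2.e) := by
    rw [smul_eq, map_smul, expJpDiv, equivSeries_mk, toSeries_hexpDiv, PowerSeries.C_smul_series]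
  rw [h1, smul_sub, smul_comm, X_smul_texpDiv, texp_neg_logSeries, e, equivSeries_ofU,
    PowerSeries.X_smul_series, mul_smul_comm, sub_sub_cancel_left, smul_neg, neg_smul, neg_neg,
    inv_smul_smul₀ hap.out, sub_self]

/-- All deformation is absorbed by the change of generators. -/
theorem casimir_eq : casimir ap bp = J3 ap bp ^ 2 + (2 : Rh) • (e ap bp * ofU ap bp UGL2.f) +
    (2 : Rh) • (ofU ap bp UGL2.f * e ap bp) + β ap bp ^ 2 • I ap bp ^ 2 := by
  have h2 : (PowerSeries.C 2 : Rh) = 2 := map_ofNat _ 2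
  rw [← QRel.casimir_eq (β := β ap bp) (isRep ap bp) (qExp ap bp), casimir, expJpDiv_neg, smul_eq,
    smul_eq, smul_eq, smul_eq, smul_eq, map_mul, h2]
  have hK : J3 ap bp - β ap bp • I ap bp = K ap bp := rfl
  rw [hK, ← Jm_eq]
  rfl

end QGL2

namespace GL2

variable {T : Type} [Ring T] [Algebra Rh T]

/-- The homomorphism from the enveloping algebra to an `ℝ⟦h⟧`-algebra. -/
def IsRep.liftRh {h e f i : T} (H : IsRep h e f i) : UGL2 →+* T :=
  letI := Algebra.compHom T (PowerSeries.C : ℝ →+* Rh)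
  (H.lift : UGL2 →ₐ[ℝ] T)

theorem IsRep.liftRh_algebraMap {h e f i : T} (H : IsRep h e f i) (r : ℝ) :
    H.liftRh (algebraMap ℝ UGL2 r) = algebraMap Rh T (PowerSeries.C r) :=
  letI := Algebra.compHom T (PowerSeries.C : ℝ →+* Rh)
  AlgHom.commutes (H.lift : UGL2 →ₐ[ℝ] T) r

theorem IsRep.liftRh_gens {h e f i : T} (H : IsRep h e f i) :
    H.liftRh UGL2.h = h ∧ H.liftRh UGL2.e = e ∧ H.liftRh UGL2.f = f ∧ H.liftRh UGL2.i = i := by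
  let := Algebra.compHom T (PowerSeries.C : ℝ →+* Rh)
  obtain ⟨h1, h2, h3, h4⟩ := lin_basis h e f i
  exact ⟨(H.lift_ι _).trans h1, (H.lift_ι _).trans h2, (H.lift_ι _).trans h3,
    (H.lift_ι _).trans h4⟩

end GL2

/-! ### Universal property of the quantum algebra and absence of torsion. -/

namespace QGL2

variable (ap bp : ℝ) [hap : Fact (ap ≠ 0)]

section Lift

variable {ap bp} {T : Type} [Ring T] [Algebra Rh T] [IsHComplete T] {K' e' M' i' : T}

/-- The homomorphism from the quantum algebra defined by the images of `K`, `e`, `J₋`, `I`. -/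
def lift (H : QRel (q ap) (β ap bp) K' e' M' i') : QGL2 ap bp →ₐ[Rh] T :=
  (PowerSeries.extendScalars H.isRep.liftRh H.isRep.liftRh_algebraMap).comp
    (equivSeries ap bp hap.out).toAlgHom

theorem lift_ofU (H : QRel (q ap) (β ap bp) K' e' M' i') (u : UGL2) :
    lift H (ofU ap bp u) = H.isRep.liftRh u := by
  change PowerSeries.extendScalars H.isRep.liftRh H.isRep.liftRh_algebraMap
    (equivSeries ap bp hap.out (ofU ap bp u)) = _
  rw [equivSeries_ofU, PowerSeries.extendScalars_C]

theorem lift_I (H : QRel (q ap) (β ap bp) K' e' M' i') : lift H (I ap bp) = i' := by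
  rw [← ofU_i, lift_ofU, H.isRep.liftRh_gens.2.2.2]

theorem lift_K (H : QRel (q ap) (β ap bp) K' e' M' i') : lift H (K ap bp) = K' := by
  rw [K, map_sub, map_smul, lift_I, ← ofU_h, lift_ofU, H.isRep.liftRh_gens.1]
  exact add_sub_cancel_right _ _

theorem lift_e (H : QRel (q ap) (β ap bp) K' e' M' i') : lift H (e ap bp) = e' := by
  rw [e, lift_ofU, H.isRep.liftRh_gens.2.1]

theorem lift_Jm (H : QRel (q ap) (β ap bp) K' e' M' i') : lift H (Jm ap bp) = M' := by
  rw [Jm_eq, map_add, map_smul, map_pow, lift_K, lift_ofU, H.isRep.liftRh_gens.2.2.1,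
    sub_add_cancel]

end Lift

/-- Reduces statements about linear maps to complete modules to the copy of U(gl(2)), where
induction on generators is available. -/
theorem eq_hsum_ofU (x : QGL2 ap bp) : x = hsum fun k =>
    ofU ap bp (PowerSeries.coeff k (equivSeries ap bp hap.out x)) := by
  have h := congrArg (equivSeries ap bp hap.out).symm
    (PowerSeries.eq_hsum_coeff (equivSeries ap bp hap.out x))
  rw [AlgEquiv.symm_apply_apply] at h
  exact h.trans (map_hsum (equivSeries ap bp hap.out).symm.toLinearMap _)

theorem ofU_add (u v : UGL2) : ofU ap bp (u + v) = ofU ap bp u + ofU ap bp v := by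
  simp only [ofU, map_add]

theorem ofU_mul (u v : UGL2) : ofU ap bp (u * v) = ofU ap bp u * ofU ap bp v := by
  simp only [ofU, map_mul]

theorem ofU_algebraMap (r : ℝ) : ofU ap bp (algebraMap ℝ UGL2 r) =
    (PowerSeries.C r : Rh) • 1 := by
  rw [ofU, AlgEquiv.symm_apply_eq, map_smul, map_one, PowerSeries.C_smul_series,
    Algebra.algebraMap_eq_smul_one]
  ext n
  simp [PowerSeries.coeff_C, PowerSeries.coeff_one]

/-- A linear map to a complete module whose kernel is stable under multiplication and contains
the generators is zero. -/
theorem linearMap_eq_zero {T : Type} [AddCommGroup T] [Module Rh T] [IsHComplete T]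
    (D : QGL2 ap bp →ₗ[Rh] T) (h1 : D 1 = 0)
    (hmul : ∀ x y, D x = 0 → D y = 0 → D (x * y) = 0) (hK : D (K ap bp) = 0)
    (he : D (e ap bp) = 0) (hM : D (Jm ap bp) = 0) (hI : D (I ap bp) = 0) (x : QGL2 ap bp) :
    D x = 0 := by
  have h3 : D (ofU ap bp UGL2.h) = 0 := by
    rw [ofU_h, ← sub_add_cancel (J3 ap bp) ((PowerSeries.C (bp / ap) : Rh) • I ap bp), map_add,
      map_smul, hI, smul_zero, add_zero]
    exact hK
  -- The hypotheses concern J₋, whereas induction in U(gl(2)) needs f = J₋ - qK².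
  have hf : D (ofU ap bp UGL2.f) = 0 := by
    rw [← add_sub_cancel_right (ofU ap bp UGL2.f) (q ap • K ap bp ^ 2), ← Jm_eq, map_sub,
      map_smul, pow_two, hmul _ _ hK hK, hM, smul_zero, sub_zero]
  have hU : ∀ u, D (ofU ap bp u) = 0 := by
    intro u
    induction u using UGL2.induction with
    | hι X =>
      have hsmul : ∀ (r : ℝ) (v : UGL2), D (ofU ap bp v) = 0 → D (ofU ap bp (r • v)) = 0 := by
        intro r v hv
        rw [Algebra.smul_def, ofU_mul, ofU_algebraMap, smul_mul_assoc, one_mul, map_smul, hv,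
          smul_zero]
      rw [← UGL2.lin_eq_ι]
      simp only [GL2.lin, LinearMap.coe_mk, AddHom.coe_mk, ofU_add, map_add]
      rw [hsmul _ _ h3, hsmul _ _ he, hsmul _ _ hf, hsmul _ _ ((ofU_i ap bp).symm ▸ hI)]
      simp
    | hr r => rw [ofU_algebraMap, map_smul, h1, smul_zero]
    | hadd x y hx hy => rw [ofU_add, map_add, hx, hy, add_zero]
    | hmul x y hx hy => rw [ofU_mul]; exact hmul _ _ hx hy
  rw [eq_hsum_ofU ap bp x]
  exact linearMap_hsum_eq_zero D _ fun k => hU _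

theorem algHom_ext {T : Type} [Ring T] [Algebra Rh T] [IsHComplete T]
    {θ θ' : QGL2 ap bp →ₐ[Rh] T} (hK : θ (K ap bp) = θ' (K ap bp))
    (he : θ (e ap bp) = θ' (e ap bp)) (hM : θ (Jm ap bp) = θ' (Jm ap bp))
    (hI : θ (I ap bp) = θ' (I ap bp)) : θ = θ' := by
  ext x
  have key : ∀ y, (θ.toLinearMap - θ'.toLinearMap) y = θ y - θ' y := fun y => rfl
  have h := linearMap_eq_zero ap bp (θ.toLinearMap - θ'.toLinearMap)
    (by rw [key, map_one, map_one, sub_self])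
    (fun x y hx hy => by
      rw [key, sub_eq_zero] at hx hy ⊢
      rw [map_mul, map_mul, hx, hy])
    (by rw [key, hK, sub_self]) (by rw [key, he, sub_self]) (by rw [key, hM, sub_self])
    (by rw [key, hI, sub_self]) x
  rwa [key, sub_eq_zero] at h

theorem X_smul_injective (x : QGL2 ap bp) (h : (PowerSeries.X : Rh) • x = 0) : x = 0 := by
  have h1 := congrArg (equivSeries ap bp hap.out) h
  rw [map_smul, map_zero] at h1
  simpa using PowerSeries.X_smul_series_injective _ h1

/-- ℝ⟦h⟧ is a discrete valuation ring with uniformizer h: a nonzero scalar is a unit times hⁿ, so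
the absence of h-torsion excludes all torsion, and torsion-free modules over a Bézout domain are
flat. -/
instance : Module.Flat Rh (QGL2 ap bp) := by
  have hreg : ∀ (r : Rh) (x : QGL2 ap bp), r ≠ 0 → r • x = 0 → x = 0 := by
    intro r x hr hx
    obtain ⟨n, u, rfl⟩ :=
      IsDiscreteValuationRing.eq_unit_mul_pow_irreducible hr PowerSeries.X_irreducible
    have hpow : ∀ n : ℕ, (PowerSeries.X ^ n : Rh) • x = 0 → x = 0 := by
      intro n
      induction n with
      | zero => simp
      | succ n ih =>
        intro h
        rw [pow_succ', mul_smul] at h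
        exact ih (X_smul_injective ap bp _ h)
    rw [mul_smul] at hx
    exact hpow n ((u.isUnit.smul_eq_zero).1 hx)
  rw [Module.Flat.flat_iff_torsion_eq_bot_of_isBezout, eq_bot_iff]
  rintro x ⟨⟨r, hr⟩, hx⟩
  exact hreg r x (nonZeroDivisors.ne_zero hr) hx

/-- Needed for the injectivity of the exponential in the completed tensor square. -/
theorem X_smul_tensor_injective (x : QGL2 ap bp ⊗[Rh] QGL2 ap bp)
    (h : (PowerSeries.X : Rh) • x = 0) : x = 0 := by
  refine Module.Flat.isSMulRegular_of_nonZeroDivisors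
    (mem_nonZeroDivisors_of_ne_zero (PowerSeries.X_ne_zero (R := ℝ))) ?_
  simpa using h

end QGL2

/-! ### Criteria for the axioms of a topological Hopf algebra -/

/-- The module structure from `seriesAlgebra ℝ`, for which completeness is known, and that of ℝ⟦h⟧
over itself are different instances; the identity map transports completeness. -/
instance : IsHComplete Rh :=
  @IsHComplete.of_linearEquiv Rh Rh _ (seriesAlgebra ℝ).toModule _ _ inferInstance
    (@LinearEquiv.mk Rh Rh _ _ _ _ _ _ Rh Rh _ _ (seriesAlgebra ℝ).toModule _
      (@LinearMap.mk Rh Rh _ _ _ Rh Rh _ _ (seriesAlgebra ℝ).toModule _ (AddHom.id Rh)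
        (fun s x => by
          change PowerSeries.map (algebraMap ℝ ℝ) s * x = s * x
          congr 1)) id (fun _ => rfl) (fun _ => rfl))

/-- The extension of an algebra homomorphism to the completion. -/
def HCompl.extendAlg {C D : Type} [Ring C] [Algebra Rh C] [Ring D] [Algebra Rh D]
    (f : C →ₐ[Rh] HCompl D) : HCompl C →ₐ[Rh] HCompl D :=
  HCompl.extendAlgHom f.toLinearMap (map_one f) (map_mul f)

theorem QRel.map {A B : Type} [Ring A] [Algebra Rh A] [Ring B] [Algebra Rh B] {q β : Rh}
    {K e M i : A} (H : QRel q β K e M i) (θ : A →ₐ[Rh] B) :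
    QRel q β (θ K) (θ e) (θ M) (θ i) := by
  constructor
  · simpa using congrArg θ H.Ke
  · simpa using congrArg θ H.KM
  · simpa using congrArg θ H.eM
  · simpa using congrArg θ H.iK
  · simpa using congrArg θ H.ie
  · simpa using congrArg θ H.iM

section MulTensor

variable {A B C T : Type} [Ring A] [Algebra Rh A] [Ring B] [Algebra Rh B] [Ring C] [Algebra Rh C]
  [Ring T] [Algebra Rh T]

theorem mulTensor_tmul (f : B →ₗ[Rh] T) (g : C →ₗ[Rh] T) (x : B) (y : C) :
    mulTensor f g (x ⊗ₜ y) = f x * g y := rfl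

/-- Applied to Δ ⊗ id, id ⊗ Δ and the counit maps, whose two factors commute; it does not apply to
the antipode. -/
theorem mulTensor_mul (f : B →ₐ[Rh] T) (g : C →ₐ[Rh] T) (h : ∀ x y, Commute (f x) (g y))
    (x y : B ⊗[Rh] C) : mulTensor f.toLinearMap g.toLinearMap (x * y) =
      mulTensor f.toLinearMap g.toLinearMap x * mulTensor f.toLinearMap g.toLinearMap y := by
  induction x with
  | zero => simp
  | add x₁ x₂ h₁ h₂ => rw [add_mul, map_add, map_add, add_mul, h₁, h₂]
  | tmul b c =>
    induction y with
    | zero => simp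
    | add y₁ y₂ h₁ h₂ => rw [mul_add, map_add, map_add, mul_add, h₁, h₂]
    | tmul b' c' =>
      simp only [Algebra.TensorProduct.tmul_mul_tmul, mulTensor_tmul, AlgHom.toLinearMap_apply,
        map_mul, mul_assoc]
      rw [← mul_assoc (g c), ← (h b' c).eq, mul_assoc]

theorem mulTensor_one (f : B →ₐ[Rh] T) (g : C →ₐ[Rh] T) :
    mulTensor f.toLinearMap g.toLinearMap 1 = 1 := by
  rw [Algebra.TensorProduct.one_def, mulTensor_tmul]
  simp

end MulTensor

section Coproduct

variable {A : Type} [Ring A] [Algebra Rh A] (Δ : A →ₐ[Rh] CTensor A A)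

/-- The map `Δ ⊗ 1`. -/
def comulLeftFactor : A →ₐ[Rh] HCompl (A ⊗[Rh] (A ⊗[Rh] A)) :=
  (HCompl.extendAlg ((HCompl.of _).comp (Algebra.TensorProduct.map (AlgHom.id Rh A)
    Algebra.TensorProduct.includeLeft))).comp Δ

/-- The map `1 ⊗ Δ`. -/
def comulRightFactor : A →ₐ[Rh] HCompl (A ⊗[Rh] (A ⊗[Rh] A)) :=
  (HCompl.extendAlg ((HCompl.of _).comp Algebra.TensorProduct.includeRight)).comp Δ

theorem HCompl.commute_of_level {C : Type} [Ring C] [Algebra Rh C] {x y : HCompl C}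
    (h : ∀ n, Commute (x.1 n) (y.1 n)) : Commute x y :=
  HCompl.ext_level fun n => h n

/-- At each level Δ x is represented by an honest tensor, placed in the first two factors, while y
sits in the third. -/
theorem comulLeftFactor_commute (x y : A) : Commute (comulLeftFactor Δ x)
    (HCompl.of (A ⊗[Rh] (A ⊗[Rh] A)) ((1 : A) ⊗ₜ[Rh] ((1 : A) ⊗ₜ[Rh] y))) := by
  refine HCompl.commute_of_level fun n => ?_
  obtain ⟨z, hz⟩ := HCompl.exists_rep (Δ x) n
  have h1 : (comulLeftFactor Δ x).1 n = Ideal.Quotient.mk _ (Algebra.TensorProduct.map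
      (AlgHom.id Rh A) Algebra.TensorProduct.includeLeft z) :=
    HCompl.extend_apply _ (hz n le_rfl)
  rw [h1, HCompl.of_apply]
  refine Commute.map (x := Algebra.TensorProduct.map (AlgHom.id Rh A)
    Algebra.TensorProduct.includeLeft z) ?_ (Ideal.Quotient.mk (hPow (A ⊗[Rh] (A ⊗[Rh] A)) n))
  change _ * _ = _ * _
  clear hz h1
  induction z with
  | zero => simp
  | add a b ha hb => rw [map_add, add_mul, mul_add, ha, hb]
  | tmul a b => simp

theorem comulRightFactor_commute (x y : A) : Commute
    (HCompl.of (A ⊗[Rh] (A ⊗[Rh] A)) (x ⊗ₜ[Rh] (1 : A ⊗[Rh] A))) (comulRightFactor Δ y) := by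
  refine HCompl.commute_of_level fun n => ?_
  obtain ⟨z, hz⟩ := HCompl.exists_rep (Δ y) n
  have h1 : (comulRightFactor Δ y).1 n = Ideal.Quotient.mk _ ((1 : A) ⊗ₜ[Rh] z) :=
    HCompl.extend_apply _ (hz n le_rfl)
  rw [h1, HCompl.of_apply]
  refine Commute.map (x := x ⊗ₜ[Rh] (1 : A ⊗[Rh] A)) (y := (1 : A) ⊗ₜ[Rh] z) ?_
    (Ideal.Quotient.mk (hPow (A ⊗[Rh] (A ⊗[Rh] A)) n))
  change _ * _ = _ * _
  simp

theorem comulLeft_mul (x y : A ⊗[Rh] A) :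
    comulLeft Δ (x * y) = comulLeft Δ x * comulLeft Δ y :=
  mulTensor_mul (comulLeftFactor Δ) ((HCompl.of _).comp ((Algebra.TensorProduct.includeRight).comp
    Algebra.TensorProduct.includeRight)) (comulLeftFactor_commute Δ) x y

theorem comulRight_mul (x y : A ⊗[Rh] A) :
    comulRight Δ (x * y) = comulRight Δ x * comulRight Δ y :=
  mulTensor_mul ((HCompl.of (A ⊗[Rh] (A ⊗[Rh] A))).comp
    (Algebra.TensorProduct.includeLeft : A →ₐ[Rh] A ⊗[Rh] (A ⊗[Rh] A))) (comulRightFactor Δ)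
    (comulRightFactor_commute Δ) x y

/-- `(Δ ⊗ id) Δ` as an algebra homomorphism. -/
def coassocLeft : A →ₐ[Rh] HCompl (A ⊗[Rh] (A ⊗[Rh] A)) :=
  (HCompl.extendAlgHom (comulLeft Δ) (mulTensor_one (comulLeftFactor Δ) _)
    (comulLeft_mul Δ)).comp Δ

/-- `(id ⊗ Δ) Δ` as an algebra homomorphism. -/
def coassocRight : A →ₐ[Rh] HCompl (A ⊗[Rh] (A ⊗[Rh] A)) :=
  (HCompl.extendAlgHom (comulRight Δ) (mulTensor_one _ (comulRightFactor Δ))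
    (comulRight_mul Δ)).comp Δ

variable {Δ}

theorem coassocLeft_of {x : A} {z : A ⊗[Rh] A} (h : Δ x = HCompl.of _ z) :
    coassocLeft Δ x = comulLeft Δ z := by
  change HCompl.extend (comulLeft Δ) (Δ x) = _
  rw [h, HCompl.extend_of]

theorem coassocRight_of {x : A} {z : A ⊗[Rh] A} (h : Δ x = HCompl.of _ z) :
    coassocRight Δ x = comulRight Δ z := by
  change HCompl.extend (comulRight Δ) (Δ x) = _
  rw [h, HCompl.extend_of]

theorem comulLeft_tmul {x : A} {z : A ⊗[Rh] A} (h : Δ x = HCompl.of _ z) (y : A) :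
    comulLeft Δ (x ⊗ₜ y) = HCompl.of _ (Algebra.TensorProduct.map (AlgHom.id Rh A)
      Algebra.TensorProduct.includeLeft z * ((1 : A) ⊗ₜ[Rh] ((1 : A) ⊗ₜ[Rh] y))) := by
  rw [map_mul]
  change HCompl.extend _ (Δ x) * _ = _
  rw [h, HCompl.extend_of]
  rfl

theorem comulRight_tmul {y : A} {z : A ⊗[Rh] A} (h : Δ y = HCompl.of _ z) (x : A) :
    comulRight Δ (x ⊗ₜ y) = HCompl.of _ (x ⊗ₜ[Rh] z) := by
  have : x ⊗ₜ[Rh] z = (x ⊗ₜ[Rh] (1 : A ⊗[Rh] A)) * ((1 : A) ⊗ₜ[Rh] z) := by simp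
  rw [this, map_mul]
  change _ * HCompl.extend _ (Δ y) = _
  rw [h, HCompl.extend_of]
  rfl

end Coproduct

section Antipode

variable {A : Type} [Ring A] [Algebra Rh A] (S : A →ₗ[Rh] A)

/-- Since S reverses products, m(S ⊗ id) applied to u (a ⊗ b) encloses the value at u between S a
and b; a central value at u can then be pulled out. -/
theorem mulTensor_antipode_left (hS : ∀ x y, S (x * y) = S y * S x) (u : A ⊗[Rh] A) (a b : A) :
    mulTensor S LinearMap.id (u * (a ⊗ₜ b)) = S a * mulTensor S LinearMap.id u * b := by
  induction u with
  | zero => simp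
  | add x y hx hy => rw [add_mul, map_add, map_add, mul_add, add_mul, hx, hy]
  | tmul x y =>
    simp only [Algebra.TensorProduct.tmul_mul_tmul, mulTensor_tmul, hS, LinearMap.id_apply,
      mul_assoc]

theorem mulTensor_antipode_right (hS : ∀ x y, S (x * y) = S y * S x) (u : A ⊗[Rh] A) (a b : A) :
    mulTensor LinearMap.id S ((a ⊗ₜ b) * u) = a * mulTensor LinearMap.id S u * S b := by
  induction u with
  | zero => simp
  | add x y hx hy => rw [mul_add, map_add, map_add, mul_add, add_mul, hx, hy]
  | tmul x y =>
    simp only [Algebra.TensorProduct.tmul_mul_tmul, mulTensor_tmul, hS, LinearMap.id_apply,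
      mul_assoc]

/-- Passes the antipode axiom to products, although m(S ⊗ id) is not multiplicative: with x = Δ(a),
y = Δ(b) the scalar ε(a) comes out. -/
theorem extend_antipode_left_mul (hS : ∀ x y, S (x * y) = S y * S x) {x y : CTensor A A} {c : Rh}
    (hx : HCompl.extend ((HCompl.of A).toLinearMap.comp (mulTensor S LinearMap.id)) x =
      HCompl.of A (algebraMap Rh A c)) :
    HCompl.extend ((HCompl.of A).toLinearMap.comp (mulTensor S LinearMap.id)) (x * y) =
      c • HCompl.extend ((HCompl.of A).toLinearMap.comp (mulTensor S LinearMap.id)) y := by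
  refine HCompl.ext_level fun n => ?_
  obtain ⟨u, hu⟩ := HCompl.exists_rep x n
  obtain ⟨v, hv⟩ := HCompl.exists_rep y n
  have huv : (x * y).1 n = Ideal.Quotient.mk (hPow (A ⊗[Rh] A) n) (u * v) := by
    rw [map_mul, ← hu n le_rfl, ← hv n le_rfl]; rfl
  have h1 := congrArg (fun z : HCompl A => z.1 n) hx
  simp only [HCompl.extend_apply _ (hu n le_rfl)] at h1
  obtain ⟨z, hz⟩ := mem_hPow.1 (Ideal.Quotient.eq.1 h1)
  rw [HCompl.extend_apply _ huv]
  change _ = c • (HCompl.extend ((HCompl.of A).toLinearMap.comp (mulTensor S LinearMap.id)) y).1 n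
  rw [HCompl.extend_apply _ (hv n le_rfl)]
  change Ideal.Quotient.mk (hPow A n) (mulTensor S LinearMap.id (u * v)) =
    Ideal.Quotient.mk (hPow A n) (c • mulTensor S LinearMap.id v)
  rw [Ideal.Quotient.eq]
  clear hv huv
  induction v with
  | zero => simp
  | add v w h1 h2 =>
    rw [mul_add, map_add, map_add, smul_add, add_sub_add_comm]
    exact Ideal.add_mem _ h1 h2
  | tmul a b =>
    rw [mulTensor_antipode_left S hS, mulTensor_tmul, mem_hPow]
    refine ⟨S a * z * b, ?_⟩
    rw [← smul_mul_assoc, ← mul_smul_comm, hz, mul_sub, sub_mul, ← Algebra.commutes,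
      ← Algebra.smul_def, smul_mul_assoc]
    rfl

theorem extend_antipode_right_mul (hS : ∀ x y, S (x * y) = S y * S x) {x y : CTensor A A} {c : Rh}
    (hx : HCompl.extend ((HCompl.of A).toLinearMap.comp (mulTensor LinearMap.id S)) y =
      HCompl.of A (algebraMap Rh A c)) :
    HCompl.extend ((HCompl.of A).toLinearMap.comp (mulTensor LinearMap.id S)) (x * y) =
      c • HCompl.extend ((HCompl.of A).toLinearMap.comp (mulTensor LinearMap.id S)) x := by
  refine HCompl.ext_level fun n => ?_
  obtain ⟨u, hu⟩ := HCompl.exists_rep x n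
  obtain ⟨v, hv⟩ := HCompl.exists_rep y n
  have huv : (x * y).1 n = Ideal.Quotient.mk (hPow (A ⊗[Rh] A) n) (u * v) := by
    rw [map_mul, ← hu n le_rfl, ← hv n le_rfl]; rfl
  have h1 := congrArg (fun z : HCompl A => z.1 n) hx
  simp only [HCompl.extend_apply _ (hv n le_rfl)] at h1
  obtain ⟨z, hz⟩ := mem_hPow.1 (Ideal.Quotient.eq.1 h1)
  rw [HCompl.extend_apply _ huv]
  change _ = c • (HCompl.extend ((HCompl.of A).toLinearMap.comp (mulTensor LinearMap.id S)) x).1 n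
  rw [HCompl.extend_apply _ (hu n le_rfl)]
  change Ideal.Quotient.mk (hPow A n) (mulTensor LinearMap.id S (u * v)) =
    Ideal.Quotient.mk (hPow A n) (c • mulTensor LinearMap.id S u)
  rw [Ideal.Quotient.eq]
  clear hu huv
  induction u with
  | zero => simp
  | add v w h1 h2 =>
    rw [add_mul, map_add, map_add, smul_add, add_sub_add_comm]
    exact Ideal.add_mem _ h1 h2
  | tmul a b =>
    rw [mulTensor_antipode_right S hS, mulTensor_tmul, mem_hPow]
    refine ⟨a * z * S b, ?_⟩
    rw [← smul_mul_assoc, ← mul_smul_comm, hz, mul_sub, sub_mul, ← Algebra.commutes,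
      ← Algebra.smul_def, smul_mul_assoc]
    rfl

end Antipode

/-! ### The Hopf structure of the quantum algebra -/

section Tensor

variable {k A : Type} [CommRing k] [Ring A] [Algebra k A]

open TensorProduct

/-- The proposed coproduct of e is exactly the one that makes u = 1 - 4q e group-like. -/
theorem QExp.tensor_u {q : k} {e u E : A} (X : QExp q e u E) :
    (1 : A ⊗[k] A) - (4 * q) • (1 ⊗ₜ[k] e + e ⊗ₜ[k] u) = u ⊗ₜ[k] u := by
  have h : u ⊗ₜ[k] u = 1 ⊗ₜ[k] u - (4 * q) • e ⊗ₜ[k] u := by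
    nth_rewrite 1 [X.u_eq]
    rw [sub_tmul, smul_tmul']
  have h' : (1 : A) ⊗ₜ[k] u = 1 - (4 * q) • (1 : A) ⊗ₜ[k] e := by
    nth_rewrite 1 [X.u_eq]
    rw [tmul_sub, tmul_smul, Algebra.TensorProduct.one_def]
  rw [h, h', smul_add, sub_sub]

/-- The inclusion of `A ⊗ A` in the first two factors of `A ⊗ A ⊗ A`. -/
local notation "ι₁₂" => Algebra.TensorProduct.map (AlgHom.id k A)
  (Algebra.TensorProduct.includeLeft : A →ₐ[k] A ⊗[k] A)

/-- The two sides are (Δ ⊗ id)Δ x and (id ⊗ Δ)Δ x for Δ x = 1 ⊗ x + x ⊗ g with g group-like. This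
covers K, e and I, with g equal to E, u and 1. -/
theorem tensor_coassoc_skew (x g : A) :
    ι₁₂ (1 ⊗ₜ[k] 1) * (1 : A) ⊗ₜ[k] ((1 : A) ⊗ₜ[k] x) +
      ι₁₂ (1 ⊗ₜ[k] x + x ⊗ₜ[k] g) * (1 : A) ⊗ₜ[k] ((1 : A) ⊗ₜ[k] g) =
    (1 : A) ⊗ₜ[k] (1 ⊗ₜ[k] x + x ⊗ₜ[k] g) + x ⊗ₜ[k] (g ⊗ₜ[k] g) := by
  simp only [map_add, Algebra.TensorProduct.map_tmul, AlgHom.id_apply,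
    Algebra.TensorProduct.includeLeft_apply, add_mul, Algebra.TensorProduct.tmul_mul_tmul,
    one_mul, mul_one, tmul_add]
  abel

/-- The same comparison for J₋, whose coproduct also involves K; here i is primitive and E
group-like. -/
theorem tensor_coassoc_comodule (c : k) (K M E i : A) :
    ι₁₂ (1 ⊗ₜ[k] 1) * (1 : A) ⊗ₜ[k] ((1 : A) ⊗ₜ[k] M) +
      ι₁₂ (1 ⊗ₜ[k] M + M ⊗ₜ[k] E - c • K ⊗ₜ[k] (i * E)) * (1 : A) ⊗ₜ[k] ((1 : A) ⊗ₜ[k] E) -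
      c • (ι₁₂ (1 ⊗ₜ[k] K + K ⊗ₜ[k] E) * (1 : A) ⊗ₜ[k] ((1 : A) ⊗ₜ[k] (i * E))) =
    (1 : A) ⊗ₜ[k] (1 ⊗ₜ[k] M + M ⊗ₜ[k] E - c • K ⊗ₜ[k] (i * E)) + M ⊗ₜ[k] (E ⊗ₜ[k] E) -
      c • K ⊗ₜ[k] ((1 ⊗ₜ[k] i + i ⊗ₜ[k] 1) * (E ⊗ₜ[k] E)) := by
  simp only [map_add, map_sub, map_smul, Algebra.TensorProduct.map_tmul, AlgHom.id_apply,
    Algebra.TensorProduct.includeLeft_apply, add_mul, sub_mul, smul_mul_assoc,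
    Algebra.TensorProduct.tmul_mul_tmul, one_mul, mul_one, tmul_add, tmul_sub, tmul_smul, smul_add]
  abel

theorem QRel.antipode_Jm_left {q β : k} {K e M i u E : A} (H : QRel q β K e M i)
    (X : QExp q e u E) :
    M + (-(M * u) - (2 * q * β) • (i * (K * u))) * E - (2 * q * β) • (-(K * u) * (i * E)) = 0 := by
  rw [X.iE H, sub_mul, neg_mul, neg_mul, smul_mul_assoc, smul_neg]
  simp only [mul_assoc, X.uE, mul_one]
  rw [← mul_assoc u, X.uE, one_mul, H.iK]
  abel

theorem QRel.antipode_Jm_right {q β : k} {K e M i u E : A} (H : QRel q β K e M i)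
    (X : QExp q e u E) :
    (-(M * u) - (2 * q * β) • (i * (K * u))) + M * u - (2 * q * β) • (K * (u * -i)) = 0 := by
  rw [mul_neg, mul_neg, smul_neg, ← mul_assoc i, H.iK, mul_assoc K i, X.iu H]
  abel

end Tensor

section Coassoc

variable {A : Type} [Ring A] [Algebra Rh A] {Δ : A →ₐ[Rh] CTensor A A}

theorem coassoc_of_skew {x g : A} (h1 : Δ 1 = HCompl.of _ (1 ⊗ₜ[Rh] 1))
    (hx : Δ x = HCompl.of _ (1 ⊗ₜ[Rh] x + x ⊗ₜ[Rh] g)) (hg : Δ g = HCompl.of _ (g ⊗ₜ[Rh] g)) :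
    coassocLeft Δ x = coassocRight Δ x := by
  rw [coassocLeft_of hx, coassocRight_of hx, map_add, map_add, comulLeft_tmul h1,
    comulLeft_tmul hx, comulRight_tmul hx, comulRight_tmul hg, ← map_add, ← map_add,
    tensor_coassoc_skew]

theorem coassoc_of_comodule {K M E i : A} {c : Rh} (h1 : Δ 1 = HCompl.of _ (1 ⊗ₜ[Rh] 1))
    (hK : Δ K = HCompl.of _ (1 ⊗ₜ[Rh] K + K ⊗ₜ[Rh] E))
    (hM : Δ M = HCompl.of _ (1 ⊗ₜ[Rh] M + M ⊗ₜ[Rh] E - c • K ⊗ₜ[Rh] (i * E)))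
    (hi : Δ i = HCompl.of _ (1 ⊗ₜ[Rh] i + i ⊗ₜ[Rh] 1)) (hE : Δ E = HCompl.of _ (E ⊗ₜ[Rh] E)) :
    coassocLeft Δ M = coassocRight Δ M := by
  have hiE : Δ (i * E) = HCompl.of _ ((1 ⊗ₜ[Rh] i + i ⊗ₜ[Rh] 1) * (E ⊗ₜ[Rh] E)) := by
    rw [map_mul, hi, hE, map_mul]
  rw [coassocLeft_of hM, coassocRight_of hM, map_sub, map_sub, map_add, map_add, map_smul,
    map_smul, comulLeft_tmul h1, comulLeft_tmul hM, comulLeft_tmul hK, comulRight_tmul hM,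
    comulRight_tmul hE, comulRight_tmul hiE, ← map_smul, ← map_smul, ← map_add, ← map_add,
    ← map_sub, ← map_sub, tensor_coassoc_comodule]

end Coassoc

namespace QGL2

variable (ap bp : ℝ) [hap : Fact (ap ≠ 0)]

/-- The element `e^{h a₊ J₊}`. -/
def E : QGL2 ap bp := expJp ap bp ap

/-- The element `e^{-h a₊ J₊}`. -/
def u : QGL2 ap bp := expJp ap bp (-ap)

theorem qExp' : QExp (q ap) (e ap bp) (u ap bp) (E ap bp) := qExp ap bp

/-- The coproduct. -/
def comul : QGL2 ap bp →ₐ[Rh] CTensor (QGL2 ap bp) (QGL2 ap bp) :=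
  lift (((qRel ap bp).tensor (qExp' ap bp)).map (HCompl.of _))

theorem comul_K : comul ap bp (K ap bp) =
    HCompl.of _ (1 ⊗ₜ[Rh] K ap bp + K ap bp ⊗ₜ[Rh] E ap bp) := lift_K _

theorem comul_e : comul ap bp (e ap bp) =
    HCompl.of _ (1 ⊗ₜ[Rh] e ap bp + e ap bp ⊗ₜ[Rh] u ap bp) := lift_e _

theorem comul_Jm : comul ap bp (Jm ap bp) =
    HCompl.of _ (1 ⊗ₜ[Rh] Jm ap bp + Jm ap bp ⊗ₜ[Rh] E ap bp -
      (2 * q ap * β ap bp) • K ap bp ⊗ₜ[Rh] (I ap bp * E ap bp)) := lift_Jm _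

theorem comul_I : comul ap bp (I ap bp) =
    HCompl.of _ (1 ⊗ₜ[Rh] I ap bp + I ap bp ⊗ₜ[Rh] 1) := lift_I _

theorem comul_u : comul ap bp (u ap bp) = HCompl.of _ (u ap bp ⊗ₜ[Rh] u ap bp) := by
  rw [← (qExp' ap bp).tensor_u, map_sub, map_one, map_smul, ← comul_e, ← map_smul,
    ← map_one (comul ap bp), ← map_sub, ← (qExp' ap bp).u_eq]

/-- By uniqueness of inverses, since u is group-like and E u = 1. -/
theorem comul_E : comul ap bp (E ap bp) = HCompl.of _ (E ap bp ⊗ₜ[Rh] E ap bp) := by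
  have h1 : comul ap bp (E ap bp) * comul ap bp (u ap bp) = 1 := by
    rw [← map_mul, (qExp' ap bp).Eu, map_one]
  refine left_inv_eq_right_inv h1 ?_
  rw [comul_u, ← map_mul, Algebra.TensorProduct.tmul_mul_tmul, (qExp' ap bp).uE,
    ← Algebra.TensorProduct.one_def, map_one]

theorem comul_one : comul ap bp 1 = HCompl.of _ (1 ⊗ₜ[Rh] 1) := by
  rw [map_one, ← Algebra.TensorProduct.one_def, map_one]

theorem coassoc (x : QGL2 ap bp) : HCompl.extend (comulLeft (comul ap bp)) (comul ap bp x) =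
    HCompl.extend (comulRight (comul ap bp)) (comul ap bp x) := by
  suffices h : coassocLeft (comul ap bp) = coassocRight (comul ap bp) from DFunLike.congr_fun h x
  have h1 := comul_one ap bp
  have hE := comul_E ap bp
  exact algHom_ext ap bp (coassoc_of_skew h1 (comul_K ap bp) hE)
    (coassoc_of_skew h1 (comul_e ap bp) (comul_u ap bp))
    (coassoc_of_comodule h1 (comul_K ap bp) (comul_Jm ap bp) (comul_I ap bp) hE)
    (coassoc_of_skew h1 (comul_I ap bp) h1)

/-- The counit. -/
def counit : QGL2 ap bp →ₐ[Rh] Rh :=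
  lift (K' := 0) (e' := 0) (M' := 0) (i' := 0) (by constructor <;> simp)

theorem counit_K : counit ap bp (K ap bp) = 0 := lift_K _

theorem counit_e : counit ap bp (e ap bp) = 0 := lift_e _

theorem counit_Jm : counit ap bp (Jm ap bp) = 0 := lift_Jm _

theorem counit_I : counit ap bp (I ap bp) = 0 := lift_I _

theorem counit_u : counit ap bp (u ap bp) = 1 := by
  rw [(qExp' ap bp).u_eq, map_sub, map_smul, counit_e, map_one, smul_zero, sub_zero]

theorem counit_E : counit ap bp (E ap bp) = 1 := by
  have h := congrArg (counit ap bp) (qExp' ap bp).Eu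
  rwa [map_mul, counit_u, mul_one, map_one] at h

/-- The counit with values in the quantum algebra. -/
def counit' : QGL2 ap bp →ₐ[Rh] QGL2 ap bp := (Algebra.ofId Rh _).comp (counit ap bp)

theorem counit'_apply (x : QGL2 ap bp) :
    counit' ap bp x = algebraMap Rh _ (counit ap bp x) := rfl

theorem counit_comul (x : QGL2 ap bp) :
    HCompl.extend ((HCompl.of (QGL2 ap bp)).toLinearMap.comp
      (mulTensor ((Algebra.ofId Rh (QGL2 ap bp)).comp (counit ap bp)).toLinearMap LinearMap.id))
      (comul ap bp x) = HCompl.of (QGL2 ap bp) x := by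
  let m := (HCompl.of (QGL2 ap bp)).toLinearMap.comp
    (mulTensor (counit' ap bp).toLinearMap (AlgHom.id Rh (QGL2 ap bp)).toLinearMap)
  have hm : ∀ z, m z = HCompl.of _ (mulTensor (counit' ap bp).toLinearMap
    (AlgHom.id Rh (QGL2 ap bp)).toLinearMap z) := fun z => rfl
  have hm1 : m 1 = 1 := by rw [hm, mulTensor_one, map_one]
  have hc : ∀ a b, Commute (counit' ap bp a) (AlgHom.id Rh (QGL2 ap bp) b) := fun a b =>
    Algebra.commutes (counit ap bp a) b
  have hmul : ∀ y z, m (y * z) = m y * m z := fun y z => by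
    rw [hm, hm, hm, mulTensor_mul _ _ hc, map_mul]
  suffices h : (HCompl.extendAlgHom m hm1 hmul).comp (comul ap bp) = HCompl.of _ from
    DFunLike.congr_fun h x
  have key : ∀ {y z}, comul ap bp y = HCompl.of _ z →
      ((HCompl.extendAlgHom m hm1 hmul).comp (comul ap bp)) y = m z := by
    intro y z h
    change HCompl.extend m (comul ap bp y) = _
    rw [h, HCompl.extend_of]
  apply algHom_ext
  · rw [key (comul_K ap bp), hm]
    simp [mulTensor_tmul, counit'_apply, counit_K]
  · rw [key (comul_e ap bp), hm]
    simp [mulTensor_tmul, counit'_apply, counit_e]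
  · rw [key (comul_Jm ap bp), hm]
    simp [mulTensor_tmul, counit'_apply, counit_K, counit_Jm]
  · rw [key (comul_I ap bp), hm]
    simp [mulTensor_tmul, counit'_apply, counit_I]

theorem comul_counit (x : QGL2 ap bp) :
    HCompl.extend ((HCompl.of (QGL2 ap bp)).toLinearMap.comp
      (mulTensor LinearMap.id ((Algebra.ofId Rh (QGL2 ap bp)).comp (counit ap bp)).toLinearMap))
      (comul ap bp x) = HCompl.of (QGL2 ap bp) x := by
  let m := (HCompl.of (QGL2 ap bp)).toLinearMap.comp
    (mulTensor (AlgHom.id Rh (QGL2 ap bp)).toLinearMap (counit' ap bp).toLinearMap)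
  have hm : ∀ z, m z = HCompl.of _ (mulTensor (AlgHom.id Rh (QGL2 ap bp)).toLinearMap
    (counit' ap bp).toLinearMap z) := fun z => rfl
  have hm1 : m 1 = 1 := by rw [hm, mulTensor_one, map_one]
  have hc : ∀ a b, Commute (AlgHom.id Rh (QGL2 ap bp) a) (counit' ap bp b) := fun a b =>
    (Algebra.commutes (counit ap bp b) a).symm
  have hmul : ∀ y z, m (y * z) = m y * m z := fun y z => by
    rw [hm, hm, hm, mulTensor_mul _ _ hc, map_mul]
  suffices h : (HCompl.extendAlgHom m hm1 hmul).comp (comul ap bp) = HCompl.of _ from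
    DFunLike.congr_fun h x
  have key : ∀ {y z}, comul ap bp y = HCompl.of _ z →
      ((HCompl.extendAlgHom m hm1 hmul).comp (comul ap bp)) y = m z := by
    intro y z h
    change HCompl.extend m (comul ap bp y) = _
    rw [h, HCompl.extend_of]
  apply algHom_ext
  · rw [key (comul_K ap bp), hm]
    simp [mulTensor_tmul, counit'_apply, counit_K, counit_E]
  · rw [key (comul_e ap bp), hm]
    simp [mulTensor_tmul, counit'_apply, counit_e, counit_u]
  · rw [key (comul_Jm ap bp), hm]
    simp [mulTensor_tmul, counit'_apply, counit_I, counit_E, counit_Jm]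
  · rw [key (comul_I ap bp), hm]
    simp [mulTensor_tmul, counit'_apply, counit_I]

/-- The antipode, as a homomorphism to the opposite algebra. -/
def antipodeOp : QGL2 ap bp →ₐ[Rh] (QGL2 ap bp)ᵐᵒᵖ :=
  lift ((qRel ap bp).antipode (qExp' ap bp))

/-- The antipode. -/
def antipode : QGL2 ap bp →ₗ[Rh] QGL2 ap bp :=
  (MulOpposite.opLinearEquiv Rh).symm.toLinearMap.comp (antipodeOp ap bp).toLinearMap

theorem antipode_apply (x : QGL2 ap bp) :
    antipode ap bp x = MulOpposite.unop (antipodeOp ap bp x) := rfl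

theorem antipode_mul (x y : QGL2 ap bp) :
    antipode ap bp (x * y) = antipode ap bp y * antipode ap bp x := by
  simp only [antipode_apply, map_mul, MulOpposite.unop_mul]

theorem antipode_one : antipode ap bp 1 = 1 := by
  simp only [antipode_apply, map_one, MulOpposite.unop_one]

theorem antipode_K : antipode ap bp (K ap bp) = -(K ap bp * u ap bp) :=
  congrArg MulOpposite.unop (lift_K ((qRel ap bp).antipode (qExp' ap bp)))

theorem antipode_e : antipode ap bp (e ap bp) = -(e ap bp * E ap bp) :=
  congrArg MulOpposite.unop (lift_e ((qRel ap bp).antipode (qExp' ap bp)))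

theorem antipode_Jm : antipode ap bp (Jm ap bp) = -(Jm ap bp * u ap bp) -
    (2 * q ap * β ap bp) • (I ap bp * (K ap bp * u ap bp)) :=
  congrArg MulOpposite.unop (lift_Jm ((qRel ap bp).antipode (qExp' ap bp)))

theorem antipode_I : antipode ap bp (I ap bp) = -I ap bp :=
  congrArg MulOpposite.unop (lift_I ((qRel ap bp).antipode (qExp' ap bp)))

theorem antipode_u : antipode ap bp (u ap bp) = E ap bp := by
  have h := (qExp' ap bp).qeE
  nth_rewrite 1 [(qExp' ap bp).u_eq]
  rw [map_sub, map_smul, antipode_one, antipode_e, smul_neg, h]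
  abel

theorem antipode_E : antipode ap bp (E ap bp) = u ap bp := by
  have h := congrArg (antipode ap bp) (qExp' ap bp).Eu
  rw [antipode_mul, antipode_u, antipode_one] at h
  exact (left_inv_eq_right_inv (qExp' ap bp).uE h).symm

theorem antipode_left (x : QGL2 ap bp) :
    HCompl.extend ((HCompl.of (QGL2 ap bp)).toLinearMap.comp
      (mulTensor (antipode ap bp) LinearMap.id)) (comul ap bp x) =
      HCompl.of _ (algebraMap Rh _ (counit ap bp x)) := by
  have X := qExp' ap bp
  have H := qRel ap bp
  let m := HCompl.extend ((HCompl.of (QGL2 ap bp)).toLinearMap.comp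
      (mulTensor (antipode ap bp) LinearMap.id))
  -- Not a difference of algebra homomorphisms, so `algHom_ext` is unavailable; instead the kernel
  -- of D is shown to be closed under products.
  let D : QGL2 ap bp →ₗ[Rh] HCompl (QGL2 ap bp) := m.comp (comul ap bp).toLinearMap -
    ((HCompl.of (QGL2 ap bp)).comp (counit' ap bp)).toLinearMap
  have hD : ∀ y, D y = m (comul ap bp y) -
    HCompl.of _ (algebraMap Rh _ (counit ap bp y)) := fun y => rfl
  have key : ∀ {y z}, comul ap bp y = HCompl.of _ z →
      D y = HCompl.of _ (mulTensor (antipode ap bp) LinearMap.id z -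
        algebraMap Rh _ (counit ap bp y)) := by
    intro y z h
    rw [hD, h, map_sub]
    congr 1
  rw [← sub_eq_zero]
  refine linearMap_eq_zero ap bp D ?_ ?_ ?_ ?_ ?_ ?_ x
  · rw [key (comul_one ap bp)]
    simp [mulTensor_tmul, antipode_one]
  · intro y z hy hz
    rw [hD, sub_eq_zero] at hy hz ⊢
    have h := extend_antipode_left_mul _ (antipode_mul ap bp) (y := comul ap bp z) hy
    rw [map_mul (comul ap bp)]
    refine h.trans ?_
    rw [hz, ← map_smul, Algebra.smul_def, map_mul, map_mul, map_mul]
    rw [map_mul]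
  · rw [key (comul_K ap bp)]
    simp [mulTensor_tmul, antipode_one, antipode_K, counit_K, mul_assoc, X.uE]
  · rw [key (comul_e ap bp)]
    simp [mulTensor_tmul, antipode_one, antipode_e, counit_e, mul_assoc, X.Eu]
  · rw [key (comul_Jm ap bp), map_sub (mulTensor _ _), map_add, map_smul, mulTensor_tmul,
      mulTensor_tmul, mulTensor_tmul, counit_Jm, map_zero, sub_zero, antipode_one, antipode_K,
      antipode_Jm, LinearMap.id_apply, LinearMap.id_apply, LinearMap.id_apply, one_mul,
      H.antipode_Jm_left X, map_zero]
  · rw [key (comul_I ap bp)]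
    simp [mulTensor_tmul, antipode_one, antipode_I, counit_I]

theorem antipode_right (x : QGL2 ap bp) :
    HCompl.extend ((HCompl.of (QGL2 ap bp)).toLinearMap.comp
      (mulTensor LinearMap.id (antipode ap bp))) (comul ap bp x) =
      HCompl.of _ (algebraMap Rh _ (counit ap bp x)) := by
  have X := qExp' ap bp
  have H := qRel ap bp
  let m := HCompl.extend ((HCompl.of (QGL2 ap bp)).toLinearMap.comp
      (mulTensor LinearMap.id (antipode ap bp)))
  let D : QGL2 ap bp →ₗ[Rh] HCompl (QGL2 ap bp) := m.comp (comul ap bp).toLinearMap -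
    ((HCompl.of (QGL2 ap bp)).comp (counit' ap bp)).toLinearMap
  have hD : ∀ y, D y = m (comul ap bp y) -
    HCompl.of _ (algebraMap Rh _ (counit ap bp y)) := fun y => rfl
  have key : ∀ {y z}, comul ap bp y = HCompl.of _ z →
      D y = HCompl.of _ (mulTensor LinearMap.id (antipode ap bp) z -
        algebraMap Rh _ (counit ap bp y)) := by
    intro y z h
    rw [hD, h, map_sub]
    congr 1
  rw [← sub_eq_zero]
  refine linearMap_eq_zero ap bp D ?_ ?_ ?_ ?_ ?_ ?_ x
  · rw [key (comul_one ap bp)]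
    simp [mulTensor_tmul, antipode_one]
  · intro y z hy hz
    rw [hD, sub_eq_zero] at hy hz ⊢
    have h := extend_antipode_right_mul _ (antipode_mul ap bp) (x := comul ap bp y) hz
    rw [map_mul (comul ap bp)]
    refine h.trans ?_
    rw [hy, ← map_smul, Algebra.smul_def, ← map_mul, map_mul (counit ap bp), mul_comm]
  · rw [key (comul_K ap bp)]
    simp [mulTensor_tmul, antipode_K, antipode_E, counit_K]
  · rw [key (comul_e ap bp)]
    simp [mulTensor_tmul, antipode_e, antipode_u, counit_e]
  · rw [key (comul_Jm ap bp), map_sub (mulTensor _ _), map_add, map_smul, mulTensor_tmul,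
      mulTensor_tmul, mulTensor_tmul, counit_Jm, map_zero, sub_zero, antipode_mul, antipode_E,
      antipode_I, antipode_Jm, LinearMap.id_apply, LinearMap.id_apply, LinearMap.id_apply, one_mul,
      H.antipode_Jm_right X, map_zero]
  · rw [key (comul_I ap bp)]
    simp [mulTensor_tmul, antipode_one, antipode_I, counit_I]

/-- The topological Hopf algebra structure of the quantum algebra. -/
def hopf : TopHopf (QGL2 ap bp) where
  comul := comul ap bp
  counit := counit ap bp
  antipode := antipode ap bp
  coassoc := coassoc ap bp
  counit_comul := counit_comul ap bp
  comul_counit := comul_counit ap bp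
  antipode_left := antipode_left ap bp
  antipode_right := antipode_right ap bp

end QGL2

/-! ### The exponential of the cocommutator matrix. -/

section Triangular

variable {A : Type} [Ring A]

theorem Matrix.lowerTriangular_pow (p s : A) (n : ℕ) :
    (!![p, 0; s, p] ^ n) 0 0 = p ^ n ∧ (!![p, 0; s, p] ^ n) 0 1 = 0 ∧
      (!![p, 0; s, p] ^ n) 1 1 = p ^ n := by
  induction n with
  | zero => simp
  | succ n ih =>
    obtain ⟨h1, h2, h3⟩ := ih
    simp [pow_succ, Matrix.mul_apply, Fin.sum_univ_two, h1, h2, h3]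

/-- In the free algebra p and s do not commute and the entry is a sum of words pⁱ s pʲ; it collapses
only after θ, where the images commute. -/
theorem Matrix.map_lowerTriangular_pow {B : Type} [Ring B] (θ : A →+* B) {p s : A}
    (h : Commute (θ s) (θ p)) (n : ℕ) :
    θ ((!![p, 0; s, p] ^ (n + 1)) 1 0) = ((n + 1 : ℕ) : B) * (θ s * θ p ^ n) := by
  induction n with
  | zero => simp
  | succ n ih =>
    have h1 : (!![p, 0; s, p] ^ (n + 1 + 1)) 1 0 =
        (!![p, 0; s, p] ^ (n + 1)) 1 0 * p + p ^ (n + 1) * s := by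
      rw [pow_succ, Matrix.mul_apply, Fin.sum_univ_two,
        (Matrix.lowerTriangular_pow p s (n + 1)).2.2]
      rfl
    rw [h1, map_add, map_mul, map_mul, ih, map_pow, ← (h.pow_right (n + 1)).eq, pow_succ (θ p),
      Nat.cast_succ (n + 1), add_mul, one_mul, mul_assoc, mul_assoc]

end Triangular

/-! ### The coproduct and counit on the original generators; centrality of the Casimir. -/

namespace QGL2

variable (ap bp : ℝ)

theorem mk_smul_C (r : ℝ) (x : PowerSeries Free) :
    mk ap bp (r • x) = (PowerSeries.C r : Rh) • mk ap bp x :=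
  smul_eq ap bp r (mk ap bp x)

theorem mk_C_smul (r : ℝ) (x : Free) :
    mk ap bp (PowerSeries.C (r • x)) = (PowerSeries.C r : Rh) • mk ap bp (PowerSeries.C x) := by
  rw [← mk_smul_C]
  congr 1
  ext n
  by_cases hn : n = 0 <;> simp [PowerSeries.coeff_C, hn]

theorem gen_eq (X : GL2) :
    gen ap bp X = GL2.lin (J3 ap bp) (Jp ap bp) (Jm ap bp) (I ap bp) X := by
  simp only [gen, freeLin, GL2.lin, LinearMap.coe_mk, AddHom.coe_mk, map_add, mk_C_smul, smul_eq]
  rfl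

theorem gen_pair_one : gen ap bp (GL2.pair ap bp 1) = Jm ap bp := by
  rw [gen_eq]
  exact (GL2.lin_basis _ _ _ _).2.2.1

theorem gen_pair_zero : gen ap bp (GL2.pair ap bp 0) = K ap bp := by
  rw [gen_eq]
  change GL2.lin _ _ _ _ (GL2.J3 - (bp / ap) • GL2.I) = _
  rw [map_sub, map_smul, (GL2.lin_basis _ _ _ _).1, (GL2.lin_basis _ _ _ _).2.2.2, smul_eq]
  rfl

theorem neg_cocommMatrix_map : (-GL2.cocommMatrix ap bp).map freeLin =
    !![ap • FreeAlgebra.ι ℝ Gen.jp, 0;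
      -(bp / 2) • FreeAlgebra.ι ℝ Gen.i, ap • FreeAlgebra.ι ℝ Gen.jp] := by
  obtain ⟨-, h2, -, h4⟩ := GL2.lin_basis (FreeAlgebra.ι ℝ Gen.j3) (FreeAlgebra.ι ℝ Gen.jp)
    (FreeAlgebra.ι ℝ Gen.jm) (FreeAlgebra.ι ℝ Gen.i)
  ext i j
  fin_cases i <;> fin_cases j <;> simp [GL2.cocommMatrix, freeLin, h2, h4]

theorem expMatrix_diag (i : Fin 2) :
    expMatrix ap bp (-GL2.cocommMatrix ap bp) i i = expJp ap bp ap := by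
  rw [expMatrix, neg_cocommMatrix_map, expJp]
  change mk ap bp _ = _
  congr 1
  ext n : 1
  simp only [hexpMatrix, hexp, PowerSeries.coeff_mk]
  have h := Matrix.lowerTriangular_pow (ap • FreeAlgebra.ι ℝ Gen.jp)
    (-(bp / 2) • FreeAlgebra.ι ℝ Gen.i) n
  fin_cases i
  · exact congrArg _ h.1
  · exact congrArg _ h.2.2

theorem expMatrix_zero_one : expMatrix ap bp (-GL2.cocommMatrix ap bp) 0 1 = 0 := by
  rw [expMatrix, neg_cocommMatrix_map]
  change mk ap bp _ = _
  rw [← map_zero (mk ap bp)]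
  congr 1
  ext n : 1
  simp only [hexpMatrix, PowerSeries.coeff_mk, map_zero,
    (Matrix.lowerTriangular_pow (ap • FreeAlgebra.ι ℝ Gen.jp)
      (-(bp / 2) • FreeAlgebra.ι ℝ Gen.i) n).2.1, smul_zero]

theorem I_mul_Jp : I ap bp * Jp ap bp = Jp ap bp * I ap bp := by
  have h : ⁅fgen .i, fgen .jp⁆ ∈ relIdeal ap bp := (TwoSidedIdeal.mem_iInf _).2 fun n =>
    TwoSidedIdeal.subset_span (Or.inl (Rel.i_central _))
  have h1 := mk_eq_zero ap bp h
  rwa [Ring.lie_def, map_sub, map_mul, map_mul, sub_eq_zero] at h1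

theorem J3_eq : J3 ap bp = K ap bp + β ap bp • I ap bp := (sub_add_cancel _ _).symm

variable [hap : Fact (ap ≠ 0)]

theorem mk_eq_hsum (x : PowerSeries Free) :
    mk ap bp x = hsum fun k => mk ap bp (PowerSeries.C (PowerSeries.coeff k x)) := by
  let θ : PowerSeries Free →ₗ[Rh] QGL2 ap bp :=
    { toFun := mk ap bp
      map_add' := map_add _
      map_smul' := fun _ _ => rfl }
  exact (congrArg θ (PowerSeries.eq_hsum_coeff x)).trans (map_hsum θ _)

/-- The n + 1 equal words divided by (n + 1)! leave 1/n!, so the entry is h times the off-diagonal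
element times the diagonal exponential. -/
theorem expMatrix_one_zero : expMatrix ap bp (-GL2.cocommMatrix ap bp) 1 0 =
    -((2 * q ap * β ap bp) • (I ap bp * E ap bp)) := by
  have hcomm : Commute (mk ap bp (PowerSeries.C (-(bp / 2) • FreeAlgebra.ι ℝ Gen.i)))
      (mk ap bp (PowerSeries.C (ap • FreeAlgebra.ι ℝ Gen.jp))) := by
    rw [mk_C_smul, mk_C_smul]
    exact (show Commute (I ap bp) (Jp ap bp) from I_mul_Jp ap bp).smul_left _ |>.smul_right _
  rw [expMatrix, neg_cocommMatrix_map, two_mul_q_mul_β ap bp hap.out, E, expJp_eq, texp]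
  change mk ap bp (hexpMatrix _ 1 0) = _
  rw [mk_eq_hsum, hsum_rec, mul_hsum, mul_smul, ← smul_neg]
  have h0 : ∀ (A : Type) [Ring A] [Algebra ℝ A] (M : Matrix (Fin 2) (Fin 2) A) (n : ℕ),
    PowerSeries.coeff n (hexpMatrix M 1 0) = (n ! : ℝ)⁻¹ • (M ^ n) 1 0 := fun A _ _ M n => by
      simp [hexpMatrix]
  simp only [h0, mk_C_smul]
  -- The term of degree 0 is an off-diagonal entry of the identity; this is where the factor h comes
  -- from.
  rw [pow_zero, Matrix.one_apply_ne (by decide), map_zero, map_zero, smul_zero, zero_add]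
  congr 1
  have hl : ∀ (c : Rh) (f : ℕ → QGL2 ap bp), c • hsum f = hsum fun n => c • f n := fun c f =>
    map_hsum (LinearMap.lsmul Rh _ c) f
  rw [← neg_smul, hl]
  congr 1
  ext n
  have h1 := Matrix.map_lowerTriangular_pow ((mk ap bp).comp PowerSeries.C) hcomm n
  rw [RingHom.comp_apply] at h1
  rw [h1, RingHom.comp_apply, RingHom.comp_apply, mk_C_smul, mk_C_smul, ← nsmul_eq_mul,
    ← Nat.cast_smul_eq_nsmul Rh, smul_mul_assoc, mul_smul_comm, smul_smul, smul_smul, smul_smul]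
  have hfac : (PowerSeries.C ((n + 1)! : ℝ)⁻¹ : Rh) * ((n + 1 : ℕ) : Rh) =
      PowerSeries.C (n ! : ℝ)⁻¹ := by
    rw [← map_natCast (PowerSeries.C (R := ℝ)), ← map_mul, Nat.factorial_succ]
    congr 1
    push_cast
    field_simp
  rw [hfac, map_neg, mul_comm]
  rfl

/-- Exponentiating h a₊ times either side gives E ⊗ E: on the left because E is group-like, on the
right because the two summands commute. Injectivity of the exponential and invertibility of a₊
conclude. -/
theorem comul_Jp : comul ap bp (Jp ap bp) = ctmul 1 (Jp ap bp) + ctmul (Jp ap bp) 1 := by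
  have hunit : IsUnit (PowerSeries.C ap : Rh) := (isUnit_iff_ne_zero.2 hap.out).map _
  refine (hunit.smul_left_cancel).1 ?_
  refine texp_injective (HCompl.X_smul_injective (X_smul_tensor_injective ap bp)) ?_
  have hl := map_texp ((HCompl.of (QGL2 ap bp ⊗[Rh] QGL2 ap bp)).comp
    Algebra.TensorProduct.includeLeft) ((PowerSeries.C ap : Rh) • Jp ap bp)
  have hr := map_texp ((HCompl.of (QGL2 ap bp ⊗[Rh] QGL2 ap bp)).comp
    Algebra.TensorProduct.includeRight) ((PowerSeries.C ap : Rh) • Jp ap bp)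
  rw [map_smul] at hl hr
  have hE := comul_E ap bp
  rw [E, expJp_eq, map_texp, map_smul] at hE
  rw [hE, smul_add]
  have hcomm : Commute ((PowerSeries.C ap : Rh) • ctmul 1 (Jp ap bp))
      ((PowerSeries.C ap : Rh) • ctmul (Jp ap bp) 1) := by
    refine Commute.smul_left (Commute.smul_right ?_ _) _
    refine Commute.map (x := (1 : QGL2 ap bp) ⊗ₜ[Rh] Jp ap bp)
      (y := Jp ap bp ⊗ₜ[Rh] (1 : QGL2 ap bp)) ?_ (HCompl.of _)
    change _ * _ = _ * _
    simp
  rw [texp_add hcomm]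
  refine Eq.trans ?_ (congrArg₂ (· * ·) hr hl)
  change _ = HCompl.of _ _ * HCompl.of _ _
  rw [← map_mul]
  simp

theorem comul_J3 : comul ap bp (J3 ap bp) = ctmul 1 (J3 ap bp) +
    ctmul (J3 ap bp) (expJp ap bp ap) -
    ctmul (bp • I ap bp) (ap⁻¹ • (expJp ap bp ap - 1)) := by
  have h : (bp • I ap bp) ⊗ₜ[Rh] (ap⁻¹ • (expJp ap bp ap - 1)) =
      β ap bp • (I ap bp ⊗ₜ[Rh] (E ap bp - 1)) := by
    rw [smul_eq, smul_eq, TensorProduct.tmul_smul, ← TensorProduct.smul_tmul', smul_smul, ← map_mul,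
      mul_comm, ← div_eq_mul_inv]
    rfl
  simp only [ctmul]
  rw [h, ← map_add, ← map_sub, J3_eq, map_add, map_smul, comul_K, comul_I, ← map_smul, ← map_add]
  congr 1
  change _ = _ ⊗ₜ _ + _ ⊗ₜ E ap bp - _
  rw [TensorProduct.tmul_add, TensorProduct.add_tmul, TensorProduct.tmul_sub,
    TensorProduct.tmul_smul, ← TensorProduct.smul_tmul', smul_add, smul_sub]
  abel

theorem comul_Jm' : comul ap bp (Jm ap bp) = ctmul 1 (Jm ap bp) +
    ctmul (Jm ap bp) (expJp ap bp ap) - (PowerSeries.X : Rh) •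
      ctmul ((bp / 2) • (J3 ap bp - (bp / ap) • I ap bp)) (I ap bp * expJp ap bp ap) := by
  rw [smul_eq ap bp (bp / ap), smul_eq ap bp (bp / 2), comul_Jm, two_mul_q_mul_β ap bp hap.out,
    mul_smul]
  rfl

theorem comul_pair (i : Fin 2) : comul ap bp (gen ap bp (GL2.pair ap bp i)) =
    ctmul 1 (gen ap bp (GL2.pair ap bp i)) +
      ∑ j, ctmul (gen ap bp (GL2.pair ap bp j))
        (expMatrix ap bp (-GL2.cocommMatrix ap bp) i j) := by
  rw [Fin.sum_univ_two]
  fin_cases i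
  · change comul ap bp (gen ap bp (GL2.pair ap bp 0)) = ctmul 1 (gen ap bp (GL2.pair ap bp 0)) +
      (ctmul _ (expMatrix ap bp _ 0 0) + ctmul _ (expMatrix ap bp _ 0 1))
    rw [gen_pair_zero, gen_pair_one, expMatrix_diag, expMatrix_zero_one, comul_K]
    simp only [ctmul, TensorProduct.tmul_zero, map_zero, add_zero, map_add]
    rfl
  · change comul ap bp (gen ap bp (GL2.pair ap bp 1)) = ctmul 1 (gen ap bp (GL2.pair ap bp 1)) +
      (ctmul _ (expMatrix ap bp _ 1 0) + ctmul _ (expMatrix ap bp _ 1 1))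
    rw [gen_pair_zero, gen_pair_one, expMatrix_diag, expMatrix_one_zero, comul_Jm]
    simp only [ctmul, TensorProduct.tmul_neg, TensorProduct.tmul_smul, map_add, map_sub, map_neg]
    rw [add_sub_assoc, sub_eq_neg_add]
    rfl

theorem counit_Jp : counit ap bp (Jp ap bp) = 0 := by
  have hunit : IsUnit (PowerSeries.C ap : Rh) := (isUnit_iff_ne_zero.2 hap.out).map _
  have hE := counit_E ap bp
  rw [E, expJp_eq, map_texp, map_smul, ← texp_zero] at hE
  refine (hunit.smul_eq_zero).1 (texp_injective (fun x hx => ?_) hE)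
  exact (mul_eq_zero.1 hx).resolve_left PowerSeries.X_ne_zero

theorem counit_gen (X : GL2) : counit ap bp (gen ap bp X) = 0 := by
  simp only [gen_eq, GL2.lin, LinearMap.coe_mk, AddHom.coe_mk, smul_eq]
  rw [map_add, map_add, map_add, map_smul, map_smul, map_smul, map_smul, J3_eq, map_add, map_smul,
    counit_K, counit_I, counit_Jp, counit_Jm]
  simp

/-- The undeformed form commutes with J₃, e, f, I; its centralizer is the kernel of a linear map and
is closed under products. -/
theorem casimir_central (x : QGL2 ap bp) : casimir ap bp * x = x * casimir ap bp := by
  obtain ⟨h3, he, hf, hi⟩ := (isRep ap bp).casimir_comm (β ap bp ^ 2)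
  rw [← casimir_eq] at h3 he hf hi
  have hK : Commute (casimir ap bp) (K ap bp) := h3.sub_right (hi.smul_right _)
  have hM : Commute (casimir ap bp) (Jm ap bp) := by
    rw [Jm_eq]
    exact hf.add_right ((hK.pow_right 2).smul_right _)
  let D : QGL2 ap bp →ₗ[Rh] QGL2 ap bp :=
    LinearMap.mulLeft Rh (casimir ap bp) - LinearMap.mulRight Rh (casimir ap bp)
  have hD : ∀ y, D y = 0 ↔ Commute (casimir ap bp) y := fun y => sub_eq_zero
  refine (hD x).1 (linearMap_eq_zero ap bp D ?_ ?_ ?_ ?_ ?_ ?_ x)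
  · exact (hD _).2 (Commute.one_right _)
  · exact fun y z hy hz => (hD _).2 (((hD y).1 hy).mul_right ((hD z).1 hz))
  · exact (hD _).2 hK
  · exact (hD _).2 he
  · exact (hD _).2 hM
  · exact (hD _).2 hi

end QGL2

/-! ### The Lie bialgebra -/

theorem lie_smul_wedge_add {L : Type} [LieRing L] [LieAlgebra ℝ L] (c a b : ℝ)
    (x y z y' z' : L) : ⁅x, c • (a • wedge y z + b • wedge y' z')⁆ =
      c • (a • (wedge ⁅x, y⁆ z + wedge y ⁅x, z⁆) + b • (wedge ⁅x, y'⁆ z' + wedge y' ⁅x, z'⁆)) := by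
  simp only [wedge, lie_smul, lie_add, lie_sub, TensorProduct.LieModule.lie_tmul_right]
  module

namespace GL2

theorem lie_J3_Jp : ⁅J3, Jp⁆ = (2 : ℝ) • Jp := by
  rw [Ring.lie_def]; ext i j; fin_cases i <;> fin_cases j <;> simp [J3, Jp]; norm_num

theorem lie_Jm_Jp : ⁅Jm, Jp⁆ = -J3 := by
  rw [Ring.lie_def]; ext i j; fin_cases i <;> fin_cases j <;> simp [J3, Jp, Jm]

theorem lie_Jm_J3 : ⁅Jm, J3⁆ = (2 : ℝ) • Jm := by
  rw [Ring.lie_def]; ext i j; fin_cases i <;> fin_cases j <;> simp [J3, Jm]; norm_num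

theorem I_eq_one : I = 1 := by
  ext i j; fin_cases i <;> fin_cases j <;> simp [I]

theorem lie_I (X : GL2) : ⁅X, I⁆ = 0 := by
  rw [Ring.lie_def, I_eq_one, mul_one, one_mul, sub_self]

theorem I_lie (X : GL2) : ⁅I, X⁆ = 0 := by
  rw [Ring.lie_def, I_eq_one, mul_one, one_mul, sub_self]

variable (ap bp : ℝ)

theorem cocommutatorIplus_eq : cocommutatorIplus ap bp 0 =
    lin (ap • wedge J3 Jp + bp • wedge Jp I) 0
      (-(ap • wedge Jp Jm) - (bp / 2) • wedge J3 I) 0 := by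
  obtain ⟨h1, h2, h3, h4⟩ := lin_basis (ap • wedge J3 Jp + bp • wedge Jp I) 0
      (-(ap • wedge Jp Jm) - (bp / 2) • wedge J3 I) 0
  refine linearMap_ext ?_ ?_ ?_ ?_
  · rw [h1, cocommutatorIplus, cocommutator, (lin_basis _ _ _ _).1]; simp
  · rw [h2, cocommutatorIplus, cocommutator, (lin_basis _ _ _ _).2.1]; simp
  · rw [h3, cocommutatorIplus, cocommutator, (lin_basis _ _ _ _).2.2.1]; simp; abel
  · rw [h4, cocommutatorIplus, cocommutator, (lin_basis _ _ _ _).2.2.2]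

theorem cocommutatorIplus_basis :
    cocommutatorIplus ap bp 0 J3 = ap • wedge J3 Jp + bp • wedge Jp I ∧
    cocommutatorIplus ap bp 0 Jp = 0 ∧
    cocommutatorIplus ap bp 0 Jm = -(ap • wedge Jp Jm) - (bp / 2) • wedge J3 I ∧
    cocommutatorIplus ap bp 0 I = 0 := by
  rw [cocommutatorIplus_eq]
  exact lin_basis _ _ _ _

theorem cocommutatorIplus_coboundary (X : GL2) :
    cocommutatorIplus ap bp 0 X = ⁅X, rMatrix ap bp⁆ := by
  obtain ⟨h1, h2, h3, h4⟩ := cocommutatorIplus_basis ap bp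
  have hself : ∀ Y : GL2, ⁅Y, Y⁆ = 0 := fun Y => lie_self Y
  suffices h : cocommutatorIplus ap bp 0 =
      { toFun := fun X => ⁅X, rMatrix ap bp⁆
        map_add' := fun X Y => add_lie X Y _
        map_smul' := fun r X => smul_lie r X _ } from
    DFunLike.congr_fun h X
  have hJ : ⁅Jp, J3⁆ = -((2 : ℝ) • Jp) := by rw [← lie_skew, lie_J3_Jp]
  have hr : ∀ Y : GL2, ⁅Y, rMatrix ap bp⁆ = (1 / 2 : ℝ) • (ap • (wedge ⁅Y, J3⁆ Jp +
      wedge J3 ⁅Y, Jp⁆) + bp • (wedge ⁅Y, Jp⁆ I + wedge Jp ⁅Y, I⁆)) := fun Y =>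
    lie_smul_wedge_add (1 / 2) ap bp Y J3 Jp Jp I
  refine linearMap_ext ?_ ?_ ?_ ?_
  · refine Eq.trans h1 (Eq.trans ?_ (hr J3).symm)
    simp only [wedge, lie_J3_Jp, hself, lie_I, TensorProduct.tmul_smul, TensorProduct.zero_tmul,
      TensorProduct.tmul_zero, ← TensorProduct.smul_tmul']
    module
  · refine Eq.trans h2 (Eq.trans ?_ (hr Jp).symm)
    simp only [wedge, hJ, hself, lie_I, TensorProduct.tmul_smul, TensorProduct.zero_tmul,
      TensorProduct.tmul_zero, ← TensorProduct.smul_tmul', TensorProduct.neg_tmul,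
      TensorProduct.tmul_neg]
    module
  · refine Eq.trans h3 (Eq.trans ?_ (hr Jm).symm)
    simp only [wedge, lie_Jm_J3, lie_Jm_Jp, lie_I, TensorProduct.tmul_smul, TensorProduct.zero_tmul,
      TensorProduct.tmul_zero, ← TensorProduct.smul_tmul', TensorProduct.neg_tmul,
      TensorProduct.tmul_neg]
    module
  · refine Eq.trans h4 (Eq.trans ?_ (hr I).symm)
    simp only [wedge, I_lie, TensorProduct.zero_tmul, TensorProduct.tmul_zero]
    module

/-- In these coordinates antisymmetry and the Jacobi identity of the dual bracket are polynomial
identities in the values of the functionals. -/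
theorem dualBracket_basis (ξ η : Module.Dual ℝ GL2) :
    dualBracket (cocommutatorIplus ap bp 0) ξ η = lin
      (ap * (ξ J3 * η Jp - ξ Jp * η J3) + bp * (ξ Jp * η I - ξ I * η Jp)) 0
      (-(ap * (ξ Jp * η Jm - ξ Jm * η Jp)) - bp / 2 * (ξ J3 * η I - ξ I * η J3)) 0 := by
  obtain ⟨h1, h2, h3, h4⟩ := cocommutatorIplus_basis ap bp
  refine linearMap_ext ?_ ?_ ?_ ?_
  · rw [(lin_basis _ _ _ _).1, dualBracket, LinearMap.comp_apply, h1]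
    simp [wedge]
  · rw [(lin_basis _ _ _ _).2.1, dualBracket, LinearMap.comp_apply, h2, map_zero]
  · rw [(lin_basis _ _ _ _).2.2.1, dualBracket, LinearMap.comp_apply, h3]
    simp [wedge]
  · rw [(lin_basis _ _ _ _).2.2.2, dualBracket, LinearMap.comp_apply, h4, map_zero]

theorem isLieBialgebra : IsLieBialgebra (cocommutatorIplus ap bp 0) where
  cocycle x y := by
    simp only [cocommutatorIplus_coboundary]
    -- For a coboundary the cocycle identity is the module axiom for the action on r.
    exact lie_lie x y _
  dual_self ξ := by
    rw [dualBracket_basis]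
    refine linearMap_ext ?_ ?_ ?_ ?_ <;> simp only [lin_basis] <;> simp <;> ring
  dual_jacobi ξ η ζ := by
    simp only [dualBracket_basis]
    refine linearMap_ext ?_ ?_ ?_ ?_ <;>
      simp only [LinearMap.add_apply, lin_basis, LinearMap.zero_apply] <;> ring

theorem cocommutatorIplus_pair (hap : ap ≠ 0) (i : Fin 2) :
    cocommutatorIplus ap bp 0 (pair ap bp i) =
      ∑ j, wedge (cocommMatrix ap bp i j) (pair ap bp j) := by
  obtain ⟨h1, -, h3, h4⟩ := cocommutatorIplus_basis ap bp
  have hb : ap * (bp / ap) = bp := by field_simp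
  rw [Fin.sum_univ_two]
  fin_cases i
  · change cocommutatorIplus ap bp 0 (J3 - (bp / ap) • I) =
      wedge (-(ap • Jp)) (J3 - (bp / ap) • I) + wedge 0 Jm
    rw [map_sub, map_smul, h1, h4]
    nth_rewrite 1 [← hb]
    simp only [wedge, TensorProduct.tmul_sub, TensorProduct.sub_tmul, TensorProduct.tmul_smul,
      TensorProduct.tmul_neg, TensorProduct.neg_tmul, ← TensorProduct.smul_tmul',
      TensorProduct.zero_tmul, TensorProduct.tmul_zero]
    module
  · change cocommutatorIplus ap bp 0 Jm =
      wedge ((bp / 2) • I) (J3 - (bp / ap) • I) + wedge (-(ap • Jp)) Jm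
    rw [h3]
    simp only [wedge, TensorProduct.tmul_sub, TensorProduct.sub_tmul, TensorProduct.tmul_smul,
      TensorProduct.tmul_neg, TensorProduct.neg_tmul, ← TensorProduct.smul_tmul']
    module

/-- In the matrix algebra, J₃, J₊ and I = 1 span a subalgebra whose products are immediate, so all
three commutators expand in simple tensors of these elements. -/
theorem rMatrix_cybe : CYBE (rMatrix ap bp) := by
  have h33 : J3 * J3 = 1 := by
    ext i j; fin_cases i <;> fin_cases j <;> simp [J3]
  have h3p : J3 * Jp = Jp := by
    ext i j; fin_cases i <;> fin_cases j <;> simp [J3, Jp]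
  have hp3 : Jp * J3 = -Jp := by
    ext i j; fin_cases i <;> fin_cases j <;> simp [J3, Jp]
  have hpp : Jp * Jp = 0 := by
    ext i j; fin_cases i <;> fin_cases j <;> simp [Jp]
  have hw : ∀ x y : GL2, wedge x y = x ⊗ₜ[ℝ] y + (-1 : ℝ) • y ⊗ₜ[ℝ] x := fun x y => by
    rw [wedge]; module
  simp only [CYBE, rMatrix, hw, I_eq_one, map_smul, map_add,
    Algebra.TensorProduct.map_tmul, AlgHom.id_apply, Algebra.TensorProduct.includeLeft_apply,
    Algebra.TensorProduct.includeRight_apply, map_one, Ring.lie_def, mul_add, add_mul,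
    smul_mul_assoc, mul_smul_comm, Algebra.TensorProduct.tmul_mul_tmul, mul_one, one_mul,
    h33, h3p, hp3, hpp, TensorProduct.zero_tmul, TensorProduct.tmul_zero, TensorProduct.tmul_neg,
    TensorProduct.neg_tmul, Algebra.TensorProduct.one_def]
  module

end GL2

/-! ### Quantization -/

section Semiclassical

variable {k A : Type} [CommRing k] [Ring A] [Algebra k A]

open TensorProduct

/-- With x = h, expanding E to second order isolates the cobracket at first order and gives the
remainder explicitly. -/
theorem antisymm_skew {x a : k} {K e E w : A}
    (hE : E = 1 + (x * a) • e + (x ^ 2 * a ^ 2) • w) :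
    (1 ⊗ₜ[k] K + K ⊗ₜ[k] E) - (K ⊗ₜ[k] 1 + E ⊗ₜ[k] K) - x • (a • (K ⊗ₜ[k] e - e ⊗ₜ[k] K)) =
      x ^ 2 • (a ^ 2 • (K ⊗ₜ[k] w - w ⊗ₜ[k] K)) := by
  rw [hE]
  simp only [tmul_add, add_tmul, tmul_smul, ← smul_tmul']
  module

theorem antisymm_comodule {x a b c : k} {K e E i M f n v w : A}
    (hE : E = 1 + (x * a) • e + (x ^ 2 * a ^ 2) • w) (hM : M = f + (x * c) • n)
    (hi : i * E = i + (x * a) • v) :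
    (1 ⊗ₜ[k] M + M ⊗ₜ[k] E - (x * b) • K ⊗ₜ[k] (i * E)) -
        (M ⊗ₜ[k] 1 + E ⊗ₜ[k] M - (x * b) • (i * E) ⊗ₜ[k] K) -
        x • (-(a • (e ⊗ₜ[k] f - f ⊗ₜ[k] e)) - b • (K ⊗ₜ[k] i - i ⊗ₜ[k] K)) =
      x ^ 2 • (a ^ 2 • (M ⊗ₜ[k] w - w ⊗ₜ[k] M) + (a * c) • (n ⊗ₜ[k] e - e ⊗ₜ[k] n) -
        (a * b) • (K ⊗ₜ[k] v - v ⊗ₜ[k] K)) := by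
  rw [hi, hE, hM]
  simp only [tmul_add, add_tmul, tmul_smul, ← smul_tmul']
  module

/-- Passes from K ∧ e to J₃ ∧ e; for a = a₊ and b = β the shift produces the term b₊ J₊ ∧ I. -/
theorem antisymm_add_smul (a b : k) (K e i : A) :
    a • (K ⊗ₜ[k] e - e ⊗ₜ[k] K) = a • ((K + b • i) ⊗ₜ[k] e - e ⊗ₜ[k] (K + b • i)) +
      (a * b) • (e ⊗ₜ[k] i - i ⊗ₜ[k] e) := by
  simp only [tmul_add, add_tmul, tmul_smul, ← smul_tmul']
  module

end Semiclassical

/-- Used to discard h-multiples in the cobracket: what vanishes modulo h contributes nothing modulo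
h² once multiplied by h. -/
theorem HCompl.X_smul_proj_two {C : Type} [Ring C] [Algebra Rh C] {w : HCompl C}
    (h : proj C 1 w = 0) : (PowerSeries.X : Rh) • proj C 2 w = 0 := by
  obtain ⟨c, hc⟩ := exists_rep w 2
  rw [proj_apply, hc 1 one_le_two] at h
  obtain ⟨d, hd⟩ := mem_hPow.1 (Ideal.Quotient.eq_zero_iff_mem.1 h)
  rw [proj_apply, hc 2 le_rfl]
  change Ideal.Quotient.mk (hPow C 2) ((PowerSeries.X : Rh) • c) = 0
  refine Ideal.Quotient.eq_zero_iff_mem.2 (mem_hPow.2 ⟨d, ?_⟩)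
  rw [← hd, pow_one, smul_smul, pow_two]

theorem X_smul_mk_eq {C : Type} [Ring C] [Algebra Rh C] {c d y : C}
    (h : c - d = (PowerSeries.X : Rh) • y) :
    (PowerSeries.X : Rh) • Ideal.Quotient.mk (hPow C 2) c =
      (PowerSeries.X : Rh) • Ideal.Quotient.mk (hPow C 2) d := by
  rw [← sub_eq_zero, ← smul_sub, ← map_sub, h]
  change Ideal.Quotient.mk (hPow C 2) ((PowerSeries.X : Rh) • (PowerSeries.X : Rh) • y) = 0
  exact Ideal.Quotient.eq_zero_iff_mem.2 (mem_hPow.2 ⟨y, by rw [smul_smul, pow_two]⟩)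

/-- A semilinear map to an `ℝ⟦h⟧`-module induces a map of tensor squares. -/
theorem exists_tensorSquare {A : Type} [Ring A] [Algebra Rh A] (g : GL2 →+ A)
    (hg : ∀ (r : ℝ) X, g (r • X) = (PowerSeries.C r : Rh) • g X) :
    ∃ Φ : GL2 ⊗[ℝ] GL2 →+ A ⊗[Rh] A, (∀ X Y, Φ (X ⊗ₜ Y) = g X ⊗ₜ g Y) ∧
      ∀ (r : ℝ) t, Φ (r • t) = (PowerSeries.C r : Rh) • Φ t := by
  let := Module.compHom (A ⊗[Rh] A) (PowerSeries.C : ℝ →+* Rh)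
  let Φ : GL2 ⊗[ℝ] GL2 →ₗ[ℝ] A ⊗[Rh] A := TensorProduct.lift
    (LinearMap.mk₂ ℝ (fun X Y => g X ⊗ₜ[Rh] g Y)
      (fun X X' Y => by rw [map_add, TensorProduct.add_tmul])
      (fun r X Y => by rw [hg, ← TensorProduct.smul_tmul']; rfl)
      (fun X Y Y' => by rw [map_add, TensorProduct.tmul_add])
      (fun r X Y => by rw [hg, TensorProduct.tmul_smul]; rfl))
  exact ⟨Φ.toAddMonoidHom, fun X Y => rfl, fun r t => map_smul Φ r t⟩

namespace QGL2

variable (ap bp : ℝ) [hap : Fact (ap ≠ 0)]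

/-- The reduction modulo `h`. -/
def red : QGL2 ap bp →+* UGL2 :=
  (PowerSeries.constantCoeff).comp (equivSeries ap bp hap.out).toRingEquiv.toRingHom

theorem red_apply (x : QGL2 ap bp) :
    red ap bp x = PowerSeries.constantCoeff (equivSeries ap bp hap.out x) := rfl

theorem red_gen (X : GL2) : red ap bp (gen ap bp X) = UniversalEnvelopingAlgebra.ι ℝ X := by
  rw [red_apply, gen, equivSeries_mk, constantCoeff_toSeries, PowerSeries.constantCoeff_C,
    ← UGL2.lin_eq_ι]
  simp [freeLin, GL2.lin, freeToU]

theorem red_ofU (u : UGL2) : red ap bp (ofU ap bp u) = u := by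
  rw [red_apply, equivSeries_ofU, PowerSeries.constantCoeff_C]

theorem red_smul (s : Rh) (x : QGL2 ap bp) :
    red ap bp (s • x) = PowerSeries.constantCoeff s • red ap bp x := by
  rw [red_apply, red_apply, map_smul, PowerSeries.series_smul_def, map_mul,
    ← PowerSeries.coeff_zero_eq_constantCoeff_apply (PowerSeries.map _ s), PowerSeries.coeff_map,
    PowerSeries.coeff_zero_eq_constantCoeff_apply, Algebra.smul_def]

theorem exists_eq_ofU_add {x : QGL2 ap bp} {u : UGL2} (h : red ap bp x = u) :
    ∃ y, x = ofU ap bp u + (PowerSeries.X : Rh) • y := by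
  obtain ⟨z, hz⟩ := PowerSeries.X_dvd_iff.2
    (show PowerSeries.constantCoeff (equivSeries ap bp hap.out x - PowerSeries.C u) = 0 by
      rw [map_sub, ← red_apply, h, PowerSeries.constantCoeff_C, sub_self])
  refine ⟨(equivSeries ap bp hap.out).symm z, (equivSeries ap bp hap.out).injective ?_⟩
  rw [map_add, map_smul, equivSeries_ofU, AlgEquiv.apply_symm_apply, PowerSeries.X_smul_series,
    ← hz, add_sub_cancel]

theorem ofU_smul (r : ℝ) (u : UGL2) :
    ofU ap bp (r • u) = (PowerSeries.C r : Rh) • ofU ap bp u := by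
  rw [Algebra.smul_def, ofU_mul, ofU_algebraMap, smul_mul_assoc, one_mul]

theorem ofU_ι (X : GL2) : ofU ap bp (UniversalEnvelopingAlgebra.ι ℝ X) =
    (PowerSeries.C ((X 0 0 - X 1 1) / 2) : Rh) • J3 ap bp +
      (PowerSeries.C (X 0 1) : Rh) • e ap bp + (PowerSeries.C (X 1 0) : Rh) • ofU ap bp UGL2.f +
      (PowerSeries.C ((X 0 0 + X 1 1) / 2) : Rh) • I ap bp := by
  rw [← UGL2.lin_eq_ι]
  simp only [GL2.lin, LinearMap.coe_mk, AddHom.coe_mk, ofU_add, ofU_smul, ofU_h, ofU_i]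
  rfl

/-- A linear map to a module killed by `h` that vanishes on the generators vanishes on all
elements that reduce to `gl(2)`. -/
theorem linearMap_eq_zero_of_red {Q : Type} [AddCommGroup Q] [Module Rh Q]
    (hQ : ∀ y : Q, (PowerSeries.X : Rh) • y = 0) (D : QGL2 ap bp →ₗ[Rh] Q)
    (hK : D (K ap bp) = 0) (he : D (e ap bp) = 0) (hM : D (Jm ap bp) = 0) (hI : D (I ap bp) = 0)
    {X : GL2} {x : QGL2 ap bp} (hx : red ap bp x = UniversalEnvelopingAlgebra.ι ℝ X) :
    D x = 0 := by
  obtain ⟨y, rfl⟩ := exists_eq_ofU_add ap bp hx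
  have hf : D (ofU ap bp UGL2.f) = 0 := by
    rw [Jm_eq, map_add, map_smul, q, mul_smul, hQ, add_zero] at hM
    exact hM
  rw [map_add, map_smul, hQ, ofU_ι, J3_eq]
  simp only [map_add, map_smul, hK, he, hf, hI, smul_zero, add_zero]

theorem E_eq : E ap bp = 1 + (PowerSeries.X * PowerSeries.C ap : Rh) • (e ap bp * E ap bp) := by
  rw [← four_mul_q, (qExp' ap bp).qeE, add_sub_cancel]

/-- Iterating E = 1 + h a₊ eE gives an exact second-order remainder without any series. -/
theorem E_eq' : E ap bp = 1 + (PowerSeries.X * PowerSeries.C ap : Rh) • e ap bp +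
    (PowerSeries.X ^ 2 * PowerSeries.C ap ^ 2 : Rh) • (e ap bp * (e ap bp * E ap bp)) := by
  have h := E_eq ap bp
  nth_rewrite 2 [h] at h
  rw [mul_add, mul_one, mul_smul_comm, smul_add, smul_smul, ← mul_pow] at *
  rw [← add_assoc, ← pow_two] at h
  exact h

theorem comul_mod_one {X : GL2} {x : QGL2 ap bp}
    (hx : red ap bp x = UniversalEnvelopingAlgebra.ι ℝ X) :
    HCompl.ModEq 1 (comul ap bp x) (ctmul x 1 + ctmul 1 x) := by
  -- The defect of primitivity, with values in a module killed by h; it is then enough to exhibit on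
  -- each generator the defect as an explicit multiple h w.
  let D : QGL2 ap bp →ₗ[Rh] (QGL2 ap bp ⊗[Rh] QGL2 ap bp) ⧸ hPow (QGL2 ap bp ⊗[Rh] QGL2 ap bp) 1 :=
    (HCompl.proj (QGL2 ap bp ⊗[Rh] QGL2 ap bp) 1).toLinearMap.comp ((comul ap bp).toLinearMap -
      (HCompl.of (QGL2 ap bp ⊗[Rh] QGL2 ap bp)).toLinearMap.comp
        ((TensorProduct.mk Rh (QGL2 ap bp) (QGL2 ap bp)).flip 1 +
          TensorProduct.mk Rh (QGL2 ap bp) (QGL2 ap bp) 1))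
  have key : ∀ {y z w}, comul ap bp y = HCompl.of _ z →
      z - (y ⊗ₜ[Rh] 1 + 1 ⊗ₜ[Rh] y) = (PowerSeries.X : Rh) • w → D y = 0 := by
    intro y z w h hw
    change HCompl.proj _ 1 (comul ap bp y - HCompl.of _ (y ⊗ₜ[Rh] 1 + 1 ⊗ₜ[Rh] y)) = 0
    rw [h, ← map_sub, hw]
    exact Ideal.Quotient.eq_zero_iff_mem.2 (mem_hPow.2 ⟨w, by rw [pow_one]⟩)
  have hE := E_eq ap bp
  have h : D x = 0 := by
    refine linearMap_eq_zero_of_red ap bp (fun y => ?_) D ?_ ?_ ?_ ?_ hx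
    · exact (pow_one (PowerSeries.X : Rh)) ▸ HCompl.X_pow_smul_quotient le_rfl y
    · refine key (w := (PowerSeries.C ap : Rh) • K ap bp ⊗ₜ[Rh] (e ap bp * E ap bp))
        (comul_K ap bp) ?_
      nth_rewrite 1 [hE]
      rw [TensorProduct.tmul_add, TensorProduct.tmul_smul, mul_smul]
      abel
    · refine key (w := -((PowerSeries.C ap : Rh) • e ap bp ⊗ₜ[Rh] e ap bp)) (comul_e ap bp) ?_
      rw [(qExp' ap bp).u_eq, four_mul_q, TensorProduct.tmul_sub, TensorProduct.tmul_smul, mul_smul,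
        smul_neg]
      abel
    · refine key (w := (PowerSeries.C ap : Rh) • Jm ap bp ⊗ₜ[Rh] (e ap bp * E ap bp) -
        (PowerSeries.C (bp / 2) : Rh) • K ap bp ⊗ₜ[Rh] (I ap bp * E ap bp)) (comul_Jm ap bp) ?_
      rw [two_mul_q_mul_β ap bp hap.out]
      nth_rewrite 1 [hE]
      rw [TensorProduct.tmul_add, TensorProduct.tmul_smul, mul_smul, mul_smul, smul_sub]
      abel
    · refine key (w := 0) (comul_I ap bp) ?_
      rw [smul_zero]
      abel
  exact sub_eq_zero.1 h

theorem counit_mod_one {X : GL2} {x : QGL2 ap bp}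
    (hx : red ap bp x = UniversalEnvelopingAlgebra.ι ℝ X) :
    PowerSeries.constantCoeff (counit ap bp x) = 0 := by
  let D : QGL2 ap bp →ₗ[Rh] Rh ⧸ hPow Rh 1 :=
    (Ideal.Quotient.mkₐ Rh (hPow Rh 1)).toLinearMap.comp (counit ap bp).toLinearMap
  have key : ∀ {y}, counit ap bp y = 0 → D y = 0 := fun {y} h => by
    change Ideal.Quotient.mk _ (counit ap bp y) = 0
    rw [h, map_zero]
  have h : D x = 0 := by
    refine linearMap_eq_zero_of_red ap bp (fun y => ?_) D (key (counit_K ap bp))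
      (key (counit_e ap bp)) (key (counit_Jm ap bp)) (key (counit_I ap bp)) hx
    exact (pow_one (PowerSeries.X : Rh)) ▸ HCompl.X_pow_smul_quotient le_rfl y
  obtain ⟨y, hy⟩ := mem_hPow.1 (Ideal.Quotient.eq_zero_iff_mem.1 h)
  have h1 : (PowerSeries.X ^ 1 : Rh) • y = counit ap bp x := hy
  rw [← h1]
  simp

theorem antipode_mod_one {X : GL2} {x : QGL2 ap bp}
    (hx : red ap bp x = UniversalEnvelopingAlgebra.ι ℝ X) :
    red ap bp (antipode ap bp x) = -UniversalEnvelopingAlgebra.ι ℝ X := by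
  let D : QGL2 ap bp →ₗ[Rh] QGL2 ap bp ⧸ hPow (QGL2 ap bp) 1 :=
    (Ideal.Quotient.mkₐ Rh (hPow (QGL2 ap bp) 1)).toLinearMap.comp
      (antipode ap bp + LinearMap.id)
  have key : ∀ {y w}, antipode ap bp y + y = (PowerSeries.X : Rh) • w → D y = 0 := by
    intro y w h
    change Ideal.Quotient.mk _ (antipode ap bp y + y) = 0
    rw [h]
    exact Ideal.Quotient.eq_zero_iff_mem.2 (mem_hPow.2 ⟨w, by rw [pow_one]⟩)
  have hu : u ap bp = 1 - (PowerSeries.X * PowerSeries.C ap : Rh) • e ap bp := by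
    rw [← four_mul_q, ← (qExp' ap bp).u_eq]
  have h : D x = 0 := by
    refine linearMap_eq_zero_of_red ap bp (fun y => ?_) D ?_ ?_ ?_ ?_ hx
    · exact (pow_one (PowerSeries.X : Rh)) ▸ HCompl.X_pow_smul_quotient le_rfl y
    · refine key (w := (PowerSeries.C ap : Rh) • (K ap bp * e ap bp)) ?_
      rw [antipode_K, hu, mul_sub, mul_one, mul_smul_comm, mul_smul]
      abel
    · refine key (w := -((PowerSeries.C ap : Rh) • (e ap bp * (e ap bp * E ap bp)))) ?_
      rw [antipode_e]
      nth_rewrite 1 [E_eq]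
      rw [mul_add, mul_one, mul_smul_comm, mul_smul, smul_neg]
      abel
    · refine key (w := (PowerSeries.C ap : Rh) • (Jm ap bp * e ap bp) -
        (PowerSeries.C (bp / 2) : Rh) • (I ap bp * (K ap bp * u ap bp))) ?_
      rw [antipode_Jm, two_mul_q_mul_β ap bp hap.out]
      nth_rewrite 1 [hu]
      rw [mul_sub, mul_one, mul_smul_comm, mul_smul, mul_smul, smul_sub]
      abel
    · refine key (w := 0) ?_
      rw [antipode_I, smul_zero, neg_add_cancel]
  obtain ⟨y, hy⟩ := mem_hPow.1 (Ideal.Quotient.eq_zero_iff_mem.1 h)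
  have h1 : red ap bp (antipode ap bp x) + red ap bp x = 0 := by
    rw [← map_add]
    refine (congrArg (red ap bp) hy.symm).trans ?_
    rw [red_smul]
    simp
  rw [hx] at h1
  exact eq_neg_of_add_eq_zero_left h1

/-- The opposite coproduct. -/
def comulOp : QGL2 ap bp →ₐ[Rh] CTensor (QGL2 ap bp) (QGL2 ap bp) :=
  (HCompl.extendAlg ((HCompl.of _).comp
    (Algebra.TensorProduct.comm Rh (QGL2 ap bp) (QGL2 ap bp)).toAlgHom)).comp (comul ap bp)

theorem comulOp_of {x : QGL2 ap bp} {z : QGL2 ap bp ⊗[Rh] QGL2 ap bp}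
    (h : comul ap bp x = HCompl.of _ z) :
    comulOp ap bp x = HCompl.of _ (TensorProduct.comm Rh _ _ z) := by
  change HCompl.extend _ (comul ap bp x) = _
  rw [h, HCompl.extend_of]
  rfl

/-- The antisymmetrized coproduct modulo `h²`. -/
def cobracket : QGL2 ap bp →ₗ[Rh]
    (QGL2 ap bp ⊗[Rh] QGL2 ap bp) ⧸ hPow (QGL2 ap bp ⊗[Rh] QGL2 ap bp) 2 :=
  (HCompl.proj (QGL2 ap bp ⊗[Rh] QGL2 ap bp) 2).toLinearMap.comp
    ((comul ap bp).toLinearMap - (comulOp ap bp).toLinearMap)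

theorem cobracket_apply (x : QGL2 ap bp) : cobracket ap bp x =
    HCompl.proj (QGL2 ap bp ⊗[Rh] QGL2 ap bp) 2 (comul ap bp x - comulOp ap bp x) := rfl

theorem cobracket_of {x : QGL2 ap bp} {z t w : QGL2 ap bp ⊗[Rh] QGL2 ap bp}
    (h : comul ap bp x = HCompl.of _ z)
    (hw : z - TensorProduct.comm Rh _ _ z - (PowerSeries.X : Rh) • t =
      (PowerSeries.X ^ 2 : Rh) • w) :
    cobracket ap bp x = (PowerSeries.X : Rh) • Ideal.Quotient.mk _ t := by
  rw [cobracket_apply, h, comulOp_of ap bp h, ← map_sub]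
  change Ideal.Quotient.mk _ _ = Ideal.Quotient.mk _ ((PowerSeries.X : Rh) • t)
  exact Ideal.Quotient.eq.2 (mem_hPow.2 ⟨w, hw.symm⟩)

theorem cobracket_K : cobracket ap bp (K ap bp) = (PowerSeries.X : Rh) • Ideal.Quotient.mk _
    ((PowerSeries.C ap : Rh) • (K ap bp ⊗ₜ[Rh] e ap bp - e ap bp ⊗ₜ[Rh] K ap bp)) :=
  cobracket_of ap bp (comul_K ap bp) (antisymm_skew (E_eq' ap bp))

theorem comulOp_e : comul ap bp (e ap bp) = comulOp ap bp (e ap bp) := by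
  rw [comulOp_of ap bp (comul_e ap bp), comul_e]
  congr 1
  change _ = e ap bp ⊗ₜ[Rh] 1 + u ap bp ⊗ₜ[Rh] e ap bp
  rw [(qExp' ap bp).u_eq, TensorProduct.tmul_sub, TensorProduct.sub_tmul, TensorProduct.tmul_smul,
    ← TensorProduct.smul_tmul']
  abel

theorem comulOp_I : comul ap bp (I ap bp) = comulOp ap bp (I ap bp) := by
  rw [comulOp_of ap bp (comul_I ap bp), comul_I]
  congr 1
  exact add_comm (1 ⊗ₜ[Rh] I ap bp) (I ap bp ⊗ₜ[Rh] 1)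

theorem cobracket_e : cobracket ap bp (e ap bp) = 0 := by
  rw [cobracket_apply, comulOp_e, sub_self, map_zero]

theorem cobracket_I : cobracket ap bp (I ap bp) = 0 := by
  rw [cobracket_apply, comulOp_I, sub_self, map_zero]

theorem antisymm_comul_Jm : ∃ z w : QGL2 ap bp ⊗[Rh] QGL2 ap bp,
    comul ap bp (Jm ap bp) = HCompl.of _ z ∧
      z - TensorProduct.comm Rh _ _ z - (PowerSeries.X : Rh) •
        (-((PowerSeries.C ap : Rh) • (e ap bp ⊗ₜ[Rh] ofU ap bp UGL2.f -
          ofU ap bp UGL2.f ⊗ₜ[Rh] e ap bp)) - (PowerSeries.C (bp / 2) : Rh) •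
            (K ap bp ⊗ₜ[Rh] I ap bp - I ap bp ⊗ₜ[Rh] K ap bp)) =
        (PowerSeries.X ^ 2 : Rh) • w := by
  have hIE : I ap bp * E ap bp = I ap bp + (PowerSeries.X * PowerSeries.C ap : Rh) •
      (I ap bp * (e ap bp * E ap bp)) := by
    nth_rewrite 1 [E_eq]
    rw [mul_add, mul_one, mul_smul_comm]
  have h := comul_Jm ap bp
  rw [two_mul_q_mul_β ap bp hap.out] at h
  refine ⟨_, _, h, Eq.trans ?_ (antisymm_comodule (b := PowerSeries.C (bp / 2)) (K := K ap bp)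
    (E_eq' ap bp) (Jm_eq ap bp) hIE)⟩
  rw [map_sub, map_add, map_smul]
  rfl

theorem cobracket_Jm : cobracket ap bp (Jm ap bp) = (PowerSeries.X : Rh) • Ideal.Quotient.mk _
    (-((PowerSeries.C ap : Rh) • (e ap bp ⊗ₜ[Rh] ofU ap bp UGL2.f -
      ofU ap bp UGL2.f ⊗ₜ[Rh] e ap bp)) -
      (PowerSeries.C (bp / 2) : Rh) • (K ap bp ⊗ₜ[Rh] I ap bp - I ap bp ⊗ₜ[Rh] K ap bp)) := by
  obtain ⟨z, w, h, hw⟩ := antisymm_comul_Jm ap bp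
  exact cobracket_of ap bp h hw

/-- Cocommutativity modulo h. It holds on generators, and Δ and σΔ are both algebra homomorphisms,
so it holds everywhere; it is needed for arbitrary x to ignore the choice of lifts. -/
theorem proj_one_comulOp (x : QGL2 ap bp) :
    HCompl.proj (QGL2 ap bp ⊗[Rh] QGL2 ap bp) 1 (comul ap bp x - comulOp ap bp x) = 0 := by
  suffices h : (HCompl.proj (QGL2 ap bp ⊗[Rh] QGL2 ap bp) 1).comp (comul ap bp) =
      (HCompl.proj (QGL2 ap bp ⊗[Rh] QGL2 ap bp) 1).comp (comulOp ap bp) by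
    rw [map_sub, sub_eq_zero]
    exact DFunLike.congr_fun h x
  have key : ∀ {y z t w}, comul ap bp y = HCompl.of _ z →
      z - TensorProduct.comm Rh _ _ z - (PowerSeries.X : Rh) • t = (PowerSeries.X ^ 2 : Rh) • w →
      (HCompl.proj (QGL2 ap bp ⊗[Rh] QGL2 ap bp) 1).comp (comul ap bp) y =
      (HCompl.proj (QGL2 ap bp ⊗[Rh] QGL2 ap bp) 1).comp (comulOp ap bp) y := by
    intro y z t w h hw
    change HCompl.proj _ 1 (comul ap bp y) = HCompl.proj _ 1 (comulOp ap bp y)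
    rw [h, comulOp_of ap bp h]
    refine Ideal.Quotient.eq.2 (mem_hPow.2 ⟨t + (PowerSeries.X : Rh) • w, ?_⟩)
    rw [pow_one, smul_add, smul_smul, ← pow_two, ← hw, add_sub_cancel]
  refine algHom_ext ap bp (key (comul_K ap bp) (antisymm_skew (E_eq' ap bp))) ?_ ?_ ?_
  · exact congrArg (HCompl.proj (QGL2 ap bp ⊗[Rh] QGL2 ap bp) 1) (comulOp_e ap bp)
  · obtain ⟨z, w, h, hw⟩ := antisymm_comul_Jm ap bp
    exact key h hw
  · exact congrArg (HCompl.proj (QGL2 ap bp ⊗[Rh] QGL2 ap bp) 1) (comulOp_I ap bp)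

theorem cobracket_ofU (Φ : GL2 ⊗[ℝ] GL2 →+ QGL2 ap bp ⊗[Rh] QGL2 ap bp)
    (hΦ : ∀ X Y, Φ (X ⊗ₜ Y) = ofU ap bp (UniversalEnvelopingAlgebra.ι ℝ X) ⊗ₜ[Rh]
      ofU ap bp (UniversalEnvelopingAlgebra.ι ℝ Y))
    (hΦ' : ∀ (r : ℝ) t, Φ (r • t) = (PowerSeries.C r : Rh) • Φ t) (X : GL2) :
    cobracket ap bp (ofU ap bp (UniversalEnvelopingAlgebra.ι ℝ X)) =
      (PowerSeries.X : Rh) • Ideal.Quotient.mk _ (Φ (GL2.cocommutatorIplus ap bp 0 X)) := by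
  have hw : ∀ X Y, Φ (wedge X Y) = ofU ap bp (UniversalEnvelopingAlgebra.ι ℝ X) ⊗ₜ[Rh]
      ofU ap bp (UniversalEnvelopingAlgebra.ι ℝ Y) - ofU ap bp (UniversalEnvelopingAlgebra.ι ℝ Y)
      ⊗ₜ[Rh] ofU ap bp (UniversalEnvelopingAlgebra.ι ℝ X) := fun X Y => by
    rw [wedge, map_sub, hΦ, hΦ]
  have h3 : ofU ap bp (UniversalEnvelopingAlgebra.ι ℝ GL2.J3) = J3 ap bp := ofU_h ap bp
  have hp : ofU ap bp (UniversalEnvelopingAlgebra.ι ℝ GL2.Jp) = e ap bp := rfl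
  have hm : ofU ap bp (UniversalEnvelopingAlgebra.ι ℝ GL2.Jm) = ofU ap bp UGL2.f := rfl
  have hi : ofU ap bp (UniversalEnvelopingAlgebra.ι ℝ GL2.I) = I ap bp := ofU_i ap bp
  have hC : (PowerSeries.C ap : Rh) * β ap bp = PowerSeries.C bp := by
    rw [β, ← map_mul, mul_div_cancel₀ _ hap.out]
  have hJ3 : cobracket ap bp (J3 ap bp) = (PowerSeries.X : Rh) • Ideal.Quotient.mk _
      (Φ (ap • wedge GL2.J3 GL2.Jp + bp • wedge GL2.Jp GL2.I)) := by
    rw [map_add Φ, hΦ', hΦ', hw, hw, h3, hp, hi, ← hC, J3_eq, map_add, map_smul, cobracket_I,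
      smul_zero, add_zero, cobracket_K]
    congr 2
    exact antisymm_add_smul _ _ _ _ _
  have hf : cobracket ap bp (ofU ap bp UGL2.f) = (PowerSeries.X : Rh) • Ideal.Quotient.mk _
      (Φ (-(ap • wedge GL2.Jp GL2.Jm) - (bp / 2) • wedge GL2.J3 GL2.I)) := by
    have h1 := cobracket_Jm ap bp
    nth_rewrite 1 [Jm_eq] at h1
    -- The correction qK² carries a factor h, and Δ - σΔ is already divisible by h, so f and J₋ have
    -- the same cobracket modulo h².
    rw [map_add, map_smul, q, mul_comm, mul_smul, cobracket_apply ap bp (K ap bp ^ 2),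
      HCompl.X_smul_proj_two (proj_one_comulOp ap bp _), smul_zero, add_zero] at h1
    rw [h1, map_sub Φ, map_neg Φ, hΦ', hΦ', hw, hw, h3, hp, hm, hi, J3_eq]
    congr 3
    simp only [TensorProduct.tmul_add, TensorProduct.add_tmul, TensorProduct.tmul_smul,
      ← TensorProduct.smul_tmul']
    congr 1
    abel
  have hlin : ∀ (c d : ℝ) (s t : GL2 ⊗[ℝ] GL2), (PowerSeries.C c : Rh) • (PowerSeries.X : Rh) •
      Ideal.Quotient.mk (hPow (QGL2 ap bp ⊗[Rh] QGL2 ap bp) 2) (Φ s) +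
      (PowerSeries.C d : Rh) • (PowerSeries.X : Rh) •
        Ideal.Quotient.mk (hPow (QGL2 ap bp ⊗[Rh] QGL2 ap bp) 2) (Φ t) =
      (PowerSeries.X : Rh) • Ideal.Quotient.mk _ (Φ (c • s + d • t)) := fun c d s t => by
    rw [map_add Φ, hΦ', hΦ', map_add, smul_add, smul_comm, smul_comm (PowerSeries.C d : Rh)]
    rfl
  rw [ofU_ι, map_add, map_add, map_add, map_smul, map_smul, map_smul, map_smul, cobracket_e,
    cobracket_I, hJ3, hf, GL2.cocommutatorIplus_eq]
  simp only [GL2.lin, LinearMap.coe_mk, AddHom.coe_mk]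
  rw [smul_zero, smul_zero, smul_zero, smul_zero, add_zero, add_zero, add_zero, add_zero]
  exact hlin _ _ _ _

theorem semiclassical {X : GL2} {x : QGL2 ap bp}
    (hx : red ap bp x = UniversalEnvelopingAlgebra.ι ℝ X) (k : ℕ) (Y Z : Fin k → GL2)
    (y z : Fin k → QGL2 ap bp)
    (hδ : GL2.cocommutatorIplus ap bp 0 X = ∑ i, Y i ⊗ₜ[ℝ] Z i)
    (hy : ∀ i, red ap bp (y i) = UniversalEnvelopingAlgebra.ι ℝ (Y i))
    (hz : ∀ i, red ap bp (z i) = UniversalEnvelopingAlgebra.ι ℝ (Z i)) :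
    HCompl.ModEq 2 (comul ap bp x - comulOp ap bp x)
      ((PowerSeries.X : Rh) • ∑ i, ctmul (y i) (z i)) := by
  obtain ⟨Φ, hΦ, hΦ'⟩ := exists_tensorSquare
    (A := QGL2 ap bp) (AddMonoidHom.mk' (fun X => ofU ap bp (UniversalEnvelopingAlgebra.ι ℝ X))
      fun X Y => by rw [map_add, ofU_add]) fun r X => by
        change ofU ap bp _ = _ • ofU ap bp _
        rw [map_smul, ofU_smul]
  change cobracket ap bp x = HCompl.proj (QGL2 ap bp ⊗[Rh] QGL2 ap bp) 2
    ((PowerSeries.X : Rh) • ∑ i, ctmul (y i) (z i))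
  obtain ⟨w, rfl⟩ := exists_eq_ofU_add ap bp hx
  rw [map_add, map_smul, cobracket_apply ap bp w, HCompl.X_smul_proj_two (proj_one_comulOp ap bp w),
    add_zero, cobracket_ofU ap bp Φ hΦ hΦ', hδ, map_sum, map_sum, map_smul, map_sum, Finset.smul_sum,
    Finset.smul_sum]
  -- Replacing the lifts y, z by the standard ones changes each tensor by a multiple of h, invisible
  -- modulo h² after the outer factor h.
  refine Finset.sum_congr rfl fun i _ => ?_
  obtain ⟨v, hv⟩ := exists_eq_ofU_add ap bp (hy i)
  obtain ⟨w, hw⟩ := exists_eq_ofU_add ap bp (hz i)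
  rw [hΦ]
  refine (X_smul_mk_eq (y := v ⊗ₜ[Rh] z i + ofU ap bp (UniversalEnvelopingAlgebra.ι ℝ (Y i)) ⊗ₜ[Rh]
    w) ?_).symm
  change y i ⊗ₜ[Rh] z i - ofU ap bp _ ⊗ₜ[Rh] ofU ap bp _ = _
  nth_rewrite 1 [hv]
  rw [TensorProduct.add_tmul, smul_add, TensorProduct.smul_tmul', ← TensorProduct.tmul_smul]
  nth_rewrite 1 [hw]
  rw [TensorProduct.tmul_add]
  abel

theorem isQuantization :
    IsQuantization (GL2.cocommutatorIplus ap bp 0) (hopf ap bp) (red ap bp) where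
  flat := ⟨(equivSeries ap bp hap.out).toAddEquiv,
    fun s x => map_smul (equivSeries ap bp hap.out) s x, fun _ => rfl⟩
  comul_zero _ _ hx := comul_mod_one ap bp hx
  counit_zero _ _ hx := counit_mod_one ap bp hx
  antipode_zero _ _ hx := antipode_mod_one ap bp hx
  semiclassical _ _ hx k Y Z y z hδ hy hz := semiclassical ap bp hx k Y Z y z hδ hy hz

theorem red_casimir : red ap bp (casimir ap bp) =
    UniversalEnvelopingAlgebra.ι ℝ GL2.J3 ^ 2 +
      (2 : ℝ) • (UniversalEnvelopingAlgebra.ι ℝ GL2.Jp * UniversalEnvelopingAlgebra.ι ℝ GL2.Jm) +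
      (2 : ℝ) • (UniversalEnvelopingAlgebra.ι ℝ GL2.Jm * UniversalEnvelopingAlgebra.ι ℝ GL2.Jp) +
      (bp / ap) ^ 2 • UniversalEnvelopingAlgebra.ι ℝ GL2.I ^ 2 := by
  have h2 : (2 : Rh) = PowerSeries.C 2 := (map_ofNat (PowerSeries.C (R := ℝ)) 2).symm
  rw [casimir_eq, e, ← ofU_h, ← ofU_i, h2, β, ← map_pow]
  simp only [map_add, map_mul, map_pow, red_smul, red_ofU, PowerSeries.constantCoeff_C]
  rfl

end QGL2

end

theorem mainTheorem6 (ap bp : ℝ) (hap : ap ≠ 0) :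
    -- the non-standard Lie bialgebra of family I₊ with `a = 0`
    (IsLieBialgebra (GL2.cocommutatorIplus ap bp 0) ∧
      (∀ X, GL2.cocommutatorIplus ap bp 0 X = ⁅X, GL2.rMatrix ap bp⁆) ∧
      GL2.CYBE (GL2.rMatrix ap bp)) ∧
    -- its cocommutator matrix
    (∀ i, GL2.cocommutatorIplus ap bp 0 (GL2.pair ap bp i) =
      ∑ j, wedge (GL2.cocommMatrix ap bp i j) (GL2.pair ap bp j)) ∧
    -- the deformed Casimir is central
    (∀ x : QGL2 ap bp, QGL2.casimir ap bp * x = x * QGL2.casimir ap bp) ∧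
    -- the Hopf structure
    ∃ T : TopHopf (QGL2 ap bp),
      -- `J₊` and `I` are primitive
      T.comul (QGL2.Jp ap bp) = ctmul 1 (QGL2.Jp ap bp) + ctmul (QGL2.Jp ap bp) 1 ∧
      T.comul (QGL2.I ap bp) = ctmul 1 (QGL2.I ap bp) + ctmul (QGL2.I ap bp) 1 ∧
      -- the coproduct of `J₃' , J₋` is the exponential of the cocommutator matrix
      (∀ i, T.comul (QGL2.gen ap bp (GL2.pair ap bp i)) =
        ctmul 1 (QGL2.gen ap bp (GL2.pair ap bp i)) +
          ∑ j, ctmul (QGL2.gen ap bp (GL2.pair ap bp j))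
            (QGL2.expMatrix ap bp (-GL2.cocommMatrix ap bp) i j)) ∧
      -- the coproduct in the original basis
      T.comul (QGL2.J3 ap bp) = ctmul 1 (QGL2.J3 ap bp) +
        ctmul (QGL2.J3 ap bp) (QGL2.expJp ap bp ap) -
        ctmul (bp • QGL2.I ap bp) (ap⁻¹ • (QGL2.expJp ap bp ap - 1)) ∧
      T.comul (QGL2.Jm ap bp) = ctmul 1 (QGL2.Jm ap bp) +
        ctmul (QGL2.Jm ap bp) (QGL2.expJp ap bp ap) -
        (PowerSeries.X : Rh) • ctmul ((bp / 2) • (QGL2.J3 ap bp - (bp / ap) • QGL2.I ap bp))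
          (QGL2.I ap bp * QGL2.expJp ap bp ap) ∧
      -- the counit is trivial
      (∀ X : GL2, T.counit (QGL2.gen ap bp X) = 0) ∧
      -- it is a quantization of the Lie bialgebra, with the generators reducing to those of gl(2)
      ∃ p : QGL2 ap bp →+* UniversalEnvelopingAlgebra ℝ GL2,
        (∀ X : GL2, p (QGL2.gen ap bp X) = UniversalEnvelopingAlgebra.ι ℝ X) ∧
        IsQuantization (GL2.cocommutatorIplus ap bp 0) T p ∧
        -- the deformed Casimir reduces to the Casimir of gl(2), up to a multiple of `I²`
        p (QGL2.casimir ap bp) =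
          UniversalEnvelopingAlgebra.ι ℝ GL2.J3 ^ 2 +
          (2 : ℝ) • (UniversalEnvelopingAlgebra.ι ℝ GL2.Jp * UniversalEnvelopingAlgebra.ι ℝ GL2.Jm) +
          (2 : ℝ) • (UniversalEnvelopingAlgebra.ι ℝ GL2.Jm * UniversalEnvelopingAlgebra.ι ℝ GL2.Jp) +
          (bp / ap) ^ 2 • UniversalEnvelopingAlgebra.ι ℝ GL2.I ^ 2 := by
  have : Fact (ap ≠ 0) := ⟨hap⟩
  refine ⟨⟨GL2.isLieBialgebra ap bp, GL2.cocommutatorIplus_coboundary ap bp,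
    GL2.rMatrix_cybe ap bp⟩, GL2.cocommutatorIplus_pair ap bp hap, QGL2.casimir_central ap bp,
    QGL2.hopf ap bp, QGL2.comul_Jp ap bp, QGL2.comul_I ap bp, QGL2.comul_pair ap bp,
    QGL2.comul_J3 ap bp, QGL2.comul_Jm' ap bp, QGL2.counit_gen ap bp, QGL2.red ap bp,
    QGL2.red_gen ap bp, QGL2.isQuantization ap bp, QGL2.red_casimir ap bp⟩
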